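/- **Setting.** For $m\in\mathbb R^p$, a positive definite $p\times p$ matrix $\Sigma_0$ and a real random variable $r$ with $E r^2=p$, let $EC_p(m,\Sigma_0,r)$ be the law of $m+r\Sigma_0^{1/2}u$, where $u$ is uniform on the unit sphere of $\mathbb R^p$ and independent of $r$. Put $V_0=\frac{\operatorname{tr}\Sigma_0}{p}\Sigma_0^{-1}$. For a matrix $A$ write $\|A\|_\infty=\max_{i,j}|a_{ij}|$, $\|A\|_1=\sum_{i,j}|a_{ij}|$, $\|A\|_{L_1}=\max_j\sum_i|a_{ij}|$. Let $U(x)=x/\|x\|_2$ for $x\ne0$, $U(0)=0$. There are $n=n_0+n_1$ independent observations, $n_0$ of them from $EC_p(\mu_0,\Sigma_0,r)$ (class 0) and $n_1$ from $EC_p(\mu_1,\Sigma_0,r)$ (class 1), the classes being roughly balanced: $n_0,n_1\ge n/3$. Let $\mu_d=(\mu_1-\mu_0)/2$. For $k=0,1$ let $\hat\mu_k$ be a spatial median of class $k$ (a minimizer of $m\mapsto\sum_i\|X_i-m\|_2$ over the observations of the class), let $\hat S_k$ be the average of $U(X_i-\hat\mu_k)U(X_i-\hat\mu_k)^\top$ over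 the class, $\hat S_{pool}=\frac{n_0}{n}\hat S_0+\frac{n_1}{n}\hat S_1$ and $\hat\mu_d=(\hat\mu_1-\hat\mu_0)/2$. Let $\hat V^1$ be a solution of $$\min\|V\|_1\quad\text{subject to}\quad\|p\hat S_{pool}V-I_p\|_\infty\le\lambda_n,\qquad V\in\mathbb R^{p\times p},$$ and let the SCLIME $\hat V$ be the symmetric matrix with $\hat v_{ij}=\hat v_{ji}$ equal to $\hat v^1_{ij}$ if $|\hat v^1_{ij}|\le|\hat v^1_{ji}|$ and to $\hat v^1_{ji}$ otherwise ($i\le j$). **Assumptions.** Let $c_0,\eta,T,M,\zeta,\psi,K_\nu>0$ and $M^*\ge0$ be constants. 1. $\|V_0\|_{L_1}\le T$ and $\max_i\sum_j|v_{ij}|^q\le s_0(p)$ for some $0\le q<1$, $s_0(p)>0$. 2. All eigenvalues of $\Sigma_0$ lie in $(\eta,1/\eta)$, $\|\Sigma_0\|_\infty<M$, and $c_0p\le\operatorname{tr}\Sigma_0\le p/c_0$. 3. For $X\sim EC_p(\mu_k,\Sigma_0,r)$ let $\xi=\|X-\mu_k\|_2$, $\zeta_j=E\xi^{-j}$, $\nu=\zeta_1^{-1}\xi^{-1}$,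 $S=E\,U(X-\mu_k)U(X-\mu_k)^\top$ ($\zeta_j$ and $S$ do not depend on $k$). Then $\zeta_j<\infty$ and $\zeta_j\zeta_1^{-j}<\zeta$ for $j=1,2,3,4$; $\|S\|_{op}<1-\psi$; and $\sup_{k\ge1}k^{-1/2}(E\nu^k)^{1/k}\le K_\nu$ ($k$ integer). 4. $\|\mu_d\|_1\le M^*$. **Theorem.** There are an absolute constant $C_*>0$, a constant $C>0$ depending only on $\zeta,\psi,K_\nu$, and a constant $D=C_{c_0,\eta,T,M}>0$ depending only on $c_0,\eta,T,M$, such that with $$\lambda_n=T\left(\frac{2C(8+\eta^2D)}{\eta^2}\sqrt{\frac{\log p}{n}}+\frac{D}{\sqrt p}\right)$$ the following holds under assumptions 1–4. (i) There are $N$ and $K$, depending only on $c_0,\eta,T,M,\zeta,\psi,K_\nu,M^*$, such that for all $n,p\ge N$ with $n>(3\log p)^{1/3}$, with probability greater than $1-4p^{-2}$ the estimators exist and, whichever minimizers are chosen, $$\|\hat V\hat\mu_d-V_0\mu_d\|_\infty\le\left(\frac{2\sqrt6\,TC_*}{\zeta_1\eta^2}+\frac{8M^*T^2C_*C(8+\eta^2D)}{\eta^2}\right)\sqrt{\frac{\log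 p}{n}}+\frac{4M^*T^2C_*D}{\sqrt p}$$ and $$\|\hat V\hat\mu_d-V_0\mu_d\|_\infty\le K\left(\sqrt{\frac{\log p}{n}}+\frac1{\sqrt p}\right).$$ (ii) Hence $\hat V\hat\mu_d$ is a consistent estimator of the Fisher direction $V_0\mu_d\propto\Sigma_0^{-1}\mu_d$: for every $\varepsilon>0$ there are $N$ and $\delta>0$, depending only on $\varepsilon$ and the constants above, such that whenever $n,p\ge N$ and $\frac{\log p}{n}\le\delta$, with probability at least $1-\varepsilon$ the estimators exist and $\|\hat V\hat\mu_d-V_0\mu_d\|_\infty\le\varepsilon$ for every choice of minimizers. -/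

import Mathlib

open MeasureTheory ProbabilityTheory
open scoped ENNReal Matrix MatrixOrder

noncomputable section

/-! ### Norms -/

/-- Elementwise maximum norm `max_{i,j} |a_{ij}|`. -/
def maxNorm {p : ℕ} (A : Matrix (Fin p) (Fin p) ℝ) : ℝ :=
  ⨆ i : Fin p, ⨆ j : Fin p, |A i j|

/-- Matrix `ℓ₁` norm: the largest absolute column sum. -/
def colSumNorm {p : ℕ} (A : Matrix (Fin p) (Fin p) ℝ) : ℝ :=
  ⨆ j : Fin p, ∑ i, |A i j|

/-- Elementwise `ℓ₁` norm `∑_{i,j} |a_{ij}|`. -/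
def entrySum {p : ℕ} (A : Matrix (Fin p) (Fin p) ℝ) : ℝ := ∑ i, ∑ j, |A i j|

/-- The sub-Gaussian norm `sup_{k ≥ 1} k^{-1/2} (E |f|^k)^{1/k}`, as an extended real. -/
def psi2Norm {α : Type*} [MeasurableSpace α] (f : α → ℝ) (L : Measure α) : ℝ≥0∞ :=
  ⨆ k : ℕ, ⨆ _ : 1 ≤ k, ENNReal.ofReal ((k : ℝ) ^ (-(1 / 2) : ℝ)) * eLpNorm f (k : ℝ≥0∞) L

/-! ### Elliptical distributions -/

/-- The uniform distribution on the unit sphere of `ℝ^p`, as a measure on `ℝ^p`. -/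
def sphereUniform (p : ℕ) : Measure (EuclideanSpace ℝ (Fin p)) :=
  (((volume : Measure (EuclideanSpace ℝ (Fin p))).toSphere Set.univ)⁻¹ •
    (volume : Measure (EuclideanSpace ℝ (Fin p))).toSphere).map Subtype.val

/-- `EC_p(m, Sig, r)`: the law of `m + r Sig^{1/2} u`, where `r` has law `rho`, `u` is uniform on
the unit sphere, and `r`, `u` are independent. `CFC.sqrt Sig` is the positive semidefinite square
root of `Sig`. -/
def ellipticalLaw {p : ℕ} (m : EuclideanSpace ℝ (Fin p)) (Sig : Matrix (Fin p) (Fin p) ℝ)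
    (rho : Measure ℝ) : Measure (EuclideanSpace ℝ (Fin p)) :=
  (rho.prod (sphereUniform p)).map
    (fun z => m + z.1 • Matrix.toEuclideanCLM (n := Fin p) (𝕜 := ℝ) (CFC.sqrt Sig) z.2)

/-- `V₀ = (tr Sig / p) Sig⁻¹`, the inverse of the shape matrix `(p / tr Sig) Sig`. -/
def shapePrecision {p : ℕ} (Sig : Matrix (Fin p) (Fin p) ℝ) : Matrix (Fin p) (Fin p) ℝ :=
  (Sig.trace / p) • Sig⁻¹

/-- The spatial sign `U(x) = x / ‖x‖`, with `U(0) = 0`. -/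
def spatialSign {p : ℕ} (x : EuclideanSpace ℝ (Fin p)) : EuclideanSpace ℝ (Fin p) := ‖x‖⁻¹ • x

/-- The outer product `U(x) U(x)ᵀ`. -/
def signOuter {p : ℕ} (x : EuclideanSpace ℝ (Fin p)) : Matrix (Fin p) (Fin p) ℝ :=
  Matrix.of fun i j => spatialSign x i * spatialSign x j

/-- The population spatial-sign covariance matrix `E U(X - m) U(X - m)ᵀ` of a law `L`. -/
def signCov {p : ℕ} (L : Measure (EuclideanSpace ℝ (Fin p))) (m : EuclideanSpace ℝ (Fin p)) :
    Matrix (Fin p) (Fin p) ℝ :=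
  Matrix.of fun i j => ∫ x, signOuter (x - m) i j ∂L

/-- `ζ_k = E ‖X - m‖^{-k}` for `X` of law `L` (used together with integrability and
`X ≠ m` almost surely). -/
def invMoment {p : ℕ} (L : Measure (EuclideanSpace ℝ (Fin p))) (m : EuclideanSpace ℝ (Fin p))
    (k : ℕ) : ℝ :=
  ∫ x, (‖x - m‖⁻¹) ^ k ∂L

/-- `ζ₁` of an elliptical distribution `EC_p(m, Sig, r)`; it does not depend on `m`. -/
def zetaOne {p : ℕ} (Sig : Matrix (Fin p) (Fin p) ℝ) (rho : Measure ℝ) : ℝ :=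
  invMoment (ellipticalLaw (0 : EuclideanSpace ℝ (Fin p)) Sig rho) 0 1

/-! ### Assumptions on the population -/

/-- The scatter matrix `Sig` is positive definite with
`‖V₀‖_{L₁} ≤ T`, `max_i ∑_j |v_{ij}|^q ≤ s₀` (with `0^q = 0`), eigenvalues in `(η, 1/η)`,
`‖Sig‖_∞ < M` and `c₀ p ≤ tr Sig ≤ p / c₀`. -/
structure ScatterAssumptions {p : ℕ} (Sig : Matrix (Fin p) (Fin p) ℝ)
    (c₀ η T M q s₀ : ℝ) : Prop where
  posDef : Sig.PosDef
  colSum_le : colSumNorm (shapePrecision Sig) ≤ T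
  sparse : ∀ i, ∑ j, (if shapePrecision Sig i j = 0 then 0
    else |shapePrecision Sig i j| ^ q) ≤ s₀
  eig : ∀ i, η < posDef.isHermitian.eigenvalues i ∧ posDef.isHermitian.eigenvalues i < 1 / η
  maxNorm_lt : maxNorm Sig < M
  trace_ge : c₀ * p ≤ Sig.trace
  trace_le : Sig.trace ≤ p / c₀

/-- Assumptions on a distribution `L` on `ℝ^p` with centre `m`, where `ξ = ‖X - m‖`,
`ζ_k = E ξ^{-k}` and `ν = ζ₁^{-1} ξ^{-1}`. -/
structure RadiusAssumptions {p : ℕ} (L : Measure (EuclideanSpace ℝ (Fin p)))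
    (m : EuclideanSpace ℝ (Fin p)) (ζ ψ Kν : ℝ) : Prop where
  ne_center : ∀ᵐ x ∂L, x ≠ m
  integrable : ∀ k ∈ Finset.Icc 1 4, Integrable (fun x => (‖x - m‖⁻¹) ^ k) L
  moment_ratio : ∀ k ∈ Finset.Icc 1 4, invMoment L m k * (invMoment L m 1 ^ k)⁻¹ < ζ
  opNorm_lt : ‖Matrix.toEuclideanCLM (n := Fin p) (𝕜 := ℝ) (signCov L m)‖ < 1 - ψ
  subGaussian : psi2Norm (fun x => (invMoment L m 1)⁻¹ * ‖x - m‖⁻¹) L ≤ ENNReal.ofReal Kν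

/-- The two-class elliptical model with centres `m₀`, `m₁`, common scatter matrix `Sig` and common
law `rho` of the generating variate `r` with `E r² = p`; `‖(m₁ - m₀) / 2‖₁ ≤ Mstar`. -/
structure TwoClassModel {p : ℕ} (m₀ m₁ : EuclideanSpace ℝ (Fin p))
    (Sig : Matrix (Fin p) (Fin p) ℝ) (rho : Measure ℝ)
    (c₀ η T M q s₀ ζ ψ Kν Mstar : ℝ) : Prop where
  prob : IsProbabilityMeasure rho
  second_moment_integrable : Integrable (fun r : ℝ => r ^ 2) rho
  second_moment : ∫ r, r ^ 2 ∂rho = p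
  scatter : ScatterAssumptions Sig c₀ η T M q s₀
  radius₀ : RadiusAssumptions (ellipticalLaw m₀ Sig rho) m₀ ζ ψ Kν
  radius₁ : RadiusAssumptions (ellipticalLaw m₁ Sig rho) m₁ ζ ψ Kν
  mean_diff : ∑ i, |(m₁ i - m₀ i) / 2| ≤ Mstar

/-- `X₀` is a sample from `EC_p(m₀, Sig, r)`, `X₁` one from `EC_p(m₁, Sig, r)`, and all
observations are independent. -/
structure TwoClassSample {Ω : Type*} [MeasurableSpace Ω] (P : Measure Ω) {p n₀ n₁ : ℕ}
    (m₀ m₁ : EuclideanSpace ℝ (Fin p)) (Sig : Matrix (Fin p) (Fin p) ℝ) (rho : Measure ℝ)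
    (X₀ : Fin n₀ → Ω → EuclideanSpace ℝ (Fin p))
    (X₁ : Fin n₁ → Ω → EuclideanSpace ℝ (Fin p)) : Prop where
  law₀ : ∀ i, HasLaw (X₀ i) (ellipticalLaw m₀ Sig rho) P
  law₁ : ∀ i, HasLaw (X₁ i) (ellipticalLaw m₁ Sig rho) P
  indep : iIndepFun (Sum.elim X₀ X₁) P

/-! ### Estimators -/

/-- `m` is a sample spatial median of the data `x`. -/
def IsSpatialMedian {p n : ℕ} (x : Fin n → EuclideanSpace ℝ (Fin p))
    (m : EuclideanSpace ℝ (Fin p)) : Prop :=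
  ∀ m', ∑ i, ‖x i - m‖ ≤ ∑ i, ‖x i - m'‖

/-- The sample spatial-sign covariance matrix of the data `x` centred at `m`. -/
def sampleSignCov {p n : ℕ} (x : Fin n → EuclideanSpace ℝ (Fin p))
    (m : EuclideanSpace ℝ (Fin p)) : Matrix (Fin p) (Fin p) ℝ :=
  (n : ℝ)⁻¹ • ∑ i, signOuter (x i - m)

/-- The pooled sample spatial-sign covariance matrix. -/
def pooledSignCov {p n₀ n₁ : ℕ} (x₀ : Fin n₀ → EuclideanSpace ℝ (Fin p))
    (x₁ : Fin n₁ → EuclideanSpace ℝ (Fin p)) (a₀ a₁ : EuclideanSpace ℝ (Fin p)) :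
    Matrix (Fin p) (Fin p) ℝ :=
  ((n₀ : ℝ) / (n₀ + n₁)) • sampleSignCov x₀ a₀ + ((n₁ : ℝ) / (n₀ + n₁)) • sampleSignCov x₁ a₁

/-- `V` solves: minimize `∑ |v_{ij}|` subject to `‖p S V - I‖_∞ ≤ lam`. -/
def IsClimeSolution {p : ℕ} (S : Matrix (Fin p) (Fin p) ℝ) (lam : ℝ)
    (V : Matrix (Fin p) (Fin p) ℝ) : Prop :=
  maxNorm ((p : ℝ) • S * V - 1) ≤ lam ∧
    ∀ W : Matrix (Fin p) (Fin p) ℝ, maxNorm ((p : ℝ) • S * W - 1) ≤ lam → entrySum V ≤ entrySum W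

/-- Symmetrization: of `v_{ij}`, `v_{ji}` keep the one of smaller modulus. The case `i ≤ j` is
the defining formula, the entry below the diagonal is `v̂_{ij} = v̂_{ji}`. -/
def symmetrize {p : ℕ} (V : Matrix (Fin p) (Fin p) ℝ) : Matrix (Fin p) (Fin p) ℝ :=
  Matrix.of fun i j =>
    if i ≤ j then (if |V i j| ≤ |V j i| then V i j else V j i)
    else (if |V j i| ≤ |V i j| then V j i else V i j)

/-- `‖V̂ μ̂_d - V₀ μ_d‖_∞`, where `V̂` is the symmetrization of `V`, `μ̂_d = (a₁ - a₀) / 2` and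
`μ_d = (m₁ - m₀) / 2`. -/
def directionError {p : ℕ} (V : Matrix (Fin p) (Fin p) ℝ) (a₀ a₁ : EuclideanSpace ℝ (Fin p))
    (Sig : Matrix (Fin p) (Fin p) ℝ) (m₀ m₁ : EuclideanSpace ℝ (Fin p)) : ℝ :=
  ⨆ i : Fin p, |(symmetrize V *ᵥ fun j => (a₁ j - a₀ j) / 2) i -
    (shapePrecision Sig *ᵥ fun j => (m₁ j - m₀ j) / 2) i|

/-- On the data `x₀`, `x₁` the estimators exist and, whichever minimizers are chosen as spatial
medians `a₀`, `a₁` and as solution `V` of the optimization problem with the pooled matrix and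
tuning parameter `lam`, the error of the estimated direction is at most `B`. -/
def DirectionErrorLE {p n₀ n₁ : ℕ} (x₀ : Fin n₀ → EuclideanSpace ℝ (Fin p))
    (x₁ : Fin n₁ → EuclideanSpace ℝ (Fin p)) (Sig : Matrix (Fin p) (Fin p) ℝ)
    (m₀ m₁ : EuclideanSpace ℝ (Fin p)) (lam B : ℝ) : Prop :=
  (∃ a₀, IsSpatialMedian x₀ a₀) ∧ (∃ a₁, IsSpatialMedian x₁ a₁) ∧
    ∀ a₀ a₁, IsSpatialMedian x₀ a₀ → IsSpatialMedian x₁ a₁ →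
      (∃ V, IsClimeSolution (pooledSignCov x₀ x₁ a₀ a₁) lam V) ∧
        ∀ V, IsClimeSolution (pooledSignCov x₀ x₁ a₀ a₁) lam V →
          directionError V a₀ a₁ Sig m₀ m₁ ≤ B

/-! ### The tuning parameter and the bound -/

/-- `λ_n = T (2 C (8 + η² D) / η² √(log p / n) + D / √p)`. -/
def tuning (C D η T : ℝ) (n p : ℕ) : ℝ :=
  T * (2 * C * (8 + η ^ 2 * D) / η ^ 2 * √(Real.log p / n) + D / √p)

/-- `(2√6 T A / (z η²) + 8 M* T² A C (8 + η² D) / η²) √(log p / n) + 4 M* T² A D / √p`. -/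
def errorBound (A C D z η T Mstar : ℝ) (n p : ℕ) : ℝ :=
  (2 * √6 * T * A / (z * η ^ 2) + 8 * Mstar * T ^ 2 * A * C * (8 + η ^ 2 * D) / η ^ 2) *
      √(Real.log p / n) + 4 * Mstar * T ^ 2 * A * D / √p

end

noncomputable section

/-! The sign of a centred elliptical vector does not see `r`: it has the law of the sign of
`Σ₀^{1/2} u`. Writing a Gaussian vector in polar coordinates and applying Jensen's inequality to its
radius shows that linear functionals of `u` are sub-Gaussian with variance proxy `1 / (p - 1)`
(`lintegral_exp_inner_sphereUniform_le`), and the eigenvalue bounds pass this on to the signs.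
Products of two sign coordinates are therefore sub-exponential at scale `1 / p`, so `p` times the
sign covariance concentrates entrywise at rate `√(log p / n)`. Its mean is within `O(1 / √p)` of `p
Σ₀ / tr Σ₀`, because `‖Σ₀^{1/2} u‖²` is nearly constant on the sphere
(`abs_integral_sign_mul_sign_sub_le`).

Medians are analysed deterministically, for data satisfying `RegularSample`; there `ν_i = (z
‖y_i‖)⁻¹` with `z = ζ₁`, and `δ = √(log p / n_k)`. The curvature of the norm transverse to its
argument gives `‖a‖ = O(1 / (z √n_k))` for the centred median `a`. Inserting this in the first-order
condition, one coordinate at a time, gives `|a_j| = O(δ / (z √p))`, and then recentring at the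
median moves each entry of `p Ŝ_k` by `O(δ)`. The conditions fail with probability at most `p⁻²` per
class (`measure_not_regularSample_le`).

Hence `V₀` is feasible for `λ_n`. The optimization separates over columns, so the columns of a
solution have `ℓ₁` norm at most `T`, and an algebraic identity yields an entrywise error of at most
`4 T λ_n` (`IsClimeSolution.abs_sub_le`). Symmetrization turns column sums into row sums, and the
error splits as `V̂ (μ̂_d - μ_d) + (V̂ - V₀) μ_d`.

Concentration needs `δ` small. If `λ_n ≥ 1`, the zero matrix is the only solution and both bounds
hold for all data; if `λ_n < 1`, the size of the product `C D` forces `δ` to be small. All estimates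
use one constant `H`, a product of a factor in `ζ, Kν` and a factor in `η`, so that `H⁹` can be
shared between `C` and `D`. -/

theorem ofReal_integral_le_lintegral_ofReal {α : Type*} [MeasurableSpace α] {P : Measure α}
    {f : α → ℝ} (hf : Integrable f P) :
    ENNReal.ofReal (∫ x, f x ∂P) ≤ ∫⁻ x, ENNReal.ofReal (f x) ∂P := by
  calc ENNReal.ofReal (∫ x, f x ∂P) ≤ ENNReal.ofReal (∫ x, max (f x) 0 ∂P) :=
        ENNReal.ofReal_le_ofReal (integral_mono hf hf.pos_part fun x => le_max_left _ _)
    _ = ∫⁻ x, ENNReal.ofReal (max (f x) 0) ∂P :=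
        ofReal_integral_eq_lintegral_ofReal hf.pos_part
          (Filter.Eventually.of_forall fun x => le_max_right _ _)
    _ = _ := by simp

/-! ### Gaussian integrals -/

section GaussianIntegral

variable {F : Type*} [NormedAddCommGroup F] [InnerProductSpace ℝ F] [FiniteDimensional ℝ F]
  [MeasurableSpace F] [BorelSpace F]

theorem integrable_exp_neg_mul_sq_norm {b : ℝ} (hb : 0 < b) :
    Integrable (fun v : F => Real.exp (-b * ‖v‖ ^ 2)) := by
  apply Integrable.of_integral_ne_zero
  rw [GaussianFourier.integral_rexp_neg_mul_sq_norm hb]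
  positivity

theorem lintegral_exp_neg_mul_sq_norm_add_inner {b : ℝ} (hb : 0 < b) (a : F) :
    ∫⁻ v : F, ENNReal.ofReal (Real.exp (-b * ‖v‖ ^ 2 + inner ℝ a v)) =
      ENNReal.ofReal ((Real.pi / b) ^ (Module.finrank ℝ F / 2 : ℝ) *
        Real.exp (‖a‖ ^ 2 / (4 * b))) := by
  have key : ∀ v : F, Real.exp (-b * ‖v‖ ^ 2 + inner ℝ a v) =
      Real.exp (-b * ‖v - (2 * b)⁻¹ • a‖ ^ 2) * Real.exp (‖a‖ ^ 2 / (4 * b)) := by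
    intro v
    rw [← Real.exp_add, norm_sub_sq_real, inner_smul_right, norm_smul, real_inner_comm,
      Real.norm_of_nonneg (by positivity)]
    congr 1
    field_simp
    ring
  simp_rw [key]
  rw [← ofReal_integral_eq_lintegral_ofReal, integral_mul_const,
    integral_sub_right_eq_self (fun v : F => Real.exp (-b * ‖v‖ ^ 2)),
    GaussianFourier.integral_rexp_neg_mul_sq_norm hb]
  · exact ((integrable_exp_neg_mul_sq_norm hb).comp_sub_right _).mul_const _
  · exact Filter.Eventually.of_forall fun v => by positivity

/-- A random vector whose linear functionals have sub-Gaussian moment generating functions has a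
square norm with an exponential moment. -/
theorem lintegral_exp_sq_norm_le {α : Type*} [MeasurableSpace α] (P : Measure α) [SFinite P]
    {Z : α → F} (hZ : Measurable Z) {s : ℝ} (hs : 0 < s)
    (h : ∀ a : F, ∫⁻ ω, ENNReal.ofReal (Real.exp (inner ℝ a (Z ω))) ∂P ≤
      ENNReal.ofReal (Real.exp (s * ‖a‖ ^ 2 / 2))) :
    ∫⁻ ω, ENNReal.ofReal (Real.exp (‖Z ω‖ ^ 2 / (4 * s))) ∂P ≤
      ENNReal.ofReal (2 ^ (Module.finrank ℝ F / 2 : ℝ)) := by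
  set c : ℝ := (Real.pi / s) ^ (Module.finrank ℝ F / 2 : ℝ) with hc
  have hc0 : 0 < c := by have := Real.pi_pos; positivity
  -- Up to the factor `c`, `exp (‖Z‖² / (4 s))` is the integral over `a` of `exp (-s ‖a‖² + ⟨Z,
  -- a⟩)`. After Tonelli the hypothesis spends half of the quadratic term, and the Gaussian integral
  -- that remains is `2 ^ (d / 2)` times `c`, with `d` the dimension.
  have h1 : ENNReal.ofReal c * ∫⁻ ω, ENNReal.ofReal (Real.exp (‖Z ω‖ ^ 2 / (4 * s))) ∂P ≤
      ENNReal.ofReal ((Real.pi / (s / 2)) ^ (Module.finrank ℝ F / 2 : ℝ)) := by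
    calc _ = ∫⁻ ω, (∫⁻ a : F, ENNReal.ofReal
          (Real.exp (-s * ‖a‖ ^ 2 + inner ℝ (Z ω) a))) ∂P := by
          rw [← lintegral_const_mul _ (by fun_prop)]
          refine lintegral_congr fun ω => ?_
          rw [lintegral_exp_neg_mul_sq_norm_add_inner hs, ENNReal.ofReal_mul hc0.le]
      _ = ∫⁻ a : F, ∫⁻ ω, ENNReal.ofReal
          (Real.exp (-s * ‖a‖ ^ 2 + inner ℝ (Z ω) a)) ∂P := by
          refine lintegral_lintegral_swap ?_
          apply Measurable.aemeasurable
          simp only [Function.uncurry_def]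
          fun_prop
      _ ≤ ∫⁻ a : F, ENNReal.ofReal (Real.exp (-(s / 2) * ‖a‖ ^ 2 + inner ℝ (0 : F) a)) := by
          refine lintegral_mono fun a => ?_
          have : ∀ ω, ENNReal.ofReal (Real.exp (-s * ‖a‖ ^ 2 + inner ℝ (Z ω) a)) =
              ENNReal.ofReal (Real.exp (-s * ‖a‖ ^ 2)) *
                ENNReal.ofReal (Real.exp (inner ℝ a (Z ω))) := fun ω => by
            rw [← ENNReal.ofReal_mul (by positivity), ← Real.exp_add, real_inner_comm]
          simp_rw [this]
          rw [lintegral_const_mul _ (by fun_prop)]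
          refine (mul_le_mul_right (h a) _).trans ?_
          rw [← ENNReal.ofReal_mul (by positivity), ← Real.exp_add]
          apply le_of_eq
          congr 2
          simp
          ring
      _ = _ := by
          rw [lintegral_exp_neg_mul_sq_norm_add_inner (by positivity)]
          simp
  have h2 : (Real.pi / (s / 2)) ^ (Module.finrank ℝ F / 2 : ℝ) =
      c * 2 ^ (Module.finrank ℝ F / 2 : ℝ) := by
    rw [hc, ← Real.mul_rpow (by have := Real.pi_pos; positivity) (by norm_num)]
    congr 1
    field_simp
  rw [h2, ENNReal.ofReal_mul hc0.le] at h1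
  exact (ENNReal.mul_le_mul_iff_right (by simpa using hc0) ENNReal.ofReal_ne_top).1 h1

end GaussianIntegral

/-! ### The uniform distribution on the sphere -/

section Sphere

open Set Metric Pointwise

variable {p : ℕ}

theorem finrank_pos_of_pos (hp : 0 < p) : 0 < Module.finrank ℝ (EuclideanSpace ℝ (Fin p)) := by
  simpa using hp

theorem toSphere_univ_ne_zero (hp : 0 < p) :
    (volume : Measure (EuclideanSpace ℝ (Fin p))).toSphere Set.univ ≠ 0 := by
  rw [Measure.toSphere_apply_univ]
  simp [hp.ne', IsOpen.measure_ne_zero]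

theorem isProbabilityMeasure_sphereUniform (hp : 0 < p) :
    IsProbabilityMeasure (sphereUniform p) := by
  have : IsProbabilityMeasure
      (((volume : Measure (EuclideanSpace ℝ (Fin p))).toSphere Set.univ)⁻¹ •
        (volume : Measure (EuclideanSpace ℝ (Fin p))).toSphere) := by
    constructor
    rw [Measure.smul_apply, smul_eq_mul]
    exact ENNReal.inv_mul_cancel (toSphere_univ_ne_zero hp) (measure_ne_top _ _)
  exact Measure.isProbabilityMeasure_map (by fun_prop)

theorem sphereUniform_apply {A : Set (EuclideanSpace ℝ (Fin p))} (hA : MeasurableSet A) :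
    sphereUniform p A =
      ((volume : Measure (EuclideanSpace ℝ (Fin p))).toSphere Set.univ)⁻¹ *
        (Module.finrank ℝ (EuclideanSpace ℝ (Fin p)) *
          volume (Ioo (0 : ℝ) 1 • (A ∩ sphere 0 1))) := by
  rw [sphereUniform, Measure.map_apply (by fun_prop) hA, Measure.smul_apply, smul_eq_mul,
    Measure.toSphere_apply' _ (measurable_subtype_coe hA)]
  congr 4
  rw [Subtype.image_preimage_coe, inter_comm]

/-- The mass of a set is proportional to the volume of the cone over its trace on the sphere; a
linear isometry commutes with taking cones and preserves volume. -/
theorem sphereUniform_map_isometry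
    (T : EuclideanSpace ℝ (Fin p) ≃ₗᵢ[ℝ] EuclideanSpace ℝ (Fin p)) :
    (sphereUniform p).map T = sphereUniform p := by
  ext A hA
  rw [Measure.map_apply T.continuous.measurable hA,
    sphereUniform_apply (T.continuous.measurable hA), sphereUniform_apply hA]
  congr 2
  have : Ioo (0 : ℝ) 1 • (T ⁻¹' A ∩ sphere 0 1) = T ⁻¹' (Ioo (0 : ℝ) 1 • (A ∩ sphere 0 1)) := by
    ext x
    simp only [mem_smul, mem_preimage, mem_inter_iff, mem_sphere_zero_iff_norm]
    constructor
    · rintro ⟨r, hr, y, ⟨hy, hy1⟩, rfl⟩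
      exact ⟨r, hr, T y, ⟨hy, by simpa using hy1⟩, by simp⟩
    · rintro ⟨r, hr, y, ⟨hy, hy1⟩, h⟩
      exact ⟨r, hr, T.symm y, ⟨by simpa using hy, by simpa using hy1⟩, by
        apply T.injective; simp [h]⟩
  rw [this]
  exact T.measurePreserving.measure_preimage_equiv (f := T.toMeasurableEquiv) _

theorem ae_norm_eq_one_sphereUniform : ∀ᵐ u ∂(sphereUniform p), ‖u‖ = 1 := by
  rw [sphereUniform, ae_map_iff (by fun_prop)
    (measurableSet_eq_fun measurable_norm measurable_const)]
  exact Filter.Eventually.of_forall fun u => norm_eq_of_mem_sphere u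

theorem lintegral_eq_lintegral_toSphere {f : EuclideanSpace ℝ (Fin p) → ℝ≥0∞} (hp : 0 < p)
    (hf : Measurable f) :
    ∫⁻ x, f x = ∫⁻ u, (∫⁻ r in Ioi (0 : ℝ),
      ENNReal.ofReal (r ^ (p - 1)) * f (r • (u : EuclideanSpace ℝ (Fin p))))
        ∂(volume : Measure (EuclideanSpace ℝ (Fin p))).toSphere := by
  have : Nontrivial (EuclideanSpace ℝ (Fin p)) :=
    Module.finrank_pos_iff.1 (finrank_pos_of_pos hp)
  have mp := (volume : Measure (EuclideanSpace ℝ (Fin p))).measurePreserving_homeomorphUnitSphereProd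
  have h1 : ∫⁻ x, f x = ∫⁻ x : ({0}ᶜ : Set (EuclideanSpace ℝ (Fin p))),
      f (x : EuclideanSpace ℝ (Fin p)) ∂(volume.comap Subtype.val) := by
    rw [lintegral_subtype_comap (measurableSet_singleton _).compl, restrict_compl_singleton]
  have h2 : ∀ x : ({0}ᶜ : Set (EuclideanSpace ℝ (Fin p))), f x =
      (fun z : sphere (0 : EuclideanSpace ℝ (Fin p)) 1 × Ioi (0 : ℝ) =>
        f ((z.2 : ℝ) • (z.1 : EuclideanSpace ℝ (Fin p)))) (homeomorphUnitSphereProd _ x) := by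
    intro x
    have : (x : EuclideanSpace ℝ (Fin p)) ≠ 0 := x.2
    simp [smul_smul, this]
  have hm : Measurable (fun z : sphere (0 : EuclideanSpace ℝ (Fin p)) 1 × Ioi (0 : ℝ) =>
        f ((z.2 : ℝ) • (z.1 : EuclideanSpace ℝ (Fin p)))) := by
    apply hf.comp
    fun_prop
  rw [h1]
  simp_rw [h2]
  rw [mp.lintegral_comp hm, lintegral_prod _ hm.aemeasurable]
  refine lintegral_congr fun u => ?_
  rw [Measure.volumeIoiPow, lintegral_withDensity_eq_lintegral_mul _ (by fun_prop)
    (by apply hf.comp; fun_prop)]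
  simp only [Pi.mul_apply, finrank_euclideanSpace, Fintype.card_fin]
  exact lintegral_subtype_comap measurableSet_Ioi (fun r : ℝ => ENNReal.ofReal (r ^ (p - 1)) *
    f (r • (u : EuclideanSpace ℝ (Fin p))))

theorem integral_pow_mul_exp_neg_half_sq (q : ℕ) :
    ∫ r in Ioi (0 : ℝ), r ^ q * Real.exp (-(1 / 2) * r ^ 2) =
      (1 / 2 : ℝ) ^ (-((q : ℝ) + 1) / 2) * (1 / 2) * Real.Gamma (((q : ℝ) + 1) / 2) := by
  have := integral_rpow_mul_exp_neg_mul_rpow (p := 2) (q := q) (b := 1 / 2) (by norm_num)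
    (by have : (0 : ℝ) ≤ q := by positivity
        linarith) (by norm_num)
  rw [← this]
  refine setIntegral_congr_fun measurableSet_Ioi fun x hx => ?_
  simp

theorem integrableOn_pow_mul_exp_neg_half_sq (q : ℕ) :
    IntegrableOn (fun r : ℝ => r ^ q * Real.exp (-(1 / 2) * r ^ 2)) (Ioi 0) := by
  apply Integrable.of_integral_ne_zero
  rw [integral_pow_mul_exp_neg_half_sq]
  have := Real.Gamma_pos_of_pos (s := ((q : ℝ) + 1) / 2) (by positivity)
  positivity

/-- The mean of the norm of a standard Gaussian vector in dimension `p` is at least `√(p - 1)`. -/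
theorem sqrt_mul_integral_le_integral (hp : 2 ≤ p) :
    √((p : ℝ) - 1) * ∫ r in Ioi (0 : ℝ), r ^ (p - 1) * Real.exp (-(1 / 2) * r ^ 2) ≤
      ∫ r in Ioi (0 : ℝ), r ^ p * Real.exp (-(1 / 2) * r ^ 2) := by
  have hp' : (2 : ℝ) ≤ p := by exact_mod_cast hp
  rw [integral_pow_mul_exp_neg_half_sq, integral_pow_mul_exp_neg_half_sq]
  have hc : ((p - 1 : ℕ) : ℝ) = (p : ℝ) - 1 := by push_cast [Nat.cast_sub (by omega : 1 ≤ p)]; ring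
  rw [hc, sub_add_cancel]
  have hG1 := Real.Gamma_pos_of_pos (s := ((p : ℝ) + 1) / 2) (by positivity)
  have hG0 := Real.Gamma_pos_of_pos (s := ((p : ℝ) - 1) / 2) (by linarith)
  have hG := Real.Gamma_pos_of_pos (s := (p : ℝ) / 2) (by positivity)
  -- Log-convexity of `Γ` at the midpoint `p / 2` of `(p - 1) / 2` and `(p + 1) / 2`. The recurrence
  -- `hrec` between the two endpoints then produces the factor `√((p - 1) / 2)`.
  have hlc := Real.Gamma_mul_add_mul_le_rpow_Gamma_mul_rpow_Gamma (s := ((p : ℝ) - 1) / 2)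
    (t := ((p : ℝ) + 1) / 2) (a := 1 / 2) (b := 1 / 2) (by linarith) (by positivity) (by norm_num)
    (by norm_num) (by norm_num)
  rw [show (1 / 2 : ℝ) * (((p : ℝ) - 1) / 2) + 1 / 2 * (((p : ℝ) + 1) / 2) = p / 2 by ring,
    ← Real.sqrt_eq_rpow, ← Real.sqrt_eq_rpow] at hlc
  have hrec : Real.Gamma (((p : ℝ) + 1) / 2) =
      ((p : ℝ) - 1) / 2 * Real.Gamma (((p : ℝ) - 1) / 2) := by
    rw [← Real.Gamma_add_one (by linarith)]
    congr 1
    ring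
  have h1 : √(((p : ℝ) - 1) / 2) * Real.Gamma ((p : ℝ) / 2) ≤
      Real.Gamma (((p : ℝ) + 1) / 2) := by
    calc _ ≤ √(((p : ℝ) - 1) / 2) * (√(Real.Gamma (((p : ℝ) - 1) / 2)) *
          √(Real.Gamma (((p : ℝ) + 1) / 2))) := by gcongr
      _ = √(Real.Gamma (((p : ℝ) + 1) / 2)) * √(Real.Gamma (((p : ℝ) + 1) / 2)) := by
          rw [← mul_assoc, ← Real.sqrt_mul (by linarith), ← hrec]
      _ = _ := Real.mul_self_sqrt hG1.le
  have h2 : (1 / 2 : ℝ) ^ (-((p : ℝ) + 1) / 2) = √2 * (1 / 2 : ℝ) ^ (-(p : ℝ) / 2) := by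
    rw [show -((p : ℝ) + 1) / 2 = -(p : ℝ) / 2 + -(1 / 2) by ring,
      Real.rpow_add (by norm_num), mul_comm, Real.sqrt_eq_rpow]
    congr 1
    rw [Real.rpow_neg (by norm_num), one_div, Real.inv_rpow (by norm_num), inv_inv]
  rw [h2]
  have h3 : √((p : ℝ) - 1) = √2 * √(((p : ℝ) - 1) / 2) := by
    rw [← Real.sqrt_mul (by norm_num)]; congr 1; ring
  rw [h3]
  have h4 : 0 < (1 / 2 : ℝ) ^ (-(p : ℝ) / 2) := by positivity
  have h5 : 0 < √(2 : ℝ) := by positivity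
  calc √2 * √(((p : ℝ) - 1) / 2) * ((1 / 2 : ℝ) ^ (-(p : ℝ) / 2) * (1 / 2) *
        Real.Gamma ((p : ℝ) / 2))
      = (√2 * (1 / 2 : ℝ) ^ (-(p : ℝ) / 2) * (1 / 2)) *
        (√(((p : ℝ) - 1) / 2) * Real.Gamma ((p : ℝ) / 2)) := by ring
    _ ≤ _ := by gcongr

/-- Jensen's inequality for the radial part of a Gaussian vector. -/
theorem exists_ofReal_integral_mul_exp_le_lintegral (hp : 2 ≤ p) :
    ∃ κ : ℝ, √((p : ℝ) - 1) ≤ κ ∧ ∀ s : ℝ,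
      ENNReal.ofReal ((∫ r in Ioi (0 : ℝ), r ^ (p - 1) * Real.exp (-(1 / 2) * r ^ 2)) *
        Real.exp (κ * s)) ≤
      ∫⁻ r in Ioi (0 : ℝ), ENNReal.ofReal (r ^ (p - 1)) *
        ENNReal.ofReal (Real.exp (-(1 / 2) * r ^ 2 + r * s)) := by
  set W := ∫ r in Ioi (0 : ℝ), r ^ (p - 1) * Real.exp (-(1 / 2) * r ^ 2) with hW
  set M := ∫ r in Ioi (0 : ℝ), r ^ p * Real.exp (-(1 / 2) * r ^ 2) with hM
  have hW0 : 0 < W := by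
    rw [hW, integral_pow_mul_exp_neg_half_sq]
    have := Real.Gamma_pos_of_pos (s := (((p - 1 : ℕ) : ℝ) + 1) / 2) (by positivity)
    positivity
  refine ⟨M / W, (le_div_iff₀ hW0).2 (sqrt_mul_integral_le_integral hp), fun s => ?_⟩
  set κ := M / W
  have hMW : M = κ * W := by simp only [κ]; field_simp
  have i1 := integrableOn_pow_mul_exp_neg_half_sq (p - 1)
  have i2 := integrableOn_pow_mul_exp_neg_half_sq p
  -- The integrand is the radial density times the tangent line of `r ↦ exp (r s)` at the mean
  -- radius `κ`. Since `M = κ W`, the linear part integrates to zero; convexity puts the tangent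
  -- below the exponential.
  have hint : W * Real.exp (κ * s) = ∫ r in Ioi (0 : ℝ),
      (Real.exp (κ * s) * (1 - κ * s) * (r ^ (p - 1) * Real.exp (-(1 / 2) * r ^ 2)) +
        Real.exp (κ * s) * s * (r ^ p * Real.exp (-(1 / 2) * r ^ 2))) := by
    rw [integral_add (i1.const_mul _) (i2.const_mul _), integral_const_mul, integral_const_mul,
      ← hW, ← hM, hMW]
    ring
  rw [hint]
  refine (ofReal_integral_le_lintegral_ofReal ((i1.const_mul _).add (i2.const_mul _))).trans ?_
  refine setLIntegral_mono (by fun_prop) fun r hr => ?_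
  have hr : 0 < r := hr
  rw [← ENNReal.ofReal_mul (by positivity)]
  apply ENNReal.ofReal_le_ofReal
  have hpow : r ^ p = r ^ (p - 1) * r := by
    rw [← pow_succ]; congr 1; omega
  have hexp : Real.exp (κ * s) * (1 + (r - κ) * s) ≤ Real.exp (r * s) := by
    have := Real.add_one_le_exp ((r - κ) * s)
    calc _ ≤ Real.exp (κ * s) * Real.exp ((r - κ) * s) := by gcongr; linarith
      _ = _ := by rw [← Real.exp_add]; congr 1; ring
  calc _ = r ^ (p - 1) * Real.exp (-(1 / 2) * r ^ 2) *
        (Real.exp (κ * s) * (1 + (r - κ) * s)) := by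
          simp only [Pi.add_apply]; rw [hpow]; ring
    _ ≤ r ^ (p - 1) * Real.exp (-(1 / 2) * r ^ 2) * Real.exp (r * s) := by gcongr
    _ = _ := by rw [Real.exp_add]; ring

theorem lintegral_exp_neg_half_sq_add_inner (hp : 0 < p) (a : EuclideanSpace ℝ (Fin p)) :
    ∫⁻ x : EuclideanSpace ℝ (Fin p),
        ENNReal.ofReal (Real.exp (-(1 / 2) * ‖x‖ ^ 2 + inner ℝ a x)) =
      ∫⁻ u, (∫⁻ r in Ioi (0 : ℝ), ENNReal.ofReal (r ^ (p - 1)) *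
        ENNReal.ofReal (Real.exp (-(1 / 2) * r ^ 2 +
          r * inner ℝ a (u : EuclideanSpace ℝ (Fin p)))))
        ∂(volume : Measure (EuclideanSpace ℝ (Fin p))).toSphere := by
  rw [lintegral_eq_lintegral_toSphere hp (by fun_prop)]
  refine lintegral_congr fun u => ?_
  refine setLIntegral_congr_fun measurableSet_Ioi fun r hr => ?_
  have hr : 0 < r := hr
  simp only [norm_smul, norm_eq_of_mem_sphere u, inner_smul_right, Real.norm_of_nonneg hr.le,
    mul_one]

theorem lintegral_sphereUniform {f : EuclideanSpace ℝ (Fin p) → ℝ≥0∞} (hf : Measurable f) :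
    ∫⁻ u, f u ∂(sphereUniform p) =
      ((volume : Measure (EuclideanSpace ℝ (Fin p))).toSphere Set.univ)⁻¹ *
        ∫⁻ u, f u ∂(volume : Measure (EuclideanSpace ℝ (Fin p))).toSphere := by
  rw [sphereUniform, lintegral_map hf (by fun_prop), lintegral_smul_measure, smul_eq_mul]

/-- Linear functionals of a uniform point of the unit sphere are sub-Gaussian. -/
theorem lintegral_exp_inner_sphereUniform_le (hp : 2 ≤ p) (a : EuclideanSpace ℝ (Fin p)) :
    ∫⁻ u, ENNReal.ofReal (Real.exp (inner ℝ a u)) ∂(sphereUniform p) ≤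
      ENNReal.ofReal (Real.exp (‖a‖ ^ 2 / (2 * ((p : ℝ) - 1)))) := by
  have hp0 : 0 < p := by omega
  have hp' : (2 : ℝ) ≤ p := by exact_mod_cast hp
  obtain ⟨κ, hκ, hJ⟩ := exists_ofReal_integral_mul_exp_le_lintegral hp
  have hκ0 : 0 < κ := lt_of_lt_of_le (Real.sqrt_pos.2 (by linarith)) hκ
  set W := ∫ r in Ioi (0 : ℝ), r ^ (p - 1) * Real.exp (-(1 / 2) * r ^ 2) with hW
  set τ := (volume : Measure (EuclideanSpace ℝ (Fin p))).toSphere with hτ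
  set g : ℝ := (Real.pi / (1 / 2)) ^ (Module.finrank ℝ (EuclideanSpace ℝ (Fin p)) / 2 : ℝ)
  have hg : 0 < g := by have := Real.pi_pos; positivity
  have hW0 : 0 ≤ W := setIntegral_nonneg measurableSet_Ioi fun r hr => by
    have hr : 0 < r := hr
    positivity
  -- The case `a = 0` identifies the Gaussian normalization with the product of the radial and
  -- angular masses, so that `W` can be cancelled below.
  have hnorm : ENNReal.ofReal g = ENNReal.ofReal W * τ univ := by
    have := lintegral_exp_neg_half_sq_add_inner hp0 (0 : EuclideanSpace ℝ (Fin p))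
    rw [lintegral_exp_neg_mul_sq_norm_add_inner (by norm_num)] at this
    simp only [norm_zero, inner_zero_left, mul_zero, add_zero] at this
    rw [lintegral_const] at this
    have h0 : Real.exp (0 ^ 2 / (4 * (1 / 2))) = 1 := by norm_num
    rw [h0, mul_one] at this
    rw [this, hW, ofReal_integral_eq_lintegral_ofReal (integrableOn_pow_mul_exp_neg_half_sq _)]
    · congr 1
      refine setLIntegral_congr_fun measurableSet_Ioi fun r hr => ?_
      have hr : 0 < r := hr
      rw [← ENNReal.ofReal_mul (by positivity)]
    · refine (ae_restrict_iff' measurableSet_Ioi).2 (Filter.Eventually.of_forall fun r hr => ?_)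
      have hr : 0 < r := hr
      simp only [Pi.zero_apply]
      positivity
  have hW0' : 0 < W := by
    rcases hW0.eq_or_lt with h | h
    · rw [← h] at hnorm
      simp at hnorm
      linarith
    · exact h
  have main : ∀ b : EuclideanSpace ℝ (Fin p),
      ∫⁻ u, ENNReal.ofReal (Real.exp (κ * inner ℝ b u)) ∂(sphereUniform p) ≤
        ENNReal.ofReal (Real.exp (‖b‖ ^ 2 / 2)) := by
    intro b
    have h := lintegral_exp_neg_half_sq_add_inner hp0 b
    rw [lintegral_exp_neg_mul_sq_norm_add_inner (by norm_num)] at h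
    have h2 : ENNReal.ofReal W * ∫⁻ u, ENNReal.ofReal
        (Real.exp (κ * inner ℝ b (u : EuclideanSpace ℝ (Fin p)))) ∂τ ≤
        ENNReal.ofReal W * τ univ * ENNReal.ofReal (Real.exp (‖b‖ ^ 2 / 2)) := by
      rw [← hnorm, ← ENNReal.ofReal_mul hg.le]
      refine le_trans ?_ (h.symm.le.trans (le_of_eq ?_))
      · rw [← lintegral_const_mul _ (by fun_prop)]
        refine lintegral_mono fun u => ?_
        rw [← ENNReal.ofReal_mul hW0]
        exact hJ _
      · congr 4; norm_num
    rw [mul_assoc] at h2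
    have h3 := (ENNReal.mul_le_mul_iff_right (by simpa using hW0') ENNReal.ofReal_ne_top).1 h2
    rw [lintegral_sphereUniform (by fun_prop)]
    refine (mul_le_mul_right h3 _).trans ?_
    rw [← mul_assoc, ENNReal.inv_mul_cancel (toSphere_univ_ne_zero hp0) (measure_ne_top _ _),
      one_mul]
  -- Rescaling moves the mean radius into the variance, where `κ² ≥ p - 1` applies.
  have := main (κ⁻¹ • a)
  simp only [inner_smul_left, norm_smul] at this
  refine le_trans (le_of_eq ?_) (this.trans ?_)
  · refine lintegral_congr fun u => ?_
    congr 2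
    simp only [conj_trivial]
    field_simp
  · apply ENNReal.ofReal_le_ofReal
    apply Real.exp_le_exp.2
    rw [Real.norm_of_nonneg (by positivity)]
    have : (p : ℝ) - 1 ≤ κ ^ 2 := by
      rw [← Real.sq_sqrt (show (0 : ℝ) ≤ p - 1 by linarith)]
      gcongr
    rw [mul_pow, div_le_div_iff₀ (by norm_num) (by nlinarith)]
    have h1 : (κ⁻¹) ^ 2 * ((p : ℝ) - 1) ≤ 1 := by
      rw [inv_pow, inv_mul_le_iff₀ (by positivity)]; linarith
    nlinarith [sq_nonneg ‖a‖]

end Sphere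

/-! ### Moments of the uniform distribution on the sphere -/

section SphereMoments

variable {p : ℕ}

theorem integrable_sphereUniform (hp : 0 < p) {f : EuclideanSpace ℝ (Fin p) → ℝ}
    (hf : Continuous f) : Integrable f (sphereUniform p) := by
  have := isProbabilityMeasure_sphereUniform hp
  obtain ⟨C, hC⟩ := (isCompact_sphere (0 : EuclideanSpace ℝ (Fin p)) 1).exists_bound_of_continuousOn
    hf.continuousOn
  refine Integrable.of_bound hf.aestronglyMeasurable C ?_
  filter_upwards [ae_norm_eq_one_sphereUniform] with u hu
  exact hC u (by simpa using hu)

theorem integral_sphereUniform_comp_isometry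
    (T : EuclideanSpace ℝ (Fin p) ≃ₗᵢ[ℝ] EuclideanSpace ℝ (Fin p))
    (f : EuclideanSpace ℝ (Fin p) → ℝ) :
    ∫ u, f (T u) ∂(sphereUniform p) = ∫ u, f u ∂(sphereUniform p) := by
  conv_rhs => rw [← sphereUniform_map_isometry T]
  exact (T.toHomeomorph.measurableEmbedding.integral_map f).symm

/-- Coordinates in an orthonormal basis are exchangeable, because permuting the basis is a linear
isometry. All second and mixed fourth moments are compared through this. -/
theorem integral_sphereUniform_perm (b : OrthonormalBasis (Fin p) ℝ (EuclideanSpace ℝ (Fin p)))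
    (e : Equiv.Perm (Fin p)) (f : (Fin p → ℝ) → ℝ) :
    ∫ u, f (fun i => inner ℝ (b (e i)) u) ∂(sphereUniform p) =
      ∫ u, f (fun i => inner ℝ (b i) u) ∂(sphereUniform p) := by
  rw [← integral_sphereUniform_comp_isometry (b.equiv b e)]
  congr! 4 with u i
  rw [← b.equiv_apply_basis b e i, LinearIsometryEquiv.inner_map_map]

theorem integral_inner_sq_basis (hp : 0 < p)
    (b : OrthonormalBasis (Fin p) ℝ (EuclideanSpace ℝ (Fin p))) (i : Fin p) :
    ∫ u, (inner ℝ (b i) u) ^ 2 ∂(sphereUniform p) = 1 / p := by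
  have := isProbabilityMeasure_sphereUniform hp
  have h1 : ∀ j, ∫ u, (inner ℝ (b j) u) ^ 2 ∂(sphereUniform p) =
      ∫ u, (inner ℝ (b i) u) ^ 2 ∂(sphereUniform p) := fun j => by
    have := integral_sphereUniform_perm b (Equiv.swap i j) (fun x => (x i) ^ 2)
    simpa using this
  have h2 : ∫ u, ∑ j, (inner ℝ (b j) u) ^ 2 ∂(sphereUniform p) = 1 := by
    calc _ = ∫ u, (1 : ℝ) ∂(sphereUniform p) := by
          refine integral_congr_ae ?_
          filter_upwards [ae_norm_eq_one_sphereUniform] with u hu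
          rw [b.sum_sq_inner_right, hu, one_pow]
      _ = 1 := by simp
  rw [integral_finsetSum _ fun j _ => integrable_sphereUniform hp (by fun_prop)] at h2
  simp_rw [h1] at h2
  simp only [Finset.sum_const, Finset.card_univ, Fintype.card_fin, nsmul_eq_mul] at h2
  have : (p : ℝ) ≠ 0 := by exact_mod_cast hp.ne'
  field_simp
  linarith

theorem exists_orthonormalBasis_eq (hp : 0 < p) {a : EuclideanSpace ℝ (Fin p)} (ha : ‖a‖ = 1) :
    ∃ b : OrthonormalBasis (Fin p) ℝ (EuclideanSpace ℝ (Fin p)), b ⟨0, hp⟩ = a := by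
  have ho : Orthonormal ℝ (({⟨0, hp⟩} : Set (Fin p)).domRestrict (fun _ : Fin p => a)) := by
    constructor
    · exact fun _ => ha
    · intro i j hij
      exact absurd (Subsingleton.elim i j) hij
  obtain ⟨b, hb⟩ := ho.exists_orthonormalBasis_extension_of_card_eq (by simp)
  exact ⟨b, hb _ rfl⟩

theorem integral_inner_sq (hp : 0 < p) (a : EuclideanSpace ℝ (Fin p)) :
    ∫ u, (inner ℝ a u) ^ 2 ∂(sphereUniform p) = ‖a‖ ^ 2 / p := by
  rcases eq_or_ne a 0 with rfl | ha
  · simp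
  have hn : ‖a‖ ≠ 0 := norm_ne_zero_iff.2 ha
  obtain ⟨b, hb⟩ := exists_orthonormalBasis_eq hp (a := ‖a‖⁻¹ • a) (by
    rw [norm_smul, norm_inv, norm_norm, inv_mul_cancel₀ hn])
  have h := integral_inner_sq_basis hp b ⟨0, hp⟩
  rw [hb] at h
  simp only [inner_smul_left, mul_pow, integral_const_mul, conj_trivial] at h
  field_simp at h ⊢
  linarith

theorem integral_inner_mul_inner (hp : 0 < p) (a c : EuclideanSpace ℝ (Fin p)) :
    ∫ u, inner ℝ a u * inner ℝ c u ∂(sphereUniform p) = inner ℝ a c / p := by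
  have h : ∀ u : EuclideanSpace ℝ (Fin p), inner ℝ a u * inner ℝ c u =
      1 / 4 * (inner ℝ (a + c) u ^ 2 - inner ℝ (a - c) u ^ 2) := fun u => by
    rw [inner_add_left, inner_sub_left]; ring
  simp_rw [h]
  rw [integral_const_mul, integral_sub (integrable_sphereUniform hp (by fun_prop))
    (integrable_sphereUniform hp (by fun_prop)), integral_inner_sq hp, integral_inner_sq hp,
    norm_add_sq_real, norm_sub_sq_real]
  ring

theorem integral_exp_inner_le (hp : 2 ≤ p) (a : EuclideanSpace ℝ (Fin p)) :
    ∫ u, Real.exp (inner ℝ a u) ∂(sphereUniform p) ≤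
      Real.exp (‖a‖ ^ 2 / (2 * ((p : ℝ) - 1))) := by
  rw [integral_eq_lintegral_of_nonneg_ae (Filter.Eventually.of_forall fun u => by positivity)
    (by fun_prop)]
  exact ENNReal.toReal_le_of_le_ofReal (by positivity) (lintegral_exp_inner_sphereUniform_le hp a)

theorem pow_four_le_exp_add_exp_neg (x : ℝ) : x ^ 4 ≤ 24 * (Real.exp x + Real.exp (-x)) := by
  have h := Real.pow_div_factorial_le_exp |x| (abs_nonneg x) 4
  have h1 : Real.exp |x| ≤ Real.exp x + Real.exp (-x) := by
    rcases abs_cases x with ⟨h, _⟩ | ⟨h, _⟩ <;> rw [h]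
    · linarith [Real.exp_pos (-x)]
    · linarith [Real.exp_pos x]
  have h2 : |x| ^ 4 = x ^ 4 := by rw [pow_abs, abs_of_nonneg (by positivity)]
  rw [h2] at h
  norm_num [Nat.factorial] at h
  linarith

theorem integral_inner_pow_four_le (hp : 2 ≤ p) (a : EuclideanSpace ℝ (Fin p)) :
    ∫ u, (inner ℝ a u) ^ 4 ∂(sphereUniform p) ≤ 320 * ‖a‖ ^ 4 / (p : ℝ) ^ 2 := by
  have hp0 : 0 < p := by omega
  have hp' : (2 : ℝ) ≤ p := by exact_mod_cast hp
  rcases eq_or_ne a 0 with rfl | ha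
  · simp
  have hn : 0 < ‖a‖ := norm_pos_iff.2 ha
  set s : ℝ := √((p : ℝ) - 1) with hs
  have hs2 : s ^ 2 = (p : ℝ) - 1 := Real.sq_sqrt (by linarith)
  have hs0 : 0 < s := Real.sqrt_pos.2 (by linarith)
  -- With norm `√(p - 1)` the moment generating function is at most `exp (1 / 2) ≤ 5 / 3`, so the
  -- fourth moment is at most `24 · 10 / 3 = 80`. Undoing the scaling with `p² ≤ 4 (p - 1)²` gives
  -- `320`.
  set c : EuclideanSpace ℝ (Fin p) := (s * ‖a‖⁻¹) • a with hc
  have hcn : ‖c‖ ^ 2 = s ^ 2 := by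
    rw [hc, norm_smul, Real.norm_of_nonneg (by positivity), mul_assoc, inv_mul_cancel₀ hn.ne',
      mul_one]
  have hexp : Real.exp (‖c‖ ^ 2 / (2 * ((p : ℝ) - 1))) ≤ 5 / 3 := by
    rw [hcn, hs2]
    have : ((p : ℝ) - 1) / (2 * ((p : ℝ) - 1)) = 1 / 2 := by
      have : (p : ℝ) - 1 ≠ 0 := by linarith
      field_simp
    rw [this]
    have h1 : Real.exp (1 / 2) ^ 2 = Real.exp 1 := by rw [← Real.exp_nat_mul]; norm_num
    have h2 := Real.exp_one_lt_d9
    by_contra! hcon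
    nlinarith
  have h1 : ∫ u, (inner ℝ c u) ^ 4 ∂(sphereUniform p) ≤ 80 := by
    calc _ ≤ ∫ u, 24 * (Real.exp (inner ℝ c u) + Real.exp (inner ℝ (-c) u))
          ∂(sphereUniform p) := by
          refine integral_mono (integrable_sphereUniform hp0 (by fun_prop))
            (integrable_sphereUniform hp0 (by fun_prop)) fun u => ?_
          simp only [inner_neg_left]
          exact pow_four_le_exp_add_exp_neg _
      _ ≤ 24 * (5 / 3 + 5 / 3) := by
          rw [integral_const_mul, integral_add (integrable_sphereUniform hp0 (by fun_prop))
            (integrable_sphereUniform hp0 (by fun_prop))]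
          have h1 := integral_exp_inner_le hp c
          have h2 := integral_exp_inner_le hp (-c)
          rw [norm_neg] at h2
          linarith
      _ = 80 := by norm_num
  simp only [hc, inner_smul_left, mul_pow, integral_const_mul, conj_trivial] at h1
  have h4 : s ^ 4 = ((p : ℝ) - 1) ^ 2 := by rw [← hs2]; ring
  rw [h4, inv_pow] at h1
  have h5 : ((p : ℝ) - 1) ^ 2 * ∫ u, (inner ℝ a u) ^ 4 ∂(sphereUniform p) ≤ 80 * ‖a‖ ^ 4 := by
    have : 0 < ‖a‖ ^ 4 := by positivity
    field_simp at h1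
    linarith
  have h6 : 0 ≤ ∫ u, (inner ℝ a u) ^ 4 ∂(sphereUniform p) :=
    integral_nonneg fun u => by positivity
  rw [le_div_iff₀ (by positivity)]
  have h7 : (p : ℝ) ^ 2 ≤ 4 * ((p : ℝ) - 1) ^ 2 := by nlinarith
  have h8 := mul_le_mul_of_nonneg_left h7 h6
  linarith

/-- The variance of a quadratic form with nonnegative eigenvalues at a uniform point of the
sphere. -/
theorem integral_sq_sum_sub_le (hp : 2 ≤ p)
    (b : OrthonormalBasis (Fin p) ℝ (EuclideanSpace ℝ (Fin p))) {l : Fin p → ℝ}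
    (hl : ∀ i, 0 ≤ l i) :
    ∫ u, (∑ i, l i * (inner ℝ (b i) u) ^ 2 - (∑ i, l i) / p) ^ 2 ∂(sphereUniform p) ≤
      320 / (p : ℝ) ^ 2 * ∑ i, l i ^ 2 := by
  have hp0 : 0 < p := by omega
  have hp' : (2 : ℝ) ≤ p := by exact_mod_cast hp
  have := isProbabilityMeasure_sphereUniform hp0
  set c : Fin p → Fin p → ℝ := fun i j =>
    ∫ u, (inner ℝ (b i) u) ^ 2 * (inner ℝ (b j) u) ^ 2 ∂(sphereUniform p) with hc
  have hcii : ∀ i, c i i ≤ 320 / (p : ℝ) ^ 2 := fun i => by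
    have := integral_inner_pow_four_le hp (b i)
    simp only [b.norm_eq_one] at this
    simp only [hc, ← pow_add]
    linarith
  have hciile : ∀ i, 1 / (p : ℝ) ^ 2 ≤ c i i := fun i => by
    have h : 0 ≤ ∫ u, ((inner ℝ (b i) u) ^ 2 - 1 / (p : ℝ)) ^ 2 ∂(sphereUniform p) :=
      integral_nonneg fun u => by positivity
    have h2 : ∀ u, ((inner ℝ (b i) u) ^ 2 - 1 / (p : ℝ)) ^ 2 =
        (inner ℝ (b i) u) ^ 2 * (inner ℝ (b i) u) ^ 2 -
          2 / p * (inner ℝ (b i) u) ^ 2 + 1 / (p : ℝ) ^ 2 := fun u => by ring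
    simp_rw [h2] at h
    rw [integral_add (integrable_sphereUniform hp0 (by fun_prop)) (integrable_const _),
      integral_sub (integrable_sphereUniform hp0 (by fun_prop))
        (integrable_sphereUniform hp0 (by fun_prop)), integral_const_mul,
      integral_inner_sq_basis hp0] at h
    simp only [integral_const, probReal_univ, one_smul] at h
    have h3 : (2 : ℝ) / p * (1 / p) = 2 / (p : ℝ) ^ 2 := by field_simp
    rw [h3] at h
    have h4 : 2 / (p : ℝ) ^ 2 = 2 * (1 / (p : ℝ) ^ 2) := by ring
    simp only [hc]
    linarith
  have hrow : ∀ i, ∑ j, c i j = 1 / p := fun i => by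
    simp only [hc]
    rw [← integral_finsetSum _ fun j _ => integrable_sphereUniform hp0 (by fun_prop),
      ← integral_inner_sq_basis hp0 b i]
    refine integral_congr_ae ?_
    filter_upwards [ae_norm_eq_one_sphereUniform] with u hu
    rw [← Finset.mul_sum, b.sum_sq_inner_right, hu, one_pow, mul_one]
  -- Squared coordinates are nonpositively correlated: by exchangeability the off-diagonal entries
  -- of a row agree, the row sums to `1 / p`, and the diagonal entry already takes `1 / p²`.
  have hoff : ∀ i j, i ≠ j → c i j ≤ 1 / (p : ℝ) ^ 2 := fun i j hij => by
    have hsame : ∀ k, k ≠ i → c i k = c i j := fun k hk => by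
      have := integral_sphereUniform_perm b (Equiv.swap j k) (fun x => x i ^ 2 * x j ^ 2)
      simpa [Equiv.swap_apply_of_ne_of_ne hij hk.symm, hc] using this
    have h := hrow i
    rw [← Finset.add_sum_erase _ _ (Finset.mem_univ i),
      Finset.sum_congr rfl (fun k hk => hsame k (Finset.ne_of_mem_erase hk))] at h
    simp only [Finset.sum_const, Finset.card_erase_of_mem (Finset.mem_univ i), Finset.card_univ,
      Fintype.card_fin, nsmul_eq_mul, Nat.cast_sub (by omega : 1 ≤ p), Nat.cast_one] at h
    have h2 := hciile i
    have h3 : ((p : ℝ) - 1) * c i j ≤ ((p : ℝ) - 1) * (1 / (p : ℝ) ^ 2) := by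
      have : (1 : ℝ) / p - 1 / (p : ℝ) ^ 2 = ((p : ℝ) - 1) * (1 / (p : ℝ) ^ 2) := by
        field_simp
      linarith
    exact le_of_mul_le_mul_left h3 (by linarith)
  have hexpand : ∀ u, (∑ i, l i * (inner ℝ (b i) u) ^ 2 - (∑ i, l i) / p) ^ 2 =
      ∑ i, ∑ j, l i * l j * ((inner ℝ (b i) u) ^ 2 * (inner ℝ (b j) u) ^ 2) -
        2 * ((∑ i, l i) / p) * ∑ i, l i * (inner ℝ (b i) u) ^ 2 + ((∑ i, l i) / p) ^ 2 := by
    intro u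
    have : (∑ i, l i * (inner ℝ (b i) u) ^ 2) ^ 2 =
        ∑ i, ∑ j, l i * l j * ((inner ℝ (b i) u) ^ 2 * (inner ℝ (b j) u) ^ 2) := by
      rw [sq, Finset.sum_mul_sum]
      refine Finset.sum_congr rfl fun i _ => Finset.sum_congr rfl fun j _ => by ring
    rw [← this]
    ring
  simp_rw [hexpand]
  rw [integral_add (integrable_sphereUniform hp0 (by fun_prop)) (integrable_const _),
      integral_sub (integrable_sphereUniform hp0 (by fun_prop))
        (integrable_sphereUniform hp0 (by fun_prop)), integral_const_mul,
      integral_finsetSum _ (fun i _ => integrable_sphereUniform hp0 (by fun_prop)),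
      integral_finsetSum _ (fun i _ => integrable_sphereUniform hp0 (by fun_prop))]
  simp only [integral_const, probReal_univ, one_smul]
  -- Since `l ≥ 0`, off-diagonal terms are at most those of the squared mean, which cancels; only
  -- the diagonal contributes to the variance.
  have h1 : ∀ i, ∫ u, ∑ j, l i * l j * ((inner ℝ (b i) u) ^ 2 * (inner ℝ (b j) u) ^ 2)
      ∂(sphereUniform p) ≤ 320 / (p : ℝ) ^ 2 * l i ^ 2 +
        ∑ j, l i * l j * (1 / (p : ℝ) ^ 2) := by
    intro i
    rw [integral_finsetSum _ (fun j _ => integrable_sphereUniform hp0 (by fun_prop))]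
    simp_rw [integral_const_mul]
    rw [← Finset.add_sum_erase _ _ (Finset.mem_univ i),
      ← Finset.add_sum_erase (a := i) _ (fun j => l i * l j * (1 / (p : ℝ) ^ 2))
        (Finset.mem_univ i)]
    have ha : l i * l i * c i i ≤ 320 / (p : ℝ) ^ 2 * l i ^ 2 := by
      rw [← sq, mul_comm]
      exact mul_le_mul_of_nonneg_right (hcii i) (by positivity)
    have hb : ∑ j ∈ Finset.univ.erase i, l i * l j * c i j ≤
        ∑ j ∈ Finset.univ.erase i, l i * l j * (1 / (p : ℝ) ^ 2) :=
      Finset.sum_le_sum fun j hj => mul_le_mul_of_nonneg_left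
        (hoff i j (Finset.ne_of_mem_erase hj).symm) (mul_nonneg (hl i) (hl j))
    have hd : 0 ≤ l i * l i * (1 / (p : ℝ) ^ 2) :=
      mul_nonneg (mul_nonneg (hl i) (hl i)) (by positivity)
    linarith
  have h2 : ∀ i, ∫ u, l i * (inner ℝ (b i) u) ^ 2 ∂(sphereUniform p) = l i * (1 / p) := fun i => by
    rw [integral_const_mul, integral_inner_sq_basis hp0]
  simp_rw [h2]
  have h3 := Finset.sum_le_sum fun i (_ : i ∈ Finset.univ) => h1 i
  rw [Finset.sum_add_distrib, ← Finset.mul_sum] at h3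
  have h4 : ∑ i, ∑ j, l i * l j * (1 / (p : ℝ) ^ 2) = ((∑ i, l i) / p) ^ 2 := by
    simp_rw [← Finset.sum_mul]
    rw [← Finset.sum_mul_sum]
    ring
  rw [h4] at h3
  rw [← Finset.sum_mul]
  have h5 : 2 * ((∑ i, l i) / (p : ℝ)) * ((∑ i, l i) * (1 / p)) = 2 * ((∑ i, l i) / p) ^ 2 := by
    ring
  rw [h5]
  linarith

end SphereMoments

/-! ### Concentration for independent samples -/

section Sampling

variable {E : Type*} [MeasurableSpace E] (L : Measure E) [IsProbabilityMeasure L] (n : ℕ)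

theorem lintegral_pi_prod {g : E → ℝ≥0∞} (hg : Measurable g) :
    ∫⁻ y : Fin n → E, ∏ i, g (y i) ∂(Measure.pi fun _ => L) = (∫⁻ x, g x ∂L) ^ n := by
  have hind : iIndepFun (fun (i : Fin n) (y : Fin n → E) => g (y i)) (Measure.pi fun _ => L) :=
    iIndepFun_pi (μ := fun _ : Fin n => L) (X := fun _ => g) fun _ => hg.aemeasurable
  rw [lintegral_prod_eq_prod_lintegral_of_indepFun Finset.univ _ hind
    fun i => hg.comp (measurable_pi_apply i)]
  have h : ∀ i : Fin n, ∫⁻ y : Fin n → E, g (y i) ∂(Measure.pi fun _ => L) = ∫⁻ x, g x ∂L :=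
    fun i => (measurePreserving_eval (fun _ : Fin n => L) i).lintegral_comp hg
  simp [h]

theorem lintegral_pi_sum {g : E → ℝ≥0∞} (hg : Measurable g) :
    ∫⁻ y : Fin n → E, ∑ i, g (y i) ∂(Measure.pi fun _ => L) = n * ∫⁻ x, g x ∂L := by
  rw [lintegral_finsetSum Finset.univ (f := fun (i : Fin n) (y : Fin n → E) => g (y i))
    fun i _ => hg.comp (measurable_pi_apply i)]
  have h : ∀ i : Fin n, ∫⁻ y : Fin n → E, g (y i) ∂(Measure.pi fun _ => L) = ∫⁻ x, g x ∂L :=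
    fun i => (measurePreserving_eval (fun _ : Fin n => L) i).lintegral_comp hg
  simp [h]

theorem lintegral_pi_exp_sum_le {f : E → ℝ} (hf : Measurable f) {b : ℝ}
    (h : ∫⁻ x, ENNReal.ofReal (Real.exp (f x)) ∂L ≤ ENNReal.ofReal (Real.exp b)) :
    ∫⁻ y : Fin n → E, ENNReal.ofReal (Real.exp (∑ i, f (y i))) ∂(Measure.pi fun _ => L) ≤
      ENNReal.ofReal (Real.exp (n * b)) := by
  have h1 : ∀ y : Fin n → E, ENNReal.ofReal (Real.exp (∑ i, f (y i))) =
      ∏ i, ENNReal.ofReal (Real.exp (f (y i))) := fun y => by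
    rw [Real.exp_sum, ENNReal.ofReal_prod_of_nonneg fun i _ => by positivity]
  simp_rw [h1]
  rw [lintegral_pi_prod L n (g := fun x => ENNReal.ofReal (Real.exp (f x))) (by fun_prop)]
  refine (pow_le_pow_left' h n).trans ?_
  rw [← ENNReal.ofReal_pow (by positivity), ← Real.exp_nat_mul]

/-- Markov's inequality for the exponential of a random variable. -/
theorem measure_ge_le_of_lintegral_exp_le {α : Type*} [MeasurableSpace α] (P : Measure α)
    {f : α → ℝ} (hf : Measurable f) {K : ℝ} (x : ℝ)
    (h : ∫⁻ ω, ENNReal.ofReal (Real.exp (f ω)) ∂P ≤ ENNReal.ofReal K) :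
    P {ω | x ≤ f ω} ≤ ENNReal.ofReal (K * Real.exp (-x)) := by
  have h1 := mul_meas_ge_le_lintegral (μ := P) (f := fun ω => ENNReal.ofReal (Real.exp (f ω)))
    (by fun_prop) (ENNReal.ofReal (Real.exp x))
  have h2 : {ω | ENNReal.ofReal (Real.exp x) ≤ ENNReal.ofReal (Real.exp (f ω))} =
      {ω | x ≤ f ω} := by
    ext ω
    simp [ENNReal.ofReal_le_ofReal_iff (Real.exp_pos _).le]
  rw [h2] at h1
  have h3 := h1.trans h
  have h4 : ENNReal.ofReal (Real.exp (-x)) * ENNReal.ofReal (Real.exp x) = 1 := by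
    rw [← ENNReal.ofReal_mul (by positivity), ← Real.exp_add]; simp
  calc P {ω | x ≤ f ω} = ENNReal.ofReal (Real.exp (-x)) *
        (ENNReal.ofReal (Real.exp x) * P {ω | x ≤ f ω}) := by rw [← mul_assoc, h4, one_mul]
    _ ≤ ENNReal.ofReal (Real.exp (-x)) * ENNReal.ofReal K := by gcongr
    _ = _ := by rw [mul_comm K, ENNReal.ofReal_mul (by positivity)]

theorem measure_pi_sum_ge_le {f : E → ℝ} (hf : Measurable f) {b : ℝ} (x : ℝ)
    (h : ∫⁻ x, ENNReal.ofReal (Real.exp (f x)) ∂L ≤ ENNReal.ofReal (Real.exp b)) :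
    (Measure.pi fun _ : Fin n => L) {y | x ≤ ∑ i, f (y i)} ≤
      ENNReal.ofReal (Real.exp (n * b - x)) := by
  have := measure_ge_le_of_lintegral_exp_le (Measure.pi fun _ : Fin n => L)
    (f := fun y => ∑ i, f (y i)) (by fun_prop) x (lintegral_pi_exp_sum_le L n hf h)
  rwa [← Real.exp_add, ← sub_eq_add_neg] at this

theorem exp_le_one_add_add_sq_mul (x : ℝ) :
    Real.exp x ≤ 1 + x + x ^ 2 * Real.exp |x| := by
  have hmono : |Real.exp x - 1 - x| ≤ |x| ^ 2 * Real.exp |x| := by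
    have := Complex.norm_exp_sub_sum_le_norm_mul_exp (x : ℂ) 2
    simp only [Finset.sum_range_succ, Finset.range_zero, Finset.sum_empty, pow_zero,
      Nat.factorial_zero, Nat.cast_one, div_one, zero_add, pow_one, Nat.factorial_one] at this
    rw [← Complex.ofReal_exp, ← Complex.ofReal_one, ← Complex.ofReal_add, ← Complex.ofReal_sub,
      Complex.norm_real, Complex.norm_real, Real.norm_eq_abs, Real.norm_eq_abs] at this
    rwa [sub_sub]
  rw [sq_abs] at hmono
  linarith [le_abs_self (Real.exp x - 1 - x)]

/-- A random variable with an exponential moment has a centred moment generating function bounded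
by that of a Gaussian near the origin. -/
theorem lintegral_exp_mul_sub_integral_le {f : E → ℝ} (hf : Measurable f) {s t : ℝ} (hs : 0 < s)
    (ht : |t| ≤ s / 2)
    (h : ∫⁻ x, ENNReal.ofReal (Real.exp (s * |f x|)) ∂L ≤ 2) :
    ∫⁻ x, ENNReal.ofReal (Real.exp (t * f x)) ∂L ≤
      ENNReal.ofReal (Real.exp (t * ∫ x, f x ∂L + 16 * t ^ 2 / s ^ 2)) := by
  have hE : Integrable (fun x => Real.exp (s * |f x|)) L := by
    refine ⟨by fun_prop, ?_⟩
    rw [hasFiniteIntegral_iff_ofReal (Filter.Eventually.of_forall fun x => by positivity)]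
    exact h.trans_lt (by simp)
  have hE2 : ∫ x, Real.exp (s * |f x|) ∂L ≤ 2 := by
    rw [integral_eq_lintegral_of_nonneg_ae (Filter.Eventually.of_forall fun x => by positivity)
      (by fun_prop)]
    exact ENNReal.toReal_le_of_le_ofReal (by norm_num) (by simpa using h)
  have hf1 : Integrable f L := by
    refine Integrable.mono' (hE.const_mul s⁻¹) (by fun_prop) (Filter.Eventually.of_forall fun x => ?_)
    rw [Real.norm_eq_abs, ← div_eq_inv_mul, le_div_iff₀ hs]
    have := Real.add_one_le_exp (s * |f x|)
    linarith
  -- Half of the exponent `s |f|` absorbs the quadratic factor and the other half absorbs `exp |t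
  -- f|`, whence the restriction `|t| ≤ s / 2`.
  have hpt : ∀ x, Real.exp (t * f x) ≤ 1 + t * f x + 8 * t ^ 2 / s ^ 2 * Real.exp (s * |f x|) := by
    intro x
    refine (exp_le_one_add_add_sq_mul _).trans ?_
    have h1 : Real.exp |t * f x| ≤ Real.exp (s * |f x| / 2) := by
      apply Real.exp_le_exp.2
      rw [abs_mul]
      nlinarith [abs_nonneg (f x)]
    have h2 : (s * |f x| / 2) ^ 2 ≤ 2 * Real.exp (s * |f x| / 2) := by
      have := Real.pow_div_factorial_le_exp (s * |f x| / 2) (by positivity) 2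
      norm_num [Nat.factorial] at this
      linarith
    have h3 : (t * f x) ^ 2 ≤ 8 * t ^ 2 / s ^ 2 * Real.exp (s * |f x| / 2) := by
      rw [div_mul_eq_mul_div, le_div_iff₀ (by positivity)]
      have : (t * f x) ^ 2 * s ^ 2 = 4 * t ^ 2 * (s * |f x| / 2) ^ 2 := by
        have := sq_abs (f x)
        rw [div_pow, mul_pow, mul_pow, this]
        ring
      rw [this]
      nlinarith [sq_nonneg t]
    have h4 : Real.exp (s * |f x| / 2) * Real.exp (s * |f x| / 2) = Real.exp (s * |f x|) := by
      rw [← Real.exp_add]; congr 1; ring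
    have h5 : (t * f x) ^ 2 * Real.exp |t * f x| ≤ 8 * t ^ 2 / s ^ 2 * Real.exp (s * |f x|) := by
      rw [← h4, ← mul_assoc]
      exact mul_le_mul h3 h1 (by positivity) (by positivity)
    linarith
  have hint : Integrable (fun x => 1 + t * f x + 8 * t ^ 2 / s ^ 2 * Real.exp (s * |f x|)) L :=
    ((integrable_const _).add (hf1.const_mul _)).add (hE.const_mul _)
  calc _ ≤ ∫⁻ x, ENNReal.ofReal (1 + t * f x + 8 * t ^ 2 / s ^ 2 * Real.exp (s * |f x|)) ∂L :=
        lintegral_mono fun x => ENNReal.ofReal_le_ofReal (hpt x)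
    _ = ENNReal.ofReal (∫ x, (1 + t * f x + 8 * t ^ 2 / s ^ 2 * Real.exp (s * |f x|)) ∂L) :=
        (ofReal_integral_eq_lintegral_ofReal hint (Filter.Eventually.of_forall fun x =>
          (Real.exp_pos _).le.trans (hpt x))).symm
    _ ≤ _ := by
        apply ENNReal.ofReal_le_ofReal
        have h0 : Integrable (fun x => 1 + t * f x) L :=
          (integrable_const _).add (hf1.const_mul _)
        rw [integral_add h0 (hE.const_mul _),
          integral_add (integrable_const _) (hf1.const_mul _), integral_const_mul,
          integral_const_mul]
        simp only [integral_const, probReal_univ, one_smul]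
        have h1 : 8 * t ^ 2 / s ^ 2 * ∫ x, Real.exp (s * |f x|) ∂L ≤ 8 * t ^ 2 / s ^ 2 * 2 := by
          gcongr
        have h2 := Real.add_one_le_exp (t * ∫ x, f x ∂L + 16 * t ^ 2 / s ^ 2)
        have h3 : 16 * t ^ 2 / s ^ 2 = 8 * t ^ 2 / s ^ 2 * 2 := by ring
        rw [h3] at h2 ⊢
        linarith

/-- **Bernstein's inequality** for the mean of an independent sample, at the scale `d`. -/
theorem measure_pi_abs_sum_sub_ge_le {f : E → ℝ} (hf : Measurable f) {s d : ℝ} (hs : 0 < s)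
    (hd : 0 ≤ d) (hd' : d ≤ 1 / 2) (h : ∫⁻ x, ENNReal.ofReal (Real.exp (s * |f x|)) ∂L ≤ 2) :
    (Measure.pi fun _ : Fin n => L)
        {y | n * (22 / s * d) ≤ |∑ i, f (y i) - n * ∫ x, f x ∂L|} ≤
      ENNReal.ofReal (2 * Real.exp (-(6 * (n * d ^ 2)))) := by
  set m := ∫ x, f x ∂L
  -- Chernoff's bound with `t = ± s d`: the exponent is `16 n d² - 22 n d² = -6 n d²`. With `n d² =
  -- log p` this is `p⁻⁶`, enough for a union over the `p²` entries of a matrix.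
  have key : ∀ t : ℝ, |t| = s * d → (Measure.pi fun _ : Fin n => L)
      {y | t * (n * m) + s * d * (n * (22 / s * d)) ≤ ∑ i, t * f (y i)} ≤
      ENNReal.ofReal (Real.exp (-(6 * (n * d ^ 2)))) := by
    intro t ht
    refine (measure_pi_sum_ge_le L n (f := fun x => t * f x) (by fun_prop) _
      (lintegral_exp_mul_sub_integral_le L hf hs (by rw [ht]; nlinarith) h)).trans ?_
    apply ENNReal.ofReal_le_ofReal
    apply Real.exp_le_exp.2
    have : t ^ 2 = s ^ 2 * d ^ 2 := by rw [← sq_abs, ht]; ring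
    rw [this]
    apply le_of_eq
    field_simp
    ring
  have h1 := key (s * d) (abs_of_nonneg (by positivity))
  have h2 := key (-(s * d)) (by rw [abs_neg, abs_of_nonneg (by positivity)])
  rw [two_mul, ENNReal.ofReal_add (by positivity) (by positivity)]
  refine (measure_mono ?_).trans ((measure_union_le _ _).trans (add_le_add h1 h2))
  intro y hy
  simp only [Set.mem_ofPred_eq, Set.mem_union, ← Finset.mul_sum] at hy ⊢
  have hsd : 0 ≤ s * d := by positivity
  rcases abs_cases (∑ i, f (y i) - n * m) with ⟨h, _⟩ | ⟨h, _⟩ <;> rw [h] at hy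
  · left; nlinarith
  · right; nlinarith

/-- Markov's inequality for the mean of an independent sample of a nonnegative function. -/
theorem measure_pi_sum_ge_le_lintegral {f : E → ℝ} (hf : Measurable f) (h0 : ∀ x, 0 ≤ f x)
    (hn : 0 < n) :
    (Measure.pi fun _ : Fin n => L) {y | (n : ℝ) ≤ ∑ i, f (y i)} ≤
      ∫⁻ x, ENNReal.ofReal (f x) ∂L := by
  have h1 := mul_meas_ge_le_lintegral (μ := Measure.pi fun _ : Fin n => L)
    (f := fun y => ∑ i, ENNReal.ofReal (f (y i))) (by fun_prop) n
  rw [lintegral_pi_sum L n (g := fun x => ENNReal.ofReal (f x)) (by fun_prop)] at h1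
  have h2 : {y : Fin n → E | (n : ℝ≥0∞) ≤ ∑ i, ENNReal.ofReal (f (y i))} =
      {y | (n : ℝ) ≤ ∑ i, f (y i)} := by
    ext y
    simp only [Set.mem_ofPred_eq]
    rw [← ENNReal.ofReal_sum_of_nonneg fun i _ => h0 _, ← ENNReal.ofReal_natCast,
      ENNReal.ofReal_le_ofReal_iff (Finset.sum_nonneg fun i _ => h0 _)]
  rw [h2] at h1
  exact (ENNReal.mul_le_mul_iff_right (by simpa using hn.ne') (by simp)).1 h1

theorem measure_pi_exists_le {A : Set E} (hA : MeasurableSet A) :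
    (Measure.pi fun _ : Fin n => L) {y | ∃ i, y i ∈ A} ≤ n * L A := by
  have : {y : Fin n → E | ∃ i, y i ∈ A} = ⋃ i, Function.eval i ⁻¹' A := by ext; simp
  rw [this]
  refine (measure_iUnion_fintype_le _ _).trans (le_of_eq ?_)
  have h : ∀ i : Fin n, (Measure.pi fun _ : Fin n => L) (Function.eval i ⁻¹' A) = L A :=
    fun i => (measurePreserving_eval (fun _ : Fin n => L) i).measure_preimage hA.nullMeasurableSet
  simp [h]

end Sampling

/-! ### The square root of the scatter matrix -/

section Root
variable {p : ℕ}

/-- The linear map of the symmetric square root of `Sig`. -/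
def scatterRoot (Sig : Matrix (Fin p) (Fin p) ℝ) :
    EuclideanSpace ℝ (Fin p) →L[ℝ] EuclideanSpace ℝ (Fin p) :=
  Matrix.toEuclideanCLM (n := Fin p) (𝕜 := ℝ) (CFC.sqrt Sig)

theorem inner_toEuclideanCLM_of_isHermitian {A : Matrix (Fin p) (Fin p) ℝ} (hA : A.IsHermitian)
    (x y : EuclideanSpace ℝ (Fin p)) :
    inner ℝ (Matrix.toEuclideanCLM (n := Fin p) (𝕜 := ℝ) A x) y =
      inner ℝ x (Matrix.toEuclideanCLM (n := Fin p) (𝕜 := ℝ) A y) := by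
  rw [← ContinuousLinearMap.adjoint_inner_right]
  congr 2
  rw [← ContinuousLinearMap.star_eq_adjoint, ← map_star]
  congr 1

theorem inner_scatterRoot_left {Sig : Matrix (Fin p) (Fin p) ℝ}
    (x y : EuclideanSpace ℝ (Fin p)) :
    inner ℝ (scatterRoot Sig x) y = inner ℝ x (scatterRoot Sig y) :=
  inner_toEuclideanCLM_of_isHermitian
    (Matrix.nonneg_iff_posSemidef.1 (CFC.sqrt_nonneg Sig)).isHermitian x y

theorem inner_scatterRoot_scatterRoot {Sig : Matrix (Fin p) (Fin p) ℝ} (h : Sig.PosDef)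
    (x y : EuclideanSpace ℝ (Fin p)) :
    inner ℝ (scatterRoot Sig x) (scatterRoot Sig y) =
      inner ℝ x (Matrix.toEuclideanCLM (n := Fin p) (𝕜 := ℝ) Sig y) := by
  rw [inner_scatterRoot_left]
  congr 1
  have h0 : 0 ≤ Sig := Matrix.nonneg_iff_posSemidef.2 h.posSemidef
  conv_rhs => rw [← CFC.sqrt_mul_sqrt_self Sig h0, map_mul]
  rfl

theorem scatterRoot_apply (Sig : Matrix (Fin p) (Fin p) ℝ) (x : EuclideanSpace ℝ (Fin p))
    (j : Fin p) :
    scatterRoot Sig x j = inner ℝ (scatterRoot Sig (EuclideanSpace.single j 1)) x := by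
  rw [inner_scatterRoot_left]
  simp [EuclideanSpace.inner_single_left]

theorem inner_scatterRoot_single {Sig : Matrix (Fin p) (Fin p) ℝ} (h : Sig.PosDef) (j k : Fin p) :
    inner ℝ (scatterRoot Sig (EuclideanSpace.single j 1))
      (scatterRoot Sig (EuclideanSpace.single k 1)) = Sig j k := by
  rw [inner_scatterRoot_scatterRoot h]
  rw [EuclideanSpace.inner_single_left, Matrix.ofLp_toEuclideanCLM]
  simp

theorem sq_norm_scatterRoot {Sig : Matrix (Fin p) (Fin p) ℝ} (h : Sig.PosDef)
    (u : EuclideanSpace ℝ (Fin p)) :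
    ‖scatterRoot Sig u‖ ^ 2 = ∑ i, h.isHermitian.eigenvalues i *
      (inner ℝ (h.isHermitian.eigenvectorBasis i) u) ^ 2 := by
  rw [← real_inner_self_eq_norm_sq, inner_scatterRoot_scatterRoot h,
    ← h.isHermitian.eigenvectorBasis.sum_inner_mul_inner]
  refine Finset.sum_congr rfl fun i _ => ?_
  rw [← inner_toEuclideanCLM_of_isHermitian h.isHermitian]
  have : Matrix.toEuclideanCLM (n := Fin p) (𝕜 := ℝ) Sig (h.isHermitian.eigenvectorBasis i) =
      h.isHermitian.eigenvalues i • h.isHermitian.eigenvectorBasis i := by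
    have := h.isHermitian.mulVec_eigenvectorBasis i
    ext k
    exact congrFun this k
  rw [this, inner_smul_left, real_inner_comm]
  simp only [conj_trivial]
  ring

theorem sum_eigenvalues_eq_trace {Sig : Matrix (Fin p) (Fin p) ℝ} (h : Sig.PosDef) :
    ∑ i, h.isHermitian.eigenvalues i = Sig.trace := by
  rw [h.isHermitian.trace_eq_sum_eigenvalues]; simp
end Root

/-! ### Elliptical laws and the reduction of their signs to the sphere -/

section EllipticalLaw
variable {p : ℕ}

@[fun_prop]
theorem measurable_spatialSign : Measurable (spatialSign : EuclideanSpace ℝ (Fin p) → _) := by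
  unfold spatialSign
  fun_prop

theorem measurable_elliptical (m : EuclideanSpace ℝ (Fin p)) (Sig : Matrix (Fin p) (Fin p) ℝ) :
    Measurable (fun z : ℝ × EuclideanSpace ℝ (Fin p) => m + z.1 • scatterRoot Sig z.2) := by
  fun_prop

theorem ellipticalLaw_eq (m : EuclideanSpace ℝ (Fin p)) (Sig : Matrix (Fin p) (Fin p) ℝ)
    (rho : Measure ℝ) : ellipticalLaw m Sig rho =
      (rho.prod (sphereUniform p)).map (fun z => m + z.1 • scatterRoot Sig z.2) := rfl

theorem ellipticalLaw_map_sub (m : EuclideanSpace ℝ (Fin p)) (Sig : Matrix (Fin p) (Fin p) ℝ)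
    (rho : Measure ℝ) :
    (ellipticalLaw m Sig rho).map (fun x => x - m) = ellipticalLaw 0 Sig rho := by
  rw [ellipticalLaw_eq, ellipticalLaw_eq, Measure.map_map (by fun_prop)
    (measurable_elliptical m Sig)]
  congr 1
  ext z : 1
  simp

/-- A positive `r` leaves the sign unchanged, and a negative one replaces `u` by `-u`, which has the
same law; `h0` excludes an atom of `rho` at zero. Hence the generating variate drops out. -/
theorem ellipticalLaw_map_spatialSign (hp : 0 < p) (Sig : Matrix (Fin p) (Fin p) ℝ)
    (rho : Measure ℝ) [IsProbabilityMeasure rho]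
    (h0 : ∀ᵐ x ∂(ellipticalLaw 0 Sig rho), x ≠ 0) :
    (ellipticalLaw 0 Sig rho).map spatialSign =
      (sphereUniform p).map (fun u => spatialSign (scatterRoot Sig u)) := by
  have := isProbabilityMeasure_sphereUniform hp
  have hrho : ∀ᵐ r ∂rho, r ≠ 0 := by
    rw [ellipticalLaw_eq] at h0
    replace h0 : ∀ᵐ x ∂_, x ∉ ({0} : Set (EuclideanSpace ℝ (Fin p))) := h0
    rw [ae_map_iff (measurable_elliptical 0 Sig).aemeasurable
      (measurableSet_singleton (0 : EuclideanSpace ℝ (Fin p))).compl] at h0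
    have := Measure.ae_ae_of_ae_prod h0
    filter_upwards [this] with r hr h
    subst h
    simp only [zero_smul, add_zero, Set.mem_singleton_iff, not_true_eq_false] at hr
    exact (NeZero.ne (sphereUniform p)) (by simpa using hr)
  refine Measure.ext_of_lintegral _ fun g hg => ?_
  rw [lintegral_map hg (by fun_prop), lintegral_map hg (by fun_prop), ellipticalLaw_eq,
    lintegral_map (by fun_prop) (measurable_elliptical 0 Sig),
    lintegral_prod _ (by fun_prop)]
  have h1 : ∀ r : ℝ, r ≠ 0 →
      ∫⁻ u, g (spatialSign (0 + r • scatterRoot Sig u)) ∂(sphereUniform p) =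
      ∫⁻ u, g (spatialSign (scatterRoot Sig u)) ∂(sphereUniform p) := by
    intro r hr
    rcases lt_or_gt_of_ne hr with h | h
    · conv_rhs => rw [← sphereUniform_map_isometry (LinearIsometryEquiv.neg ℝ),
        lintegral_map (by fun_prop) (by fun_prop)]
      refine lintegral_congr fun u => ?_
      congr 1
      simp only [spatialSign, zero_add, norm_smul, LinearIsometryEquiv.coe_neg, map_neg, norm_neg,
        smul_smul, Real.norm_of_nonpos h.le, smul_neg, ← neg_smul]
      congr 1
      field_simp
    · refine lintegral_congr fun u => ?_
      congr 1
      simp only [spatialSign, zero_add, norm_smul, smul_smul, Real.norm_of_nonneg h.le]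
      congr 1
      field_simp
  calc _ = ∫⁻ r, ∫⁻ u, g (spatialSign (scatterRoot Sig u)) ∂(sphereUniform p) ∂rho := by
        refine lintegral_congr_ae ?_
        filter_upwards [hrho] with r hr using h1 r hr
    _ = _ := by simp

/-! ### Signs of elliptical vectors -/

variable {Sig : Matrix (Fin p) (Fin p) ℝ} {η : ℝ}

theorem le_sq_norm_scatterRoot (h : Sig.PosDef) (hη : ∀ i, η ≤ h.isHermitian.eigenvalues i)
    (u : EuclideanSpace ℝ (Fin p)) : η * ‖u‖ ^ 2 ≤ ‖scatterRoot Sig u‖ ^ 2 := by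
  rw [sq_norm_scatterRoot h, ← h.isHermitian.eigenvectorBasis.sum_sq_inner_right, Finset.mul_sum]
  exact Finset.sum_le_sum fun i _ => mul_le_mul_of_nonneg_right (hη i) (sq_nonneg _)

theorem sq_norm_scatterRoot_le (h : Sig.PosDef) (hη : ∀ i, h.isHermitian.eigenvalues i ≤ 1 / η)
    (u : EuclideanSpace ℝ (Fin p)) : ‖scatterRoot Sig u‖ ^ 2 ≤ 1 / η * ‖u‖ ^ 2 := by
  rw [sq_norm_scatterRoot h, ← h.isHermitian.eigenvectorBasis.sum_sq_inner_right, Finset.mul_sum]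
  exact Finset.sum_le_sum fun i _ => mul_le_mul_of_nonneg_right (hη i) (sq_nonneg _)

theorem spatialSign_neg (x : EuclideanSpace ℝ (Fin p)) : spatialSign (-x) = -spatialSign x := by
  simp [spatialSign]

theorem lintegral_sphereUniform_comp_neg {g : EuclideanSpace ℝ (Fin p) → ℝ≥0∞}
    (hg : Measurable g) :
    ∫⁻ u, g (-u) ∂(sphereUniform p) = ∫⁻ u, g u ∂(sphereUniform p) := by
  conv_rhs => rw [← sphereUniform_map_isometry (LinearIsometryEquiv.neg ℝ),
    lintegral_map hg (by fun_prop)]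
  rfl

theorem exp_add_exp_neg_mono {x y : ℝ} (h : |x| ≤ |y|) :
    Real.exp x + Real.exp (-x) ≤ Real.exp y + Real.exp (-y) := by
  have := Real.cosh_le_cosh.2 h
  rw [Real.cosh_eq, Real.cosh_eq] at this
  linarith

/-- Linear functionals of the sign of an elliptical vector are sub-Gaussian, with a variance proxy
of order `1 / p`. -/
theorem lintegral_exp_inner_spatialSign_le (hp : 2 ≤ p) (h : Sig.PosDef) (hη : 0 < η)
    (h1 : ∀ i, η ≤ h.isHermitian.eigenvalues i) (h2 : ∀ i, h.isHermitian.eigenvalues i ≤ 1 / η)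
    (a : EuclideanSpace ℝ (Fin p)) :
    ∫⁻ u, ENNReal.ofReal (Real.exp (inner ℝ a (spatialSign (scatterRoot Sig u))))
        ∂(sphereUniform p) ≤
      ENNReal.ofReal (Real.exp (2 / (η ^ 2 * p) * ‖a‖ ^ 2 / 2)) := by
  have hp' : (2 : ℝ) ≤ p := by exact_mod_cast hp
  -- On the sphere `‖Σ^{1/2} u‖ ≥ √η`, so the absolute value of the functional of the sign is at
  -- most `|⟨c, u⟩|`.
  set c : EuclideanSpace ℝ (Fin p) := (√η)⁻¹ • scatterRoot Sig a with hc
  have hsη : 0 < √η := Real.sqrt_pos.2 hη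
  -- Domination of absolute values does not compare exponentials. By the symmetry of the sphere each
  -- exponential integral may be replaced by one of `cosh`, which is monotone in the absolute value.
  have hsymm : ∀ f : EuclideanSpace ℝ (Fin p) → ℝ, Measurable f → (∀ u, f (-u) = -f u) →
      2 * ∫⁻ u, ENNReal.ofReal (Real.exp (f u)) ∂(sphereUniform p) =
      ∫⁻ u, ENNReal.ofReal (Real.exp (f u) + Real.exp (-f u)) ∂(sphereUniform p) := by
    intro f hf hodd
    have h3 : ∫⁻ u, ENNReal.ofReal (Real.exp (-f u)) ∂(sphereUniform p) =
        ∫⁻ u, ENNReal.ofReal (Real.exp (f u)) ∂(sphereUniform p) := by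
      rw [← lintegral_sphereUniform_comp_neg (by fun_prop)]
      simp_rw [hodd, neg_neg]
    simp_rw [ENNReal.ofReal_add (Real.exp_pos _).le (Real.exp_pos _).le]
    rw [lintegral_add_left (by fun_prop), h3, two_mul]
  have hmono : 2 * ∫⁻ u, ENNReal.ofReal (Real.exp (inner ℝ a (spatialSign (scatterRoot Sig u))))
      ∂(sphereUniform p) ≤ 2 * ∫⁻ u, ENNReal.ofReal (Real.exp (inner ℝ c u))
      ∂(sphereUniform p) := by
    rw [hsymm _ (by fun_prop) (fun u => by rw [map_neg, spatialSign_neg, inner_neg_right]),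
      hsymm _ (by fun_prop) (fun u => by rw [inner_neg_right])]
    refine lintegral_mono_ae ?_
    filter_upwards [ae_norm_eq_one_sphereUniform] with u hu
    apply ENNReal.ofReal_le_ofReal
    apply exp_add_exp_neg_mono
    have hlow := le_sq_norm_scatterRoot h h1 u
    rw [hu, one_pow, mul_one] at hlow
    have hlow' : √η ≤ ‖scatterRoot Sig u‖ := Real.sqrt_le_iff.2 ⟨norm_nonneg _, hlow⟩
    rw [spatialSign, inner_smul_right, hc, inner_smul_left, inner_scatterRoot_left, abs_mul,
      abs_mul]
    simp only [abs_inv, abs_norm, conj_trivial, abs_of_pos hsη]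
    gcongr
  have h3 := (ENNReal.mul_le_mul_iff_right (by norm_num) (by norm_num)).1 hmono
  refine h3.trans ((lintegral_exp_inner_sphereUniform_le hp c).trans ?_)
  apply ENNReal.ofReal_le_ofReal
  apply Real.exp_le_exp.2
  have hcn : ‖c‖ ^ 2 ≤ ‖a‖ ^ 2 / η ^ 2 := by
    rw [hc, norm_smul, mul_pow, norm_inv, inv_pow, Real.norm_of_nonneg hsη.le, Real.sq_sqrt hη.le]
    calc η⁻¹ * ‖scatterRoot Sig a‖ ^ 2 ≤ η⁻¹ * (1 / η * ‖a‖ ^ 2) := by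
          gcongr; exact sq_norm_scatterRoot_le h h2 a
      _ = _ := by field_simp
  calc ‖c‖ ^ 2 / (2 * ((p : ℝ) - 1)) ≤ (‖a‖ ^ 2 / η ^ 2) / p := by
        gcongr
        linarith
    _ = _ := by field_simp

/-- Products of two coordinates of the sign have an exponential moment at the scale `1 / p`. -/
theorem lintegral_exp_abs_mul_le {E : Type*} [MeasurableSpace E] (P : Measure E) [SFinite P]
    (hp : 0 < p) {V : E → EuclideanSpace ℝ (Fin p)} (hV : Measurable V) (hη : 0 < η)
    (h : ∀ a : EuclideanSpace ℝ (Fin p), ∫⁻ u, ENNReal.ofReal (Real.exp (inner ℝ a (V u))) ∂P ≤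
      ENNReal.ofReal (Real.exp (2 / (η ^ 2 * p) * ‖a‖ ^ 2 / 2))) (j k : Fin p) :
    ∫⁻ u, ENNReal.ofReal (Real.exp (η ^ 2 / 8 * |p * (V u j * V u k)|)) ∂P ≤ 2 := by
  have hp' : (0 : ℝ) < p := by exact_mod_cast hp
  have hVj : ∀ j, Measurable fun u => V u j := fun j => by fun_prop
  have hsq : ∀ j, ∫⁻ u, ENNReal.ofReal (Real.exp (η ^ 2 / 8 * (p * (V u j) ^ 2))) ∂P ≤ 2 := by
    intro j
    -- The one-dimensional case: variance proxy `2 / (η² p)` gives the exponent `η² p / 8`, and the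
    -- resulting bound `√2` is relaxed to `2`.
    have h1 := lintegral_exp_sq_norm_le P (F := ℝ) (hVj j) (s := 2 / (η ^ 2 * p)) (by positivity)
      (fun t => by
        have := h (EuclideanSpace.single j t)
        simpa [EuclideanSpace.inner_single_left, mul_comm] using this)
    calc _ = ∫⁻ u, ENNReal.ofReal (Real.exp (‖V u j‖ ^ 2 / (4 * (2 / (η ^ 2 * p))))) ∂P := by
          refine lintegral_congr fun u => ?_
          congr 2
          rw [Real.norm_eq_abs, sq_abs]
          field_simp
          ring
      _ ≤ _ := h1
      _ ≤ ENNReal.ofReal 2 := by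
          apply ENNReal.ofReal_le_ofReal
          calc (2 : ℝ) ^ ((Module.finrank ℝ ℝ : ℝ) / 2) ≤ 2 ^ (1 : ℝ) := by
                apply Real.rpow_le_rpow_of_exponent_le (by norm_num)
                simp
                norm_num
            _ = 2 := by simp
      _ = 2 := by simp
  have h2 : 2 * ∫⁻ u, ENNReal.ofReal (Real.exp (η ^ 2 / 8 * |p * (V u j * V u k)|)) ∂P ≤
      2 * 2 := by
    rw [← lintegral_const_mul _ (by fun_prop), two_mul]
    refine le_trans ?_ (add_le_add (hsq j) (hsq k))
    rw [← lintegral_add_left (by fun_prop)]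
    refine lintegral_mono fun u => ?_
    have h22 : ∀ x : ℝ, 2 * ENNReal.ofReal x = ENNReal.ofReal (2 * x) := fun x => by
      rw [ENNReal.ofReal_mul (by norm_num)]; simp
    rw [← ENNReal.ofReal_add (by positivity) (by positivity), h22]
    apply ENNReal.ofReal_le_ofReal
    set x := Real.exp (η ^ 2 / 16 * (p * (V u j) ^ 2)) with hx
    set y := Real.exp (η ^ 2 / 16 * (p * (V u k) ^ 2)) with hy
    have e1 : Real.exp (η ^ 2 / 8 * (p * (V u j) ^ 2)) = x * x := by
      rw [hx, ← Real.exp_add]; congr 1; ring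
    have e2 : Real.exp (η ^ 2 / 8 * (p * (V u k) ^ 2)) = y * y := by
      rw [hy, ← Real.exp_add]; congr 1; ring
    have e3 : Real.exp (η ^ 2 / 8 * |p * (V u j * V u k)|) ≤ x * y := by
      rw [hx, hy, ← Real.exp_add]
      apply Real.exp_le_exp.2
      have : |(p : ℝ) * (V u j * V u k)| ≤ p * ((V u j) ^ 2 + (V u k) ^ 2) / 2 := by
        rw [abs_mul, abs_of_pos hp', mul_div_assoc]
        gcongr
        rw [abs_le]
        constructor <;> nlinarith [sq_nonneg (V u j + V u k), sq_nonneg (V u j - V u k)]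
      have h3 : 0 ≤ η ^ 2 / 8 := by positivity
      nlinarith
    rw [e1, e2]
    nlinarith [sq_nonneg (x - y)]
  exact (ENNReal.mul_le_mul_iff_right (by norm_num) (by norm_num)).1 h2

/-- The spatial-sign covariance matrix of an elliptical law is close to the normalized scatter
matrix. -/
theorem abs_integral_sign_mul_sign_sub_le (hp : 2 ≤ p) (h : Sig.PosDef) (hη : 0 < η)
    (h1 : ∀ i, η ≤ h.isHermitian.eigenvalues i) (h2 : ∀ i, h.isHermitian.eigenvalues i ≤ 1 / η)
    (j k : Fin p) :
    |∫ u, (p : ℝ) * (spatialSign (scatterRoot Sig u) j * spatialSign (scatterRoot Sig u) k)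
        ∂(sphereUniform p) - p * Sig j k / Sig.trace| ≤ 320 / η ^ 4 / √p := by
  have hp0 : 0 < p := by omega
  have hp' : (2 : ℝ) ≤ p := by exact_mod_cast hp
  have := isProbabilityMeasure_sphereUniform hp0
  set b : Fin p → EuclideanSpace ℝ (Fin p) := fun j => scatterRoot Sig (EuclideanSpace.single j 1)
    with hb
  set τ := Sig.trace / p with hτ
  have hητ : η ≤ τ := by
    rw [hτ, le_div_iff₀ (by linarith), ← sum_eigenvalues_eq_trace h]
    calc η * p = ∑ _i : Fin p, η := by simp [mul_comm]
      _ ≤ _ := Finset.sum_le_sum fun i _ => h1 i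
  have hτ0 : 0 < τ := hη.trans_le hητ
  have hSig : p * Sig j k / Sig.trace =
      ∫ u, (p : ℝ) / τ * (inner ℝ (b j) u * inner ℝ (b k) u) ∂(sphereUniform p) := by
    rw [integral_const_mul, integral_inner_mul_inner hp0, inner_scatterRoot_single h, hτ]
    have : Sig.trace ≠ 0 := by
      intro h0; rw [hτ, h0] at hτ0; simp at hτ0
    field_simp
  set A : EuclideanSpace ℝ (Fin p) → ℝ := fun u => inner ℝ (b j) u * inner ℝ (b k) u with hA
  set D : EuclideanSpace ℝ (Fin p) → ℝ := fun u => ‖scatterRoot Sig u‖ ^ 2 - τ with hD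
  have hsign : ∀ u, (p : ℝ) * (spatialSign (scatterRoot Sig u) j *
      spatialSign (scatterRoot Sig u) k) = p * (A u / ‖scatterRoot Sig u‖ ^ 2) := fun u => by
    simp only [spatialSign, PiLp.smul_apply, smul_eq_mul, scatterRoot_apply Sig u, hA, hb]
    ring
  have hlow : ∀ᵐ u ∂(sphereUniform p), η ≤ ‖scatterRoot Sig u‖ ^ 2 := by
    filter_upwards [ae_norm_eq_one_sphereUniform] with u hu
    have := le_sq_norm_scatterRoot h h1 u
    rwa [hu, one_pow, mul_one] at this
  have hbn : ∀ j, ‖b j‖ ^ 4 ≤ 1 / η ^ 2 := fun j => by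
    have := sq_norm_scatterRoot_le h h2 (EuclideanSpace.single j 1)
    simp only [PiLp.norm_single, norm_one, one_pow, mul_one] at this
    calc ‖b j‖ ^ 4 = (‖b j‖ ^ 2) ^ 2 := by ring
      _ ≤ (1 / η) ^ 2 := by gcongr
      _ = _ := by field_simp
  have hAsq : ∫ u, (A u) ^ 2 ∂(sphereUniform p) ≤ 320 / (η ^ 2 * p ^ 2) := by
    have hb4 : ∀ j, ∫ u, (inner ℝ (b j) u) ^ 4 ∂(sphereUniform p) ≤ 320 / (η ^ 2 * p ^ 2) := by
      intro j
      refine (integral_inner_pow_four_le hp (b j)).trans ?_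
      calc 320 * ‖b j‖ ^ 4 / (p : ℝ) ^ 2 ≤ 320 * (1 / η ^ 2) / (p : ℝ) ^ 2 := by
            gcongr; exact hbn j
        _ = _ := by field_simp
    calc _ ≤ ∫ u, (1 / 2 * ((inner ℝ (b j) u) ^ 4 + (inner ℝ (b k) u) ^ 4))
          ∂(sphereUniform p) := by
          refine integral_mono (integrable_sphereUniform hp0 (by fun_prop))
            (integrable_sphereUniform hp0 (by fun_prop)) fun u => ?_
          simp only [hA]
          nlinarith [sq_nonneg ((inner ℝ (b j) u : ℝ) ^ 2 - (inner ℝ (b k) u) ^ 2)]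
      _ ≤ _ := by
          rw [integral_const_mul, integral_add (integrable_sphereUniform hp0 (by fun_prop))
            (integrable_sphereUniform hp0 (by fun_prop))]
          linarith [hb4 j, hb4 k]
  have hDsq : ∫ u, (D u) ^ 2 ∂(sphereUniform p) ≤ 320 / (η ^ 2 * p) := by
    have hl0 : ∀ i, 0 ≤ h.isHermitian.eigenvalues i := fun i => hη.le.trans (h1 i)
    have hvar := integral_sq_sum_sub_le hp h.isHermitian.eigenvectorBasis hl0
    rw [sum_eigenvalues_eq_trace h] at hvar
    simp only [hD, sq_norm_scatterRoot h]
    refine hvar.trans ?_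
    calc _ ≤ 320 / (p : ℝ) ^ 2 * ∑ _i : Fin p, (1 / η) ^ 2 := by
          gcongr with i _
          · exact hl0 i
          · exact h2 i
      _ = _ := by
          simp only [Finset.sum_const, Finset.card_univ, Fintype.card_fin, nsmul_eq_mul]
          field_simp
  have hsp : 0 < √(p : ℝ) := Real.sqrt_pos.2 (by linarith)
  have hpp : √(p : ℝ) * √p = p := Real.mul_self_sqrt (by linarith)
  have hAint : Integrable A (sphereUniform p) := integrable_sphereUniform hp0 (by fun_prop)
  have hint1 : Integrable (fun u => (p : ℝ) * (A u / ‖scatterRoot Sig u‖ ^ 2))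
      (sphereUniform p) := by
    refine Integrable.mono' (hAint.norm.const_mul (p / η))
      (Measurable.aestronglyMeasurable (by fun_prop)) ?_
    filter_upwards [hlow] with u hu
    rw [norm_mul, norm_div, Real.norm_of_nonneg (by positivity : (0 : ℝ) ≤ p),
      Real.norm_of_nonneg (sq_nonneg ‖scatterRoot Sig u‖)]
    calc (p : ℝ) * (‖A u‖ / ‖scatterRoot Sig u‖ ^ 2) ≤ p * (‖A u‖ / η) := by gcongr
      _ = _ := by ring
  simp_rw [hsign]
  rw [hSig, ← integral_sub hint1 (hAint.const_mul _), ← Real.norm_eq_abs]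
  -- Replacing `‖Σ^{1/2} u‖²` by its mean `τ` costs `p A D / (τ w)`. Since `A²` has mean `O(1 / p²)`
  -- and `D²` has mean `O(1 / p)`, the weight `√p` balances the two terms of the
  -- arithmetic-geometric inequality.
  have hbd : Integrable (fun u => (p : ℝ) / η ^ 2 * (1 / 2 * (√p * (A u) ^ 2 + (D u) ^ 2 / √p)))
      (sphereUniform p) := integrable_sphereUniform hp0 (by fun_prop)
  refine (norm_integral_le_of_norm_le hbd ?_).trans ?_
  · filter_upwards [hlow] with u hu
    set w := ‖scatterRoot Sig u‖ ^ 2 with hw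
    have hw0 : 0 < w := hη.trans_le hu
    have e1 : (p : ℝ) * (A u / w) - p / τ * (inner ℝ (b j) u * inner ℝ (b k) u) =
        -(p / (τ * w) * (A u * D u)) := by
      simp only [hA, hD, ← hw]
      field_simp
      ring
    rw [e1, norm_neg, norm_mul, Real.norm_of_nonneg (by positivity : (0 : ℝ) ≤ p / (τ * w))]
    have e2 : ‖A u * D u‖ ≤ 1 / 2 * (√p * (A u) ^ 2 + (D u) ^ 2 / √p) := by
      rw [Real.norm_eq_abs]
      have e3 : √p * (A u) ^ 2 + (D u) ^ 2 / √p =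
          ((√p * A u) ^ 2 + (D u) ^ 2) / √p := by
        field_simp
      rw [e3, abs_le]
      constructor
      · rw [neg_le_iff_add_nonneg]
        have : A u * D u + 1 / 2 * (((√p * A u) ^ 2 + (D u) ^ 2) / √p) =
            (√p * A u + D u) ^ 2 / (2 * √p) := by field_simp; ring
        rw [this]; positivity
      · rw [← sub_nonneg]
        have : 1 / 2 * (((√p * A u) ^ 2 + (D u) ^ 2) / √p) - A u * D u =
            (√p * A u - D u) ^ 2 / (2 * √p) := by field_simp; ring
        rw [this]; positivity
    have e4 : (p : ℝ) / (τ * w) ≤ p / η ^ 2 := by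
      rw [sq]; gcongr
    exact mul_le_mul e4 e2 (norm_nonneg _) (by positivity)
  · rw [integral_const_mul, integral_const_mul,
      integral_add (integrable_sphereUniform hp0 (by fun_prop))
        (integrable_sphereUniform hp0 (by fun_prop)), integral_const_mul, integral_div]
    calc (p : ℝ) / η ^ 2 * (1 / 2 * (√p * ∫ u, (A u) ^ 2 ∂(sphereUniform p) +
          (∫ u, (D u) ^ 2 ∂(sphereUniform p)) / √p))
        ≤ p / η ^ 2 * (1 / 2 * (√p * (320 / (η ^ 2 * p ^ 2)) + 320 / (η ^ 2 * p) / √p)) := by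
          gcongr
      _ = _ := by
          have hpp2 : √(p : ℝ) ^ 2 = p := by rw [sq, hpp]
          field_simp
          rw [hpp2]
          ring

end EllipticalLaw

/-! ### Spatial medians -/

section Median
variable {p n : ℕ}

theorem exists_isSpatialMedian (hn : 0 < n) (x : Fin n → EuclideanSpace ℝ (Fin p)) :
    ∃ a, IsSpatialMedian x a := by
  have hc : Continuous fun m : EuclideanSpace ℝ (Fin p) => ∑ i, ‖x i - m‖ := by fun_prop
  refine hc.exists_forall_le ?_
  have h1 : Filter.Tendsto (fun m : EuclideanSpace ℝ (Fin p) => ‖m‖ - ‖x ⟨0, hn⟩‖)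
      (Filter.cocompact _) Filter.atTop :=
    Filter.tendsto_atTop_add_const_right _ _ (tendsto_norm_cocompact_atTop)
  refine Filter.tendsto_atTop_mono (fun m => ?_) h1
  calc ‖m‖ - ‖x ⟨0, hn⟩‖ ≤ ‖x ⟨0, hn⟩ - m‖ := by
        rw [norm_sub_rev]; exact norm_sub_norm_le _ _
    _ ≤ _ := Finset.single_le_sum (f := fun i => ‖x i - m‖) (fun i _ => norm_nonneg _)
        (Finset.mem_univ _)

theorem IsSpatialMedian.sub {x : Fin n → EuclideanSpace ℝ (Fin p)} {a : EuclideanSpace ℝ (Fin p)}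
    (h : IsSpatialMedian x a) (m : EuclideanSpace ℝ (Fin p)) :
    IsSpatialMedian (fun i => x i - m) (a - m) := by
  intro m'
  have := h (m' + m)
  simpa [sub_sub, add_comm, sub_sub_sub_cancel_right] using this

theorem sampleSignCov_sub (x : Fin n → EuclideanSpace ℝ (Fin p)) (a m : EuclideanSpace ℝ (Fin p)) :
    sampleSignCov (fun i => x i - m) (a - m) = sampleSignCov x a := by
  simp [sampleSignCov, sub_sub_sub_cancel_right]

theorem norm_smul_spatialSign (y : EuclideanSpace ℝ (Fin p)) : ‖y‖ • spatialSign y = y := by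
  rcases eq_or_ne y 0 with rfl | hy
  · simp
  rw [spatialSign, smul_smul, mul_inv_cancel₀ (norm_ne_zero_iff.2 hy), one_smul]

theorem norm_spatialSign {y : EuclideanSpace ℝ (Fin p)} (hy : y ≠ 0) : ‖spatialSign y‖ = 1 := by
  rw [spatialSign, norm_smul, norm_inv, norm_norm, inv_mul_cancel₀ (norm_ne_zero_iff.2 hy)]

/-- A quadratic upper expansion, from `x ≤ (x² + r²) / (2 r)` with `r = ‖y‖`. It replaces
differentiation in the first-order condition. -/
theorem norm_sub_smul_le {y : EuclideanSpace ℝ (Fin p)} (hy : y ≠ 0) (e : EuclideanSpace ℝ (Fin p))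
    (t : ℝ) : ‖y - t • e‖ ≤ ‖y‖ - t * inner ℝ (spatialSign y) e + t ^ 2 * (‖e‖ ^ 2 / (2 * ‖y‖)) := by
  have hy0 : 0 < ‖y‖ := norm_pos_iff.2 hy
  have h1 : ‖y - t • e‖ ^ 2 = ‖y‖ ^ 2 - 2 * (t * inner ℝ y e) + t ^ 2 * ‖e‖ ^ 2 := by
    rw [norm_sub_sq_real, inner_smul_right, norm_smul, mul_pow, Real.norm_eq_abs, sq_abs]
  have h2 : inner ℝ (spatialSign y) e = inner ℝ y e / ‖y‖ := by
    rw [spatialSign, inner_smul_left]; simp only [conj_trivial]; field_simp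
  have h3 : ‖y - t • e‖ ≤ (‖y - t • e‖ ^ 2 + ‖y‖ ^ 2) / (2 * ‖y‖) := by
    rw [le_div_iff₀ (by positivity)]
    nlinarith [sq_nonneg (‖y - t • e‖ - ‖y‖)]
  refine h3.trans (le_of_eq ?_)
  rw [h1, h2]
  field_simp
  ring

/-- The first-order condition for a spatial median which is not an observation. -/
theorem IsSpatialMedian.sum_spatialSign_eq_zero {y : Fin n → EuclideanSpace ℝ (Fin p)}
    {a : EuclideanSpace ℝ (Fin p)} (h : IsSpatialMedian y a) (hne : ∀ i, y i - a ≠ 0) :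
    ∑ i, spatialSign (y i - a) = 0 := by
  set e := ∑ i, spatialSign (y i - a) with he
  set K := ∑ i, ‖e‖ ^ 2 / (2 * ‖y i - a‖) with hK
  have hK0 : 0 ≤ K := Finset.sum_nonneg fun i _ => by positivity
  -- Moving `a` by `t e` along the sum `e` of the signs lowers the objective by `t ‖e‖²` up to the
  -- error `t² K`; minimality forces `‖e‖² ≤ t K` for every `t > 0`.
  have key : ∀ t : ℝ, 0 < t → ‖e‖ ^ 2 ≤ t * K := by
    intro t ht
    have h1 := h (a + t • e)
    have h2 : ∑ i, ‖y i - (a + t • e)‖ ≤ ∑ i, (‖y i - a‖ -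
        t * inner ℝ (spatialSign (y i - a)) e + t ^ 2 * (‖e‖ ^ 2 / (2 * ‖y i - a‖))) :=
      Finset.sum_le_sum fun i _ => by
        rw [← sub_sub]; exact norm_sub_smul_le (hne i) e t
    rw [Finset.sum_add_distrib, Finset.sum_sub_distrib, ← Finset.mul_sum, ← Finset.mul_sum,
      ← sum_inner, ← he, real_inner_self_eq_norm_sq, ← hK] at h2
    have h3 : t * ‖e‖ ^ 2 ≤ t * (t * K) := by nlinarith
    exact le_of_mul_le_mul_left h3 ht
  have h0 : ‖e‖ ^ 2 ≤ 0 := by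
    by_contra! hpos
    rcases hK0.eq_or_lt with hK0 | hK0
    · have := key 1 one_pos
      rw [← hK0] at this
      linarith
    · have := key (‖e‖ ^ 2 / (2 * K)) (by positivity)
      have h4 : ‖e‖ ^ 2 / (2 * K) * K = ‖e‖ ^ 2 / 2 := by field_simp
      linarith
  have : ‖e‖ = 0 := by nlinarith [norm_nonneg e]
  exact norm_eq_zero.1 this

/-- With `s = ⟨U(y), a⟩`, the difference of `‖y - a‖²` and `(‖y‖ - s)²` is `‖a‖² - s²`; dividing by
the sum of the two roots, at most `2 (‖y‖ + ‖a‖)`, leaves the curvature term. This curvature,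
transverse to `y`, is what locates the median. -/
theorem le_norm_sub {y : EuclideanSpace ℝ (Fin p)} (hy : y ≠ 0) (a : EuclideanSpace ℝ (Fin p)) :
    ‖y‖ - inner ℝ (spatialSign y) a +
      (‖a‖ ^ 2 - (inner ℝ (spatialSign y) a) ^ 2) / (2 * (‖y‖ + ‖a‖)) ≤ ‖y - a‖ := by
  have hy0 : 0 < ‖y‖ := norm_pos_iff.2 hy
  set s : ℝ := inner ℝ (spatialSign y) a with hs
  have hin : inner ℝ y a = ‖y‖ * s := by
    conv_lhs => rw [← norm_smul_spatialSign y]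
    rw [inner_smul_left]; simp [hs]
  have h1 : ‖y - a‖ ^ 2 = (‖y‖ - s) ^ 2 + (‖a‖ ^ 2 - s ^ 2) := by
    rw [norm_sub_sq_real, hin]; ring
  have hsa : |s| ≤ ‖a‖ := by
    have := abs_real_inner_le_norm (spatialSign y) a
    rwa [norm_spatialSign hy, one_mul] at this
  have hs2 : s ^ 2 ≤ ‖a‖ ^ 2 := sq_le_sq.2 (by rwa [abs_norm])
  have h2 : |‖y‖ - s| ≤ ‖y - a‖ := by
    rw [← abs_norm (y - a), ← sq_le_sq, h1]; linarith
  have h3 := norm_sub_le y a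
  have h4 : ‖y‖ - s ≤ ‖y - a‖ := (le_abs_self _).trans h2
  have h5 := neg_abs_le s
  rw [← le_sub_iff_add_le', div_le_iff₀ (by positivity)]
  have h6 : ‖y - a‖ + (‖y‖ - s) ≤ 2 * (‖y‖ + ‖a‖) := by linarith
  have h7 : ‖a‖ ^ 2 - s ^ 2 = (‖y - a‖ - (‖y‖ - s)) * (‖y - a‖ + (‖y‖ - s)) := by
    have : (‖y - a‖ - (‖y‖ - s)) * (‖y - a‖ + (‖y‖ - s)) = ‖y - a‖ ^ 2 - (‖y‖ - s) ^ 2 := by ring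
    rw [this, h1]; ring
  rw [h7]
  exact mul_le_mul_of_nonneg_left h6 (by linarith)

/-- Regularity of a centred sample: `U i` denotes the sign and `ν i` the normalized inverse radius
of the `i`-th observation. -/
structure RegularSample (y : Fin n → EuclideanSpace ℝ (Fin p)) (z H δ : ℝ) : Prop where
  ne_zero : ∀ i, y i ≠ 0
  sum_sign : ∀ j, √p * |∑ i, spatialSign (y i) j| ≤ H * n * δ
  sum_sq : ∀ j, ∑ i, p * (spatialSign (y i) j) ^ 2 ≤ H * n
  norm_sum : ‖∑ i, spatialSign (y i)‖ ≤ H * √n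
  sum_inv_sq : ∑ i, ((z * ‖y i‖)⁻¹) ^ 2 ≤ H * n
  card : n ≤ H * (Finset.univ.filter fun i => 1 / 2 ≤ (z * ‖y i‖)⁻¹).card
  quad : ∀ a, ∑ i, (inner ℝ (spatialSign (y i)) a) ^ 2 ≤ n * ‖a‖ ^ 2 / (2 * H)
  sep : ∀ i, 32 * H ^ 2 * (z * ‖y i‖)⁻¹ ≤ √n
  weighted : ∀ j, ∑ i, (z * ‖y i‖)⁻¹ * (p * (spatialSign (y i) j) ^ 2) ≤ H * n * (√n * δ)

variable {y : Fin n → EuclideanSpace ℝ (Fin p)} {z H δ : ℝ}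

/-- At least `n / H` observations have radius at most `2 / z`, and `quad` removes at most half of
their transverse part. The total curvature is thus at least `n ‖a‖² z / (16 H)`, against a linear
term of at most `H √n ‖a‖`. Only the comparison with the centre is assumed, not minimality, so the
bound also applies on a segment towards the median. -/
theorem RegularSample.norm_le_of_sum_le (h : RegularSample y z H δ) (hn : 0 < n) (hz : 0 < z)
    (hH : 1 ≤ H) {a : EuclideanSpace ℝ (Fin p)} (ha : ‖a‖ ≤ 2 / z)
    (hle : ∑ i, ‖y i - a‖ ≤ ∑ i, ‖y i‖) : ‖a‖ ≤ 16 * H ^ 2 / (z * √n) := by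
  have hn' : (0 : ℝ) < n := by exact_mod_cast hn
  have hsn : 0 < √(n : ℝ) := Real.sqrt_pos.2 hn'
  have hsn2 : √(n : ℝ) * √n = n := Real.mul_self_sqrt hn'.le
  rcases eq_or_ne a 0 with rfl | ha0
  · simp; positivity
  have hapos : 0 < ‖a‖ := norm_pos_iff.2 ha0
  set G := Finset.univ.filter fun i => 1 / 2 ≤ (z * ‖y i‖)⁻¹ with hG
  have hyR : ∀ i ∈ G, ‖y i‖ ≤ 2 / z := by
    intro i hi
    have h1 := (Finset.mem_filter.1 hi).2
    have hy0 : 0 < ‖y i‖ := norm_pos_iff.2 (h.ne_zero i)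
    rw [le_inv_comm₀ (by norm_num) (by positivity)] at h1
    rw [le_div_iff₀ hz]
    norm_num at h1
    linarith
  have hterm : ∀ i, 0 ≤ ‖a‖ ^ 2 - (inner ℝ (spatialSign (y i)) a) ^ 2 := fun i => by
    have := abs_real_inner_le_norm (spatialSign (y i)) a
    rw [norm_spatialSign (h.ne_zero i), one_mul] at this
    rw [sub_nonneg]
    exact sq_le_sq.2 (by rwa [abs_norm])
  have hsum : ∑ i, (‖y i‖ - inner ℝ (spatialSign (y i)) a +
      (‖a‖ ^ 2 - (inner ℝ (spatialSign (y i)) a) ^ 2) / (2 * (‖y i‖ + ‖a‖))) ≤ ∑ i, ‖y i - a‖ :=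
    Finset.sum_le_sum fun i _ => le_norm_sub (h.ne_zero i) a
  rw [Finset.sum_add_distrib, Finset.sum_sub_distrib, ← sum_inner] at hsum
  have hG1 : ∑ i ∈ G, (‖a‖ ^ 2 - (inner ℝ (spatialSign (y i)) a) ^ 2) * (z / 8) ≤
      ∑ i, (‖a‖ ^ 2 - (inner ℝ (spatialSign (y i)) a) ^ 2) / (2 * (‖y i‖ + ‖a‖)) := by
    refine (Finset.sum_le_sum fun i hi => ?_).trans
      (Finset.sum_le_sum_of_subset_of_nonneg (Finset.subset_univ G)
        fun i _ _ => div_nonneg (hterm i) (by positivity))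
    rw [div_eq_mul_inv]
    refine mul_le_mul_of_nonneg_left ?_ (hterm i)
    rw [le_inv_comm₀ (by positivity) (by positivity)]
    have := hyR i hi
    calc 2 * (‖y i‖ + ‖a‖) ≤ 2 * (2 / z + 2 / z) := by gcongr
      _ = (z / 8)⁻¹ := by field_simp; norm_num
  have hG2 : n * ‖a‖ ^ 2 / (2 * H) ≤
      ∑ i ∈ G, (‖a‖ ^ 2 - (inner ℝ (spatialSign (y i)) a) ^ 2) := by
    rw [Finset.sum_sub_distrib, Finset.sum_const, nsmul_eq_mul]
    have h1 : ∑ i ∈ G, (inner ℝ (spatialSign (y i)) a) ^ 2 ≤ n * ‖a‖ ^ 2 / (2 * H) :=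
      (Finset.sum_le_sum_of_subset_of_nonneg (Finset.subset_univ G)
        fun i _ _ => sq_nonneg _).trans (h.quad a)
    have h2 : n * ‖a‖ ^ 2 / H ≤ G.card * ‖a‖ ^ 2 := by
      rw [div_le_iff₀ (by linarith)]
      have := mul_le_mul_of_nonneg_right h.card (sq_nonneg ‖a‖)
      linarith
    have h3 : n * ‖a‖ ^ 2 / H = 2 * (n * ‖a‖ ^ 2 / (2 * H)) := by field_simp
    linarith
  rw [← Finset.sum_mul] at hG1
  have hin : inner ℝ (∑ i, spatialSign (y i)) a ≤ H * √n * ‖a‖ :=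
    (real_inner_le_norm _ _).trans (mul_le_mul_of_nonneg_right h.norm_sum hapos.le)
  have hfin : n * ‖a‖ ^ 2 / (2 * H) * (z / 8) ≤ H * √n * ‖a‖ := by
    have := mul_le_mul_of_nonneg_right hG2 (by positivity : 0 ≤ z / 8)
    linarith
  rw [le_div_iff₀ (by positivity)]
  have h5 : n * ‖a‖ ^ 2 / (2 * H) * (z / 8) * (16 * H) = (√n * ‖a‖) * (‖a‖ * (z * √n)) := by
    have : (√n * ‖a‖) * (‖a‖ * (z * √n)) = (√n * √n) * (‖a‖ ^ 2 * z) := by ring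
    rw [this, hsn2]; field_simp; norm_num
  have h6 := mul_le_mul_of_nonneg_right hfin (by positivity : 0 ≤ 16 * H)
  rw [h5] at h6
  have h7 : H * √n * ‖a‖ * (16 * H) = (√n * ‖a‖) * (16 * H ^ 2) := by ring
  rw [h7] at h6
  exact le_of_mul_le_mul_left h6 (by positivity)

/-- By `card` some normalized inverse radius is at least `1 / 2`; `sep` is evaluated there. -/
theorem RegularSample.le_sqrt (h : RegularSample y z H δ) (hn : 0 < n)  :
    16 * H ^ 2 ≤ √n := by
  have hn' : (0 : ℝ) < n := by exact_mod_cast hn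
  have hne : (Finset.univ.filter fun i => 1 / 2 ≤ (z * ‖y i‖)⁻¹).Nonempty := by
    rw [Finset.nonempty_iff_ne_empty]
    intro h0
    have := h.card
    rw [h0] at this
    simp at this
    linarith
  obtain ⟨i, hi⟩ := hne
  have h1 := (Finset.mem_filter.1 hi).2
  have h2 := h.sep i
  nlinarith [sq_nonneg H]

/-- The `ℓ₂` consistency of the spatial median. -/
theorem RegularSample.norm_median_le (h : RegularSample y z H δ) (hn : 0 < n) (hz : 0 < z)
    (hH : 1 ≤ H) {a : EuclideanSpace ℝ (Fin p)} (ha : IsSpatialMedian y a) :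
    ‖a‖ ≤ 16 * H ^ 2 / (z * √n) := by
  have hn' : (0 : ℝ) < n := by exact_mod_cast hn
  have hsn : 0 < √(n : ℝ) := Real.sqrt_pos.2 hn'
  have hmed : ∑ i, ‖y i - a‖ ≤ ∑ i, ‖y i‖ := by simpa using ha 0
  rcases le_or_gt ‖a‖ (2 / z) with hle | hgt
  · exact h.norm_le_of_sum_le hn hz hH hle hmed
  exfalso
  have hapos : 0 < ‖a‖ := lt_trans (by positivity) hgt
  -- The point `t • a` lies on the segment from the centre to `a`, at norm `2 / z`. By convexity it
  -- still beats the centre, so the local bound applies and gives `2 √n ≤ 16 H²`, contrary to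
  -- `le_sqrt`.
  set t := (2 / z) / ‖a‖ with ht
  have ht0 : 0 < t := by positivity
  have ht1 : t < 1 := by rw [ht, div_lt_one hapos]; exact hgt
  have htn : ‖t • a‖ = 2 / z := by
    rw [norm_smul, Real.norm_of_nonneg ht0.le, ht]; field_simp
  have hconv : ∑ i, ‖y i - t • a‖ ≤ ∑ i, ‖y i‖ := by
    have h1 : ∑ i, ‖y i - t • a‖ ≤ ∑ i, ((1 - t) * ‖y i‖ + t * ‖y i - a‖) := by
      refine Finset.sum_le_sum fun i _ => ?_
      have : y i - t • a = (1 - t) • y i + t • (y i - a) := by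
        rw [sub_smul, smul_sub, one_smul]; abel
      rw [this]
      refine (norm_add_le _ _).trans (le_of_eq ?_)
      rw [norm_smul, norm_smul, Real.norm_of_nonneg ht0.le,
        Real.norm_of_nonneg (by linarith : 0 ≤ 1 - t)]
    rw [Finset.sum_add_distrib, ← Finset.mul_sum, ← Finset.mul_sum] at h1
    nlinarith
  have hb := h.norm_le_of_sum_le hn hz hH htn.le hconv
  rw [htn, div_le_div_iff₀ hz (by positivity)] at hb
  have h3 := h.le_sqrt hn
  have h4 : 2 * √(n : ℝ) ≤ 16 * H ^ 2 := by
    have : z * (2 * √(n : ℝ)) ≤ z * (16 * H ^ 2) := by linarith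
    exact le_of_mul_le_mul_left this hz
  nlinarith

/-- The factor `‖y‖ / ‖y - a‖` by which the sign changes direction. -/
theorem abs_norm_div_norm_sub_sub_one_le {x a : EuclideanSpace ℝ (Fin p)} (hx : x ≠ 0)
    (ha : 2 * ‖a‖ ≤ ‖x‖) :
    2 / 3 ≤ ‖x‖ / ‖x - a‖ ∧ ‖x‖ / ‖x - a‖ ≤ 2 ∧ |‖x‖ / ‖x - a‖ - 1| ≤ 2 * (‖a‖ / ‖x‖) := by
  have hx0 : 0 < ‖x‖ := norm_pos_iff.2 hx
  have h1 := norm_sub_le x a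
  have h2 := norm_sub_norm_le x a
  have h3 : 0 < ‖x - a‖ := by linarith
  refine ⟨?_, ?_, ?_⟩
  · rw [div_le_div_iff₀ (by norm_num) h3]; linarith
  · rw [div_le_iff₀ h3]; linarith
  · have h4 : ‖x‖ / ‖x - a‖ - 1 = (‖x‖ - ‖x - a‖) / ‖x - a‖ := by field_simp
    have h5 : |‖x‖ - ‖x - a‖| ≤ ‖a‖ := by rw [abs_le]; constructor <;> linarith
    rw [h4, abs_div, abs_of_pos h3, div_le_iff₀ h3]
    refine h5.trans ?_
    have h6 : 2 * (‖a‖ / ‖x‖) * ‖x - a‖ = ‖a‖ * (2 * ‖x - a‖ / ‖x‖) := by ring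
    rw [h6]
    have h7 : 1 ≤ 2 * ‖x - a‖ / ‖x‖ := by rw [le_div_iff₀ hx0]; linarith
    nlinarith [norm_nonneg a]

theorem spatialSign_sub_apply {x a : EuclideanSpace ℝ (Fin p)} (hx : x ≠ 0) (j : Fin p) :
    spatialSign (x - a) j = ‖x‖ / ‖x - a‖ * (spatialSign x j - a j / ‖x‖) := by
  have hx0 : ‖x‖ ≠ 0 := norm_ne_zero_iff.2 hx
  simp only [spatialSign, PiLp.smul_apply, PiLp.sub_apply, smul_eq_mul]
  field_simp

theorem RegularSample.two_mul_norm_le (h : RegularSample y z H δ) (hn : 0 < n) (hz : 0 < z)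
    (hH : 1 ≤ H) {a : EuclideanSpace ℝ (Fin p)} (ha : ‖a‖ ≤ 16 * H ^ 2 / (z * √n))
    (i : Fin n) : 2 * ‖a‖ ≤ ‖y i‖ ∧ ‖a‖ / ‖y i‖ ≤ 16 * H ^ 2 / √n * (z * ‖y i‖)⁻¹ := by
  have hsn : 0 < √(n : ℝ) := Real.sqrt_pos.2 (by exact_mod_cast hn)
  have hy0 : 0 < ‖y i‖ := norm_pos_iff.2 (h.ne_zero i)
  have h1 := h.sep i
  have h2 : ‖a‖ / ‖y i‖ ≤ 16 * H ^ 2 / √n * (z * ‖y i‖)⁻¹ := by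
    calc ‖a‖ / ‖y i‖ ≤ (16 * H ^ 2 / (z * √n)) / ‖y i‖ := by gcongr
      _ = _ := by field_simp
  refine ⟨?_, h2⟩
  have h3 : 16 * H ^ 2 / √n * (z * ‖y i‖)⁻¹ ≤ 1 / 2 := by
    rw [div_mul_eq_mul_div, div_le_iff₀ hsn]; linarith
  have h4 := h2.trans h3
  rw [div_le_iff₀ hy0] at h4
  linarith

theorem RegularSample.sum_abs_mul_inv_le (h : RegularSample y z H δ) (j : Fin p) :
    ∑ i, √p * |spatialSign (y i) j| * (z * ‖y i‖)⁻¹ ≤ H * n := by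
  have h1 : ∑ i, √p * |spatialSign (y i) j| * (z * ‖y i‖)⁻¹ ≤
      ∑ i, 1 / 2 * (p * (spatialSign (y i) j) ^ 2 + ((z * ‖y i‖)⁻¹) ^ 2) := by
    refine Finset.sum_le_sum fun i _ => ?_
    have h2 : (√p * |spatialSign (y i) j|) ^ 2 = p * (spatialSign (y i) j) ^ 2 := by
      rw [mul_pow, Real.sq_sqrt (by positivity), sq_abs]
    rw [← h2]
    nlinarith [sq_nonneg (√p * |spatialSign (y i) j| - (z * ‖y i‖)⁻¹)]
  rw [← Finset.mul_sum, Finset.sum_add_distrib] at h1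
  linarith [h.sum_sq j, h.sum_inv_sq]

/-- The coordinatewise consistency of the spatial median. -/
theorem RegularSample.abs_median_apply_le (h : RegularSample y z H δ) (hn : 0 < n) (hp : 0 < p)
    (hz : 0 < z) (hH : 1 ≤ H) (hδ : 1 ≤ √n * δ)
    {a : EuclideanSpace ℝ (Fin p)} (ha : IsSpatialMedian y a) (j : Fin p) :
    |a j| ≤ 100 * H ^ 4 * δ / (z * √p) := by
  have hn' : (0 : ℝ) < n := by exact_mod_cast hn
  have hsn : 0 < √(n : ℝ) := Real.sqrt_pos.2 hn'
  have hsp : 0 < √(p : ℝ) := Real.sqrt_pos.2 (by exact_mod_cast hp)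
  have hna := h.norm_median_le hn hz hH ha
  have hδ0 : 0 < δ := by
    by_contra! hneg
    nlinarith
  set c : Fin n → ℝ := fun i => ‖y i‖ / ‖y i - a‖ with hc
  have hfac := fun i => abs_norm_div_norm_sub_sub_one_le (h.ne_zero i)
    (h.two_mul_norm_le hn hz hH hna i).1
  have hstat := ha.sum_spatialSign_eq_zero fun i h0 => by
    have := (hfac i).1
    rw [h0] at this
    norm_num at this
  have hj : ∑ i, c i * (spatialSign (y i) j - a j / ‖y i‖) = 0 := by
    have := congrArg (fun v : EuclideanSpace ℝ (Fin p) => v j) hstat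
    simp only [PiLp.zero_apply, WithLp.ofLp_sum, Finset.sum_apply] at this
    rw [← this]
    exact Finset.sum_congr rfl fun i _ => (spatialSign_sub_apply (h.ne_zero i) j).symm
  -- Coordinate `j` of the first-order condition solved for `a j`: the leading term is the sum of
  -- the signs, and the factors `c i` deviate from `1` by `O(‖a‖ / ‖y i‖)`.
  have hsplit : a j * ∑ i, c i / ‖y i‖ =
      ∑ i, spatialSign (y i) j + ∑ i, (c i - 1) * spatialSign (y i) j := by
    rw [← Finset.sum_add_distrib, Finset.mul_sum, ← sub_eq_zero, ← Finset.sum_sub_distrib]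
    rw [← neg_eq_zero, ← Finset.sum_neg_distrib, ← hj]
    exact Finset.sum_congr rfl fun i _ => by ring
  have hlow : z * n / (3 * H) ≤ ∑ i, c i / ‖y i‖ := by
    set G := Finset.univ.filter fun i => 1 / 2 ≤ (z * ‖y i‖)⁻¹ with hG
    calc z * n / (3 * H) ≤ z * (H * G.card) / (3 * H) := by
          gcongr; exact h.card
      _ = ∑ _i ∈ G, z / 3 := by
          rw [Finset.sum_const, nsmul_eq_mul]; field_simp
      _ ≤ ∑ i ∈ G, c i / ‖y i‖ := by
          refine Finset.sum_le_sum fun i hi => ?_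
          have h1 := (Finset.mem_filter.1 hi).2
          have h2 := (hfac i).1
          have hy0 : 0 < ‖y i‖ := norm_pos_iff.2 (h.ne_zero i)
          have h3 : ‖y i‖⁻¹ = z * (z * ‖y i‖)⁻¹ := by field_simp
          rw [div_eq_mul_inv (c i), h3]
          calc z / 3 = 2 / 3 * (z * (1 / 2)) := by ring
            _ ≤ _ := by gcongr
      _ ≤ _ := Finset.sum_le_sum_of_subset_of_nonneg (Finset.subset_univ G)
          fun i _ _ => by positivity
  -- The `ℓ₂` bound enters only here: `|c i - 1| ≤ 32 H² ν_i / √n`, where `1 / √n ≤ δ`. Together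
  -- with the leading term this makes `33 H³ n δ`, and division by `hlow` gives `99 H⁴ δ`.
  have hrem : √p * |∑ i, (c i - 1) * spatialSign (y i) j| ≤ 32 * H ^ 3 * n * δ := by
    calc √p * |∑ i, (c i - 1) * spatialSign (y i) j|
        ≤ √p * ∑ i, |(c i - 1) * spatialSign (y i) j| := by
          gcongr; exact Finset.abs_sum_le_sum_abs _ _
      _ ≤ ∑ i, 2 * (16 * H ^ 2 / √n) * (√p * |spatialSign (y i) j| * (z * ‖y i‖)⁻¹) := by
          rw [Finset.mul_sum]
          refine Finset.sum_le_sum fun i _ => ?_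
          rw [abs_mul]
          have h1 := (hfac i).2.2
          have h2 := (h.two_mul_norm_le hn hz hH hna i).2
          calc √p * (|c i - 1| * |spatialSign (y i) j|) ≤
              √p * ((2 * (16 * H ^ 2 / √n * (z * ‖y i‖)⁻¹)) * |spatialSign (y i) j|) := by
                gcongr
                linarith
            _ = _ := by ring
      _ ≤ 2 * (16 * H ^ 2 / √n) * (H * n) := by
          rw [← Finset.mul_sum]
          gcongr
          exact h.sum_abs_mul_inv_le j
      _ = 32 * H ^ 3 * n * (1 / √n) := by ring
      _ ≤ _ := by
          gcongr
          rw [div_le_iff₀ hsn]; linarith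
  have htot : √p * (|a j| * (z * n / (3 * H))) ≤ 33 * H ^ 3 * n * δ := by
    have h1 : |a j| * (z * n / (3 * H)) ≤
        |∑ i, spatialSign (y i) j| + |∑ i, (c i - 1) * spatialSign (y i) j| := by
      calc |a j| * (z * n / (3 * H)) ≤ |a j| * ∑ i, c i / ‖y i‖ := by gcongr
        _ = |a j * ∑ i, c i / ‖y i‖| := by
            rw [abs_mul, abs_of_nonneg (a := ∑ i, c i / ‖y i‖)
              (Finset.sum_nonneg fun i _ => by positivity)]
        _ ≤ _ := by rw [hsplit]; exact abs_add_le _ _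
    have h2 := mul_le_mul_of_nonneg_left h1 hsp.le
    have h3 := h.sum_sign j
    have h4 : H * n * δ ≤ H ^ 3 * n * δ := by
      gcongr
      nlinarith [sq_nonneg H, sq_nonneg (H - 1)]
    linarith
  rw [le_div_iff₀ (by positivity)]
  have h5 : √p * (|a j| * (z * n / (3 * H))) = (|a j| * (z * √p)) * (n / (3 * H)) := by ring
  have h6 : 33 * H ^ 3 * n * δ = (99 * H ^ 4 * δ) * (n / (3 * H)) := by field_simp; ring
  rw [h5, h6] at htot
  have h7 := le_of_mul_le_mul_right htot (by positivity)
  have h8 : 0 < H ^ 4 * δ := by positivity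
  linarith

/-- Centring at the spatial median instead of the true centre changes the sample spatial-sign
covariance matrix little. -/
theorem RegularSample.abs_sampleSignCov_sub_le (h : RegularSample y z H δ) (hn : 0 < n)
    (hp : 0 < p) (hz : 0 < z) (hH : 1 ≤ H) (hδ : 1 ≤ √n * δ) (hδ1 : δ ≤ 1)
    {a : EuclideanSpace ℝ (Fin p)} (ha : IsSpatialMedian y a) (j k : Fin p) :
    |p * sampleSignCov y a j k - p * sampleSignCov y 0 j k| ≤ 41000 * H ^ 9 * δ := by
  have hn' : (0 : ℝ) < n := by exact_mod_cast hn
  have hsn : 0 < √(n : ℝ) := Real.sqrt_pos.2 hn'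
  have hsp : 0 < √(p : ℝ) := Real.sqrt_pos.2 (by exact_mod_cast hp)
  have hpp : √(p : ℝ) * √p = p := Real.mul_self_sqrt (by positivity)
  have hna := h.norm_median_le hn hz hH ha
  have hδ0 : 0 < δ := by
    by_contra! hneg
    nlinarith
  set A := 100 * H ^ 4 * δ with hA
  have hA0 : 0 < A := by positivity
  have hcoord := h.abs_median_apply_le hn hp hz hH hδ ha
  have hfac := fun i => abs_norm_div_norm_sub_sub_one_le (h.ne_zero i)
    (h.two_mul_norm_le hn hz hH hna i).1
  have hterm : ∀ i, p * |signOuter (y i - a) j k - signOuter (y i) j k| ≤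
      4 * A * (√p * |spatialSign (y i) j| * (z * ‖y i‖)⁻¹) +
      4 * A * (√p * |spatialSign (y i) k| * (z * ‖y i‖)⁻¹) +
      4 * A ^ 2 * ((z * ‖y i‖)⁻¹) ^ 2 +
      48 * H ^ 2 / √n * ((z * ‖y i‖)⁻¹ * (p * (spatialSign (y i) j) ^ 2)) +
      48 * H ^ 2 / √n * ((z * ‖y i‖)⁻¹ * (p * (spatialSign (y i) k) ^ 2)) := by
    intro i
    have hy0 : 0 < ‖y i‖ := norm_pos_iff.2 (h.ne_zero i)
    simp only [signOuter, Matrix.of_apply]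
    rw [spatialSign_sub_apply (h.ne_zero i), spatialSign_sub_apply (h.ne_zero i)]
    obtain ⟨hc1, hc2, hc3⟩ := hfac i
    have he := (h.two_mul_norm_le hn hz hH hna i).2
    set c := ‖y i‖ / ‖y i - a‖
    set u := spatialSign (y i) j
    set v := spatialSign (y i) k
    set ν := (z * ‖y i‖)⁻¹ with hν
    have hν0 : 0 < ν := by positivity
    have hb : ∀ l, √p * |a l / ‖y i‖| ≤ A * ν := fun l => by
      rw [abs_div, abs_norm]
      calc √p * (|a l| / ‖y i‖) ≤ √p * (A / (z * √p) / ‖y i‖) := by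
            gcongr; exact hcoord l
        _ = A * ν := by rw [hν]; field_simp
    set α := a j / ‖y i‖
    set β := a k / ‖y i‖
    have hcsq : c ^ 2 ≤ 4 := by nlinarith
    have hcsq1 : |c ^ 2 - 1| ≤ 96 * H ^ 2 / √n * ν := by
      have h1 : c ^ 2 - 1 = (c - 1) * (c + 1) := by ring
      rw [h1, abs_mul, abs_of_nonneg (by linarith : 0 ≤ c + 1)]
      have h2 : |c - 1| ≤ 32 * H ^ 2 / √n * ν := by
        refine hc3.trans ?_
        calc 2 * (‖a‖ / ‖y i‖) ≤ 2 * (16 * H ^ 2 / √n * ν) := by gcongr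
          _ = _ := by ring
      calc |c - 1| * (c + 1) ≤ (32 * H ^ 2 / √n * ν) * 3 := by gcongr; linarith
        _ = _ := by ring
    -- The shift contributes terms in `α`, `β`, of size `ν / √p` by the coordinatewise bound; the
    -- change of length contributes `c² - 1`, whose extra factor `ν` is the reason for the field
    -- `weighted`.
    have hid : c * (u - α) * (c * (v - β)) - u * v =
        c ^ 2 * (-(u * β) - α * v + α * β) + (c ^ 2 - 1) * (u * v) := by ring
    rw [hid]
    have h1 : |c ^ 2 * (-(u * β) - α * v + α * β) + (c ^ 2 - 1) * (u * v)| ≤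
        4 * (|u| * |β| + |α| * |v| + |α| * |β|) +
          96 * H ^ 2 / √n * ν * ((u ^ 2 + v ^ 2) / 2) := by
      refine (abs_add_le _ _).trans (add_le_add ?_ ?_)
      · rw [abs_mul, abs_of_nonneg (sq_nonneg c)]
        refine mul_le_mul hcsq ?_ (abs_nonneg _) (by norm_num)
        refine (abs_add_le _ _).trans ?_
        rw [abs_mul α β]
        have := abs_sub (-(u * β)) (α * v)
        rw [abs_neg, abs_mul, abs_mul] at this
        linarith
      · rw [abs_mul]
        refine mul_le_mul hcsq1 ?_ (abs_nonneg _) (by positivity)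
        rw [abs_le]
        constructor <;> nlinarith [sq_nonneg (u + v), sq_nonneg (u - v)]
    have h2 := mul_le_mul_of_nonneg_left h1 (by positivity : (0 : ℝ) ≤ p)
    refine h2.trans ?_
    have e1 : (p : ℝ) * (|u| * |β|) ≤ A * (√p * |u| * ν) := by
      calc (p : ℝ) * (|u| * |β|) = √p * √p * (|u| * |β|) := by rw [hpp]
        _ = √p * |u| * (√p * |β|) := by ring
        _ ≤ √p * |u| * (A * ν) := mul_le_mul_of_nonneg_left (hb k) (by positivity)
        _ = _ := by ring
    have e2 : (p : ℝ) * (|α| * |v|) ≤ A * (√p * |v| * ν) := by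
      calc (p : ℝ) * (|α| * |v|) = √p * √p * (|α| * |v|) := by rw [hpp]
        _ = √p * |v| * (√p * |α|) := by ring
        _ ≤ √p * |v| * (A * ν) := mul_le_mul_of_nonneg_left (hb j) (by positivity)
        _ = _ := by ring
    have e3 : (p : ℝ) * (|α| * |β|) ≤ A ^ 2 * ν ^ 2 := by
      calc (p : ℝ) * (|α| * |β|) = √p * √p * (|α| * |β|) := by rw [hpp]
        _ = (√p * |α|) * (√p * |β|) := by ring
        _ ≤ (A * ν) * (A * ν) := mul_le_mul (hb j) (hb k) (by positivity) (by positivity)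
        _ = _ := by ring
    have e4 : (p : ℝ) * (96 * H ^ 2 / √n * ν * ((u ^ 2 + v ^ 2) / 2)) =
        48 * H ^ 2 / √n * (ν * (p * u ^ 2)) + 48 * H ^ 2 / √n * (ν * (p * v ^ 2)) := by ring
    rw [mul_add, e4]
    linarith
  -- The five terms add up to `400 + 400 + 40000 + 48 + 48`, which is below `41000`; powers of `H`
  -- are raised to the ninth and `δ² ≤ δ`.
  have hsum : p * |∑ i, signOuter (y i - a) j k - ∑ i, signOuter (y i) j k| ≤
      n * (41000 * H ^ 9 * δ) := by
    rw [← Finset.sum_sub_distrib]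
    refine (mul_le_mul_of_nonneg_left (Finset.abs_sum_le_sum_abs _ _) (by positivity)).trans ?_
    rw [Finset.mul_sum]
    refine (Finset.sum_le_sum fun i _ => hterm i).trans ?_
    simp only [Finset.sum_add_distrib, ← Finset.mul_sum]
    have h1 := h.sum_abs_mul_inv_le j
    have h2 := h.sum_abs_mul_inv_le k
    have h3 := h.sum_inv_sq
    have h4 := h.weighted j
    have h5 := h.weighted k
    have hw : ∀ l, 48 * H ^ 2 / √n * ∑ i, (z * ‖y i‖)⁻¹ * (p * (spatialSign (y i) l) ^ 2) ≤
        48 * (H ^ 3 * n * δ) := fun l => by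
      calc _ ≤ 48 * H ^ 2 / √n * (H * n * (√n * δ)) := by gcongr; exact h.weighted l
        _ = _ := by field_simp
    have h6 : 4 * A * (∑ i, √p * |spatialSign (y i) j| * (z * ‖y i‖)⁻¹) ≤ 400 * (H ^ 5 * n * δ) := by
      calc _ ≤ 4 * A * (H * n) := by gcongr
        _ = _ := by rw [hA]; ring
    have h7 : 4 * A * (∑ i, √p * |spatialSign (y i) k| * (z * ‖y i‖)⁻¹) ≤ 400 * (H ^ 5 * n * δ) := by
      calc _ ≤ 4 * A * (H * n) := by gcongr
        _ = _ := by rw [hA]; ring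
    have h8 : 4 * A ^ 2 * (∑ i, ((z * ‖y i‖)⁻¹) ^ 2) ≤ 40000 * (H ^ 9 * n * δ) := by
      calc _ ≤ 4 * A ^ 2 * (H * n) := by gcongr
        _ = 40000 * (H ^ 9 * n * (δ * δ)) := by rw [hA]; ring
        _ ≤ 40000 * (H ^ 9 * n * (δ * 1)) := by gcongr
        _ = _ := by ring
    have h9 : H ^ 5 * n * δ ≤ H ^ 9 * n * δ := by
      gcongr
      norm_num
    have h10 : H ^ 3 * n * δ ≤ H ^ 9 * n * δ := by
      gcongr
      norm_num
    have h11 : 0 < H ^ 9 * n * δ := by positivity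
    linarith [hw j, hw k]
  have hcov : ∀ b, sampleSignCov y b j k = (n : ℝ)⁻¹ * ∑ i, signOuter (y i - b) j k := fun b => by
    simp [sampleSignCov, Matrix.sum_apply]
  rw [hcov, hcov]
  simp only [sub_zero]
  rw [← mul_sub, ← mul_sub, abs_mul, abs_mul, abs_of_nonneg (by positivity : (0 : ℝ) ≤ p),
    abs_of_nonneg (by positivity : (0 : ℝ) ≤ (n : ℝ)⁻¹)]
  calc (p : ℝ) * ((n : ℝ)⁻¹ * |∑ i, signOuter (y i - a) j k - ∑ i, signOuter (y i) j k|) =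
      (n : ℝ)⁻¹ * (p * |∑ i, signOuter (y i - a) j k - ∑ i, signOuter (y i) j k|) := by ring
    _ ≤ (n : ℝ)⁻¹ * (n * (41000 * H ^ 9 * δ)) := by gcongr
    _ = _ := by field_simp

end Median

/-! ### Constrained `ℓ₁` minimization -/

section Clime
variable {p : ℕ}

theorem abs_le_maxNorm (A : Matrix (Fin p) (Fin p) ℝ) (i j : Fin p) : |A i j| ≤ maxNorm A :=
  (le_ciSup (f := fun j => |A i j|) (Set.finite_range _).bddAbove j).trans
    (le_ciSup (f := fun i => ⨆ j, |A i j|) (Set.finite_range _).bddAbove i)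

theorem maxNorm_le {A : Matrix (Fin p) (Fin p) ℝ} {c : ℝ} (hc : 0 ≤ c) (h : ∀ i j, |A i j| ≤ c) :
    maxNorm A ≤ c :=
  Real.iSup_le (fun i => Real.iSup_le (fun j => h i j) hc) hc

theorem maxNorm_le_iff {A : Matrix (Fin p) (Fin p) ℝ} {c : ℝ} (hc : 0 ≤ c) :
    maxNorm A ≤ c ↔ ∀ i j, |A i j| ≤ c :=
  ⟨fun h i j => (abs_le_maxNorm A i j).trans h, maxNorm_le hc⟩

theorem maxNorm_nonneg (A : Matrix (Fin p) (Fin p) ℝ) : 0 ≤ maxNorm A :=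
  Real.iSup_nonneg fun _ => Real.iSup_nonneg fun _ => abs_nonneg _

theorem sum_abs_le_colSumNorm (A : Matrix (Fin p) (Fin p) ℝ) (j : Fin p) :
    ∑ i, |A i j| ≤ colSumNorm A :=
  le_ciSup (f := fun j => ∑ i, |A i j|) (Set.finite_range _).bddAbove j

/-- Matrices with a larger objective than the feasible `W` may be discarded. The rest lie in a cube,
so a continuous objective is minimized over a compact set. -/
theorem exists_isClimeSolution {S : Matrix (Fin p) (Fin p) ℝ} {lam : ℝ}
    {W : Matrix (Fin p) (Fin p) ℝ} (hW : maxNorm ((p : ℝ) • S * W - 1) ≤ lam) :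
    ∃ V, IsClimeSolution S lam V := by
  have hlam : 0 ≤ lam := (maxNorm_nonneg _).trans hW
  set F : Set (Matrix (Fin p) (Fin p) ℝ) := {V | ∀ i j, |((p : ℝ) • S * V - 1) i j| ≤ lam} with hF
  have hFc : IsClosed F := by
    simp only [hF, Set.ofPred_forall]
    refine isClosed_iInter fun i => isClosed_iInter fun j => isClosed_le ?_ continuous_const
    have : Continuous fun V : Matrix (Fin p) (Fin p) ℝ => (p : ℝ) • S * V - 1 := by fun_prop
    exact (this.matrix_elem i j).abs
  set K : Set (Matrix (Fin p) (Fin p) ℝ) :=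
    Set.univ.pi fun _ => Set.univ.pi fun _ => Set.Icc (-entrySum W) (entrySum W) with hK
  have hKc : IsCompact K := isCompact_univ_pi fun _ => isCompact_univ_pi fun _ => isCompact_Icc
  have hcont : Continuous (entrySum : Matrix (Fin p) (Fin p) ℝ → ℝ) := by
    unfold entrySum
    refine continuous_finsetSum _ fun i _ => continuous_finsetSum _ fun j _ => ?_
    exact (continuous_id.matrix_elem i j).abs
  have hmem : ∀ V : Matrix (Fin p) (Fin p) ℝ, entrySum V ≤ entrySum W → V ∈ K := by
    intro V hV i _ j _
    have h1 : |V i j| ≤ entrySum V :=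
      (Finset.single_le_sum (f := fun j => |V i j|) (fun j _ => abs_nonneg _)
        (Finset.mem_univ j)).trans
      (Finset.single_le_sum (f := fun i => ∑ j, |V i j|)
        (fun i _ => Finset.sum_nonneg fun j _ => abs_nonneg _) (Finset.mem_univ i))
    exact abs_le.1 (h1.trans hV)
  have hWF : W ∈ F := (maxNorm_le_iff hlam).1 hW
  obtain ⟨V, ⟨hVF, -⟩, hV⟩ := (hKc.inter_left hFc).exists_isMinOn ⟨W, hWF, hmem W le_rfl⟩
    hcont.continuousOn
  refine ⟨V, (maxNorm_le_iff hlam).2 hVF, fun W' hW' => ?_⟩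
  rcases le_total (entrySum W') (entrySum W) with h | h
  · exact hV ⟨(maxNorm_le_iff hlam).1 hW', hmem W' h⟩
  · exact (hV ⟨hWF, hmem W le_rfl⟩).trans h

/-- Every column of a solution has minimal `ℓ₁` norm among the feasible columns. -/
theorem IsClimeSolution.sum_abs_col_le {S V W : Matrix (Fin p) (Fin p) ℝ} {lam : ℝ}
    (hV : IsClimeSolution S lam V) (hW : maxNorm ((p : ℝ) • S * W - 1) ≤ lam) (j : Fin p) :
    ∑ i, |V i j| ≤ ∑ i, |W i j| := by
  have hlam : 0 ≤ lam := (maxNorm_nonneg _).trans hW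
  -- Objective and constraint separate over columns, so exchanging one column preserves feasibility.
  set V' : Matrix (Fin p) (Fin p) ℝ := V.updateCol j (fun i => W i j) with hV'
  have hfeas : maxNorm ((p : ℝ) • S * V' - 1) ≤ lam := by
    refine maxNorm_le hlam fun i k => ?_
    by_cases hk : k = j
    · have := (maxNorm_le_iff hlam).1 hW i k
      simp only [Matrix.sub_apply, Matrix.mul_apply, hV'] at this ⊢
      subst hk
      simpa using this
    · have := (maxNorm_le_iff hlam).1 hV.1 i k
      simp only [Matrix.sub_apply, Matrix.mul_apply, hV'] at this ⊢
      simpa [hk] using this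
  have h := hV.2 V' hfeas
  have hsum : ∀ A : Matrix (Fin p) (Fin p) ℝ, entrySum A = ∑ k, ∑ i, |A i k| :=
    fun A => Finset.sum_comm
  rw [hsum, hsum, ← Finset.add_sum_erase _ _ (Finset.mem_univ j),
    ← Finset.add_sum_erase (a := j) _ (fun k => ∑ i, |V' i k|) (Finset.mem_univ j)] at h
  have h1 : ∑ k ∈ Finset.univ.erase j, ∑ i, |V' i k| =
      ∑ k ∈ Finset.univ.erase j, ∑ i, |V i k| :=
    Finset.sum_congr rfl fun k hk => by simp [hV', Finset.ne_of_mem_erase hk]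
  have h2 : ∑ i, |V' i j| = ∑ i, |W i j| := by simp [hV']
  rw [h1, h2] at h
  linarith

theorem abs_mul_apply_le {A B : Matrix (Fin p) (Fin p) ℝ} {a b : ℝ} (i j : Fin p)
    (hA : ∑ k, |A i k| ≤ a) (hb : 0 ≤ b) (hB : ∀ k, |B k j| ≤ b) : |(A * B) i j| ≤ a * b := by
  rw [Matrix.mul_apply]
  refine (Finset.abs_sum_le_sum_abs _ _).trans ?_
  calc ∑ k, |A i k * B k j| ≤ ∑ k, |A i k| * b := by
        refine Finset.sum_le_sum fun k _ => ?_
        rw [abs_mul]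
        exact mul_le_mul_of_nonneg_left (hB k) (abs_nonneg _)
    _ ≤ _ := by rw [← Finset.sum_mul]; gcongr

/-- With `A = p S`, `X = V - W` and `R = A W - 1`, symmetry gives `X = W (A X) - (Xᵀ R)ᵀ`, which
needs no inverse of `A`. In the first product `W` has row sums at most `T` and `A X` entries at most
`2 lam`; in the second, columns of `X` have `ℓ₁` norm at most `2 T` and `R` has entries at most
`lam`. -/
theorem IsClimeSolution.abs_sub_le {S V W : Matrix (Fin p) (Fin p) ℝ} {lam T : ℝ}
    (hV : IsClimeSolution S lam V) (hS : Sᵀ = S) (hWs : Wᵀ = W)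
    (hW : maxNorm ((p : ℝ) • S * W - 1) ≤ lam) (hT : ∀ j, ∑ i, |W i j| ≤ T) (i j : Fin p) :
    |V i j - W i j| ≤ 4 * T * lam := by
  have hlam : 0 ≤ lam := (maxNorm_nonneg _).trans hW
  set A : Matrix (Fin p) (Fin p) ℝ := (p : ℝ) • S with hA
  have hAs : Aᵀ = A := by rw [hA, Matrix.transpose_smul, hS]
  set R := A * W - 1 with hR
  set X := V - W with hX
  have hRT : Rᵀ = W * A - 1 := by
    rw [hR, Matrix.transpose_sub, Matrix.transpose_mul, hAs, hWs, Matrix.transpose_one]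
  have hid : X = W * (A * X) - (Xᵀ * R)ᵀ := by
    rw [Matrix.transpose_mul, Matrix.transpose_transpose, hRT]
    noncomm_ring
  have hAX : ∀ k l, |(A * X) k l| ≤ 2 * lam := fun k l => by
    have h1 := (maxNorm_le_iff hlam).1 hV.1 k l
    have h2 := (maxNorm_le_iff hlam).1 hW k l
    have h3 : (A * X) k l = (A * V - 1) k l - (A * W - 1) k l := by
      rw [hX, Matrix.mul_sub]; simp
    rw [h3]
    refine (abs_sub _ _).trans ?_
    linarith
  have hrow : ∑ k, |W i k| ≤ T := by
    refine le_trans (le_of_eq ?_) (hT i)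
    refine Finset.sum_congr rfl fun k _ => ?_
    rw [← Matrix.transpose_apply W, hWs]
  have hXc : ∑ k, |Xᵀ j k| ≤ 2 * T := by
    calc ∑ k, |Xᵀ j k| ≤ ∑ k, (|V k j| + |W k j|) :=
          Finset.sum_le_sum fun k _ => by simpa [hX] using abs_sub (V k j) (W k j)
      _ ≤ _ := by
          rw [Finset.sum_add_distrib]
          linarith [hV.sum_abs_col_le hW j, hT j]
  have h1 := abs_mul_apply_le i j hrow (by linarith) (fun k => hAX k j)
  have h2 := abs_mul_apply_le (B := R) j i hXc hlam
    (fun k => (maxNorm_le_iff hlam).1 hW k i)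
  have h3 : V i j - W i j = (W * (A * X)) i j - (Xᵀ * R) j i := by
    have := congrFun (congrFun hid i) j
    rw [Matrix.sub_apply, Matrix.transpose_apply] at this
    exact this
  rw [h3]
  refine (abs_sub _ _).trans ?_
  linarith

theorem symmetrize_eq_or (V : Matrix (Fin p) (Fin p) ℝ) (i j : Fin p) :
    symmetrize V i j = V i j ∨ symmetrize V i j = V j i := by
  simp only [symmetrize, Matrix.of_apply]
  split_ifs <;> simp

/-- The transposed entry on the right is deliberate: row sums after symmetrization are bounded by
column sums before it, and only the latter are controlled by optimality. -/
theorem abs_symmetrize_le (V : Matrix (Fin p) (Fin p) ℝ) (i j : Fin p) :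
    |symmetrize V i j| ≤ |V j i| := by
  simp only [symmetrize, Matrix.of_apply]
  split_ifs <;> linarith

theorem abs_mulVec_le {A : Matrix (Fin p) (Fin p) ℝ} {v : Fin p → ℝ} {a b : ℝ} (i : Fin p)
    (hA : ∑ k, |A i k| ≤ a) (hb : 0 ≤ b) (hv : ∀ k, |v k| ≤ b) : |(A *ᵥ v) i| ≤ a * b := by
  simp only [Matrix.mulVec, dotProduct]
  refine (Finset.abs_sum_le_sum_abs _ _).trans ?_
  calc ∑ k, |A i k * v k| ≤ ∑ k, |A i k| * b := by
        refine Finset.sum_le_sum fun k _ => ?_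
        rw [abs_mul]
        exact mul_le_mul_of_nonneg_left (hv k) (abs_nonneg _)
    _ ≤ _ := by rw [← Finset.sum_mul]; gcongr

theorem abs_mulVec_le' {A : Matrix (Fin p) (Fin p) ℝ} {v : Fin p → ℝ} {a b : ℝ} (i : Fin p)
    (hA : ∀ k, |A i k| ≤ a) (ha : 0 ≤ a) (hv : ∑ k, |v k| ≤ b) : |(A *ᵥ v) i| ≤ a * b := by
  simp only [Matrix.mulVec, dotProduct]
  refine (Finset.abs_sum_le_sum_abs _ _).trans ?_
  calc ∑ k, |A i k * v k| ≤ ∑ k, a * |v k| := by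
        refine Finset.sum_le_sum fun k _ => ?_
        rw [abs_mul]
        exact mul_le_mul_of_nonneg_right (hA k) (abs_nonneg _)
    _ ≤ _ := by rw [← Finset.mul_sum]; gcongr

variable {Sig : Matrix (Fin p) (Fin p) ℝ}

theorem transpose_shapePrecision (h : Sig.PosDef) :
    (shapePrecision Sig)ᵀ = shapePrecision Sig := by
  have hs : Sigᵀ = Sig := by
    have := h.isHermitian.eq
    rwa [Matrix.conjTranspose_eq_transpose_of_trivial] at this
  rw [shapePrecision, Matrix.transpose_smul, Matrix.transpose_nonsing_inv, hs]

/-- The population matrix is feasible when the sample sign covariance matrix is close to the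
normalized scatter matrix. -/
theorem maxNorm_mul_shapePrecision_sub_one_le (h : Sig.PosDef) (hp : 0 < p)
    {S : Matrix (Fin p) (Fin p) ℝ} {T b : ℝ} (hb : 0 ≤ b)
    (hT : colSumNorm (shapePrecision Sig) ≤ T)
    (hS : ∀ j k, |p * S j k - p * Sig j k / Sig.trace| ≤ b) :
    maxNorm ((p : ℝ) • S * shapePrecision Sig - 1) ≤ T * b := by
  have htr : Sig.trace ≠ 0 := by
    have : Nonempty (Fin p) := ⟨⟨0, hp⟩⟩
    exact h.trace_pos.ne'
  have hp' : (p : ℝ) ≠ 0 := by exact_mod_cast hp.ne'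
  have hdet : IsUnit Sig.det := h.det_pos.ne'.isUnit
  have hone : ((p : ℝ) / Sig.trace) • Sig * shapePrecision Sig = 1 := by
    rw [shapePrecision, Matrix.smul_mul, Matrix.mul_smul, Matrix.mul_nonsing_inv _ hdet, smul_smul]
    rw [div_mul_div_comm, mul_comm, div_self (by positivity), one_smul]
  have hT0 : 0 ≤ T := (Finset.sum_nonneg fun i _ => abs_nonneg _).trans
    ((sum_abs_le_colSumNorm (shapePrecision Sig) ⟨0, hp⟩).trans hT)
  refine maxNorm_le (by positivity) fun i j => ?_
  rw [← hone, ← Matrix.sub_mul, ← Matrix.transpose_apply (_ * _), Matrix.transpose_mul,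
    transpose_shapePrecision h]
  refine abs_mul_apply_le j i ?_ hb fun k => ?_
  · refine le_trans (le_of_eq ?_) ((sum_abs_le_colSumNorm (shapePrecision Sig) j).trans hT)
    refine Finset.sum_congr rfl fun k _ => ?_
    rw [← Matrix.transpose_apply (shapePrecision Sig), transpose_shapePrecision h]
  · have := hS i k
    simp only [Matrix.transpose_apply, Matrix.sub_apply, Matrix.smul_apply, smul_eq_mul]
    rwa [div_mul_eq_mul_div]

/-- The part `V̂ (μ̂_d - μ_d)` pairs row sums with the maximum norm; the part `(V̂ - V₀) μ_d` pairs
the maximum norm with the `ℓ₁` norm of `μ_d`. Symmetrized entries are original or transposed ones,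
so the entrywise error bound survives. -/
theorem directionError_le (h : Sig.PosDef) {S V : Matrix (Fin p) (Fin p) ℝ} {lam T b Ms : ℝ}
    {a₀ a₁ m₀ m₁ : EuclideanSpace ℝ (Fin p)} (hV : IsClimeSolution S lam V) (hS : Sᵀ = S)
    (hW : maxNorm ((p : ℝ) • S * shapePrecision Sig - 1) ≤ lam) (hT0 : 0 ≤ T)
    (hT : colSumNorm (shapePrecision Sig) ≤ T) (hb : 0 ≤ b)
    (hm : ∀ j, |(a₁ j - a₀ j) / 2 - (m₁ j - m₀ j) / 2| ≤ b)
    (hMs : ∑ i, |(m₁ i - m₀ i) / 2| ≤ Ms) :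
    directionError V a₀ a₁ Sig m₀ m₁ ≤ T * b + 4 * T * lam * Ms := by
  have hlam : 0 ≤ lam := (maxNorm_nonneg _).trans hW
  have hMs0 : 0 ≤ Ms := (Finset.sum_nonneg fun i _ => abs_nonneg _).trans hMs
  refine Real.iSup_le (fun i => ?_) (by positivity)
  have hsplit : (symmetrize V *ᵥ fun j => (a₁ j - a₀ j) / 2) i -
      (shapePrecision Sig *ᵥ fun j => (m₁ j - m₀ j) / 2) i =
      (symmetrize V *ᵥ fun j => (a₁ j - a₀ j) / 2 - (m₁ j - m₀ j) / 2) i +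
      ((symmetrize V - shapePrecision Sig) *ᵥ fun j => (m₁ j - m₀ j) / 2) i := by
    simp only [Matrix.mulVec, dotProduct, Matrix.sub_apply]
    rw [← Finset.sum_sub_distrib, ← Finset.sum_add_distrib]
    exact Finset.sum_congr rfl fun j _ => by ring
  rw [hsplit]
  have hcol : ∀ j, ∑ i, |shapePrecision Sig i j| ≤ T :=
    fun j => (sum_abs_le_colSumNorm _ j).trans hT
  refine (abs_add_le _ _).trans (add_le_add ?_ ?_)
  · refine abs_mulVec_le i ?_ hb hm
    calc ∑ k, |symmetrize V i k| ≤ ∑ k, |V k i| :=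
          Finset.sum_le_sum fun k _ => abs_symmetrize_le V i k
      _ ≤ _ := (hV.sum_abs_col_le hW i).trans (hcol i)
  · refine abs_mulVec_le' i (fun k => ?_) (by positivity) hMs
    have hs := transpose_shapePrecision h
    rw [Matrix.sub_apply]
    rcases symmetrize_eq_or V i k with he | he <;> rw [he]
    · exact hV.abs_sub_le hS hs hW hcol i k
    · have : shapePrecision Sig i k = shapePrecision Sig k i := by
        conv_lhs => rw [← hs, Matrix.transpose_apply]
      rw [this]
      exact hV.abs_sub_le hS hs hW hcol k i

/-- For a tuning parameter at least `1` the only solution is the zero matrix. -/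
theorem IsClimeSolution.eq_zero_of_one_le {S V : Matrix (Fin p) (Fin p) ℝ} {lam : ℝ}
    (hV : IsClimeSolution S lam V) (hlam : 1 ≤ lam) : V = 0 := by
  have h0 : maxNorm ((p : ℝ) • S * (0 : Matrix (Fin p) (Fin p) ℝ) - 1) ≤ lam := by
    refine maxNorm_le (by linarith) fun i j => ?_
    simp only [Matrix.mul_zero, zero_sub, Matrix.neg_apply, abs_neg, Matrix.one_apply]
    split_ifs <;> simp <;> linarith
  ext i j
  have h1 := hV.sum_abs_col_le h0 j
  simp only [Matrix.zero_apply, abs_zero, Finset.sum_const_zero] at h1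
  have h2 := Finset.single_le_sum (f := fun i => |V i j|) (fun i _ => abs_nonneg _)
    (Finset.mem_univ i)
  have h3 : |V i j| ≤ 0 := h2.trans h1
  simpa using h3

theorem exists_isClimeSolution_of_one_le (S : Matrix (Fin p) (Fin p) ℝ) {lam : ℝ}
    (hlam : 1 ≤ lam) : ∃ V, IsClimeSolution S lam V := by
  refine exists_isClimeSolution (W := 0) (maxNorm_le (by linarith) fun i j => ?_)
  simp only [Matrix.mul_zero, zero_sub, Matrix.neg_apply, abs_neg, Matrix.one_apply]
  split_ifs <;> simp <;> linarith

theorem directionError_zero_le {T Ms : ℝ} {a₀ a₁ m₀ m₁ : EuclideanSpace ℝ (Fin p)}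
    (hT0 : 0 ≤ T) (hT : colSumNorm (shapePrecision Sig) ≤ T)
    (hMs : ∑ i, |(m₁ i - m₀ i) / 2| ≤ Ms) :
    directionError (0 : Matrix (Fin p) (Fin p) ℝ) a₀ a₁ Sig m₀ m₁ ≤ T * Ms := by
  have hMs0 : 0 ≤ Ms := (Finset.sum_nonneg fun i _ => abs_nonneg _).trans hMs
  refine Real.iSup_le (fun i => ?_) (by positivity)
  have hz : symmetrize (0 : Matrix (Fin p) (Fin p) ℝ) = 0 := by
    ext i j
    rcases symmetrize_eq_or (0 : Matrix (Fin p) (Fin p) ℝ) i j with h | h <;> simp [h]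
  rw [hz, Matrix.zero_mulVec, Pi.zero_apply, zero_sub, abs_neg]
  refine abs_mulVec_le' i (fun k => ?_) hT0 hMs
  exact (Finset.single_le_sum (f := fun i => |shapePrecision Sig i k|) (fun i _ => abs_nonneg _)
    (Finset.mem_univ i)).trans ((sum_abs_le_colSumNorm _ k).trans hT)

end Clime

/-! ### Regularity of a sample with high probability -/

section GoodEvent
variable {p : ℕ}

/-- The properties of a centred elliptical law on which the concentration arguments rest. -/
structure SignRadiusLaw (L : Measure (EuclideanSpace ℝ (Fin p))) (Sig : Matrix (Fin p) (Fin p) ℝ)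
    (η ζ s z : ℝ) : Prop where
  ae_ne_zero : ∀ᵐ x ∂L, x ≠ 0
  z_pos : 0 < z
  mgf : ∀ a, ∫⁻ x, ENNReal.ofReal (Real.exp (inner ℝ a (spatialSign x))) ∂L ≤
    ENNReal.ofReal (Real.exp (2 / (η ^ 2 * p) * ‖a‖ ^ 2 / 2))
  cov : ∀ j k, |∫ x, (p : ℝ) * (spatialSign x j * spatialSign x k) ∂L -
    p * Sig j k / Sig.trace| ≤ 320 / η ^ 4 / √p
  integrable_inv : Integrable (fun x => (z * ‖x‖)⁻¹) L
  integral_inv : ∫ x, (z * ‖x‖)⁻¹ ∂L = 1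
  integrable_inv_sq : Integrable (fun x => ((z * ‖x‖)⁻¹) ^ 2) L
  integral_inv_sq : ∫ x, ((z * ‖x‖)⁻¹) ^ 2 ∂L ≤ ζ
  exp_inv_sq : ∫⁻ x, ENNReal.ofReal (Real.exp (s * ((z * ‖x‖)⁻¹) ^ 2)) ∂L ≤ 2

theorem exp_neg_mul_log (hp : 0 < p) (k : ℕ) :
    Real.exp (-(k * Real.log p)) = 1 / (p : ℝ) ^ k := by
  rw [Real.exp_neg, Real.exp_nat_mul, Real.exp_log (by exact_mod_cast hp), one_div]

variable {L : Measure (EuclideanSpace ℝ (Fin p))} [IsProbabilityMeasure L]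
  {Sig : Matrix (Fin p) (Fin p) ℝ} {η ζ s z : ℝ}

theorem abs_spatialSign_apply_le (x : EuclideanSpace ℝ (Fin p)) (j : Fin p) :
    |spatialSign x j| ≤ 1 := by
  rcases eq_or_ne x 0 with rfl | hx
  · simp [spatialSign]
  · rw [← norm_spatialSign hx, ← Real.norm_eq_abs]
    exact PiLp.norm_apply_le _ j

theorem abs_inner_spatialSign_le (x a : EuclideanSpace ℝ (Fin p)) :
    |(inner ℝ a (spatialSign x) : ℝ)| ≤ ‖a‖ := by
  rcases eq_or_ne x 0 with rfl | hx
  · simp [spatialSign]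
  · have := abs_real_inner_le_norm a (spatialSign x)
    rwa [norm_spatialSign hx, mul_one] at this

theorem integrable_sign_mul_sign (j k : Fin p) :
    Integrable (fun x => (p : ℝ) * (spatialSign x j * spatialSign x k)) L := by
  refine Integrable.const_mul ?_ _
  refine Integrable.of_bound (Measurable.aestronglyMeasurable (by fun_prop)) 1
    (Filter.Eventually.of_forall fun x => ?_)
  rw [norm_mul, Real.norm_eq_abs, Real.norm_eq_abs]
  exact mul_le_one₀ (abs_spatialSign_apply_le x j) (abs_nonneg _) (abs_spatialSign_apply_le x k)

theorem SignRadiusLaw.integral_inner_sq_le (h : SignRadiusLaw L Sig η ζ s z) (hp : 0 < p)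
    (hη : 0 < η) (a : EuclideanSpace ℝ (Fin p)) :
    ∫ x, (inner ℝ a (spatialSign x)) ^ 2 ∂L ≤ 12 / (η ^ 2 * p) * ‖a‖ ^ 2 := by
  have hp' : (0 : ℝ) < p := by exact_mod_cast hp
  rcases eq_or_ne a 0 with rfl | ha
  · simp
  have hn : 0 < ‖a‖ := norm_pos_iff.2 ha
  -- At this scale the exponent in `mgf` equals `1`, and `exp 1 < 3`; the inequality `x² ≤ 2 (exp x
  -- + exp (-x))` then gives `12`.
  set t : ℝ := η * √p / ‖a‖ with ht
  have ht0 : 0 < t := by positivity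
  have hexp : ∀ c : EuclideanSpace ℝ (Fin p), ‖c‖ = t * ‖a‖ →
      ∫⁻ x, ENNReal.ofReal (Real.exp (inner ℝ c (spatialSign x))) ∂L ≤ ENNReal.ofReal 3 := by
    intro c hc
    refine (h.mgf c).trans (ENNReal.ofReal_le_ofReal ?_)
    have : 2 / (η ^ 2 * p) * ‖c‖ ^ 2 / 2 = 1 := by
      rw [hc, ht, div_mul_cancel₀ _ hn.ne', mul_pow, Real.sq_sqrt hp'.le]
      field_simp
    rw [this]
    linarith [Real.exp_one_lt_d9]
  have hb : ∀ c : EuclideanSpace ℝ (Fin p),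
      Integrable (fun x => (inner ℝ c (spatialSign x)) ^ 2) L := fun c => by
    refine Integrable.of_bound (Measurable.aestronglyMeasurable (by fun_prop)) (‖c‖ ^ 2)
      (Filter.Eventually.of_forall fun x => ?_)
    rw [norm_pow, Real.norm_eq_abs]
    gcongr
    exact abs_inner_spatialSign_le x c
  have h1 : ENNReal.ofReal (t ^ 2 * ∫ x, (inner ℝ a (spatialSign x)) ^ 2 ∂L) ≤
      ENNReal.ofReal 12 := by
    rw [← integral_const_mul, ofReal_integral_eq_lintegral_ofReal ((hb a).const_mul _)
      (Filter.Eventually.of_forall fun x => by positivity)]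
    calc _ ≤ ∫⁻ x, ENNReal.ofReal 2 * (ENNReal.ofReal (Real.exp (inner ℝ (t • a) (spatialSign x))) +
          ENNReal.ofReal (Real.exp (inner ℝ (-(t • a)) (spatialSign x)))) ∂L := by
          refine lintegral_mono fun x => ?_
          rw [← ENNReal.ofReal_add (by positivity) (by positivity),
            ← ENNReal.ofReal_mul (by norm_num)]
          apply ENNReal.ofReal_le_ofReal
          rw [inner_neg_left, inner_smul_left]
          simp only [conj_trivial]
          set y : ℝ := t * inner ℝ a (spatialSign x)
          have h2 := Real.pow_div_factorial_le_exp |y| (abs_nonneg y) 2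
          norm_num [Nat.factorial] at h2
          have h3 := exp_add_exp_neg_mono (x := |y|) (y := y) (by simp)
          have h4 : t ^ 2 * (inner ℝ a (spatialSign x)) ^ 2 = y ^ 2 := by simp only [y]; ring
          rw [h4]
          linarith [Real.exp_pos (-|y|)]
      _ ≤ ENNReal.ofReal 2 * (ENNReal.ofReal 3 + ENNReal.ofReal 3) := by
          rw [lintegral_const_mul _ (by fun_prop), lintegral_add_left (by fun_prop)]
          gcongr
          · exact hexp _ (by rw [norm_smul, Real.norm_of_nonneg ht0.le])
          · exact hexp _ (by rw [norm_neg, norm_smul, Real.norm_of_nonneg ht0.le])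
      _ = ENNReal.ofReal 12 := by
          rw [← ENNReal.ofReal_add (by norm_num) (by norm_num), ← ENNReal.ofReal_mul (by norm_num)]
          norm_num
  have h2 := (ENNReal.ofReal_le_ofReal_iff (by norm_num)).1 h1
  have h3 : t ^ 2 = η ^ 2 * p / ‖a‖ ^ 2 := by
    rw [ht, div_pow, mul_pow, Real.sq_sqrt hp'.le]
  rw [h3] at h2
  rw [div_mul_eq_mul_div, le_div_iff₀ (by positivity)]
  have h4 : 0 < ‖a‖ ^ 2 := by positivity
  rw [div_mul_eq_mul_div, div_le_iff₀ h4] at h2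
  linarith

variable {n : ℕ}

/-- Bernstein's inequality with `s = η² / 8`, whence `176 = 22 · 8`; each entry fails with
probability `2 p⁻⁶` and there are `p²` entries. -/
theorem SignRadiusLaw.measure_cov_le (h : SignRadiusLaw L Sig η ζ s z) (hp : 0 < p) (hη : 0 < η)
    {δ : ℝ} (hδ : 0 ≤ δ) (hδ' : δ ≤ 1 / 2) (hl : n * δ ^ 2 = Real.log p) :
    (Measure.pi fun _ : Fin n => L) {y | ∃ j k, n * (176 / η ^ 2 * δ) ≤
      |∑ i, (p : ℝ) * (spatialSign (y i) j * spatialSign (y i) k) -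
        n * ∫ x, (p : ℝ) * (spatialSign x j * spatialSign x k) ∂L|} ≤
      ENNReal.ofReal (2 / (p : ℝ) ^ 4) := by
  have hp' : (0 : ℝ) < p := by exact_mod_cast hp
  have h1 : ∀ j k, (Measure.pi fun _ : Fin n => L) {y | n * (176 / η ^ 2 * δ) ≤
      |∑ i, (p : ℝ) * (spatialSign (y i) j * spatialSign (y i) k) -
        n * ∫ x, (p : ℝ) * (spatialSign x j * spatialSign x k) ∂L|} ≤
      ENNReal.ofReal (2 / (p : ℝ) ^ 6) := by
    intro j k
    have := measure_pi_abs_sum_sub_ge_le L n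
      (f := fun x => (p : ℝ) * (spatialSign x j * spatialSign x k)) (by fun_prop)
      (s := η ^ 2 / 8) (by positivity) hδ hδ'
      (lintegral_exp_abs_mul_le L hp measurable_spatialSign hη h.mgf j k)
    rw [hl] at this
    have e1 : 22 / (η ^ 2 / 8) * δ = 176 / η ^ 2 * δ := by field_simp; ring
    have e2 := exp_neg_mul_log hp 6
    push_cast at e2
    rw [e1, e2] at this
    refine this.trans (le_of_eq ?_)
    congr 1; ring
  have h2 : {y : Fin n → EuclideanSpace ℝ (Fin p) | ∃ j k, n * (176 / η ^ 2 * δ) ≤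
      |∑ i, (p : ℝ) * (spatialSign (y i) j * spatialSign (y i) k) -
        n * ∫ x, (p : ℝ) * (spatialSign x j * spatialSign x k) ∂L|} =
      ⋃ j, ⋃ k, {y | n * (176 / η ^ 2 * δ) ≤
      |∑ i, (p : ℝ) * (spatialSign (y i) j * spatialSign (y i) k) -
        n * ∫ x, (p : ℝ) * (spatialSign x j * spatialSign x k) ∂L|} := by
    ext y; simp
  rw [h2]
  refine (measure_iUnion_fintype_le _ _).trans ?_
  calc _ ≤ ∑ _j : Fin p, ∑ _k : Fin p, ENNReal.ofReal (2 / (p : ℝ) ^ 6) :=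
        Finset.sum_le_sum fun j _ => (measure_iUnion_fintype_le _ _).trans
          (Finset.sum_le_sum fun k _ => h1 j k)
    _ = _ := by
        simp only [Finset.sum_const, Finset.card_univ, Fintype.card_fin, nsmul_eq_mul]
        rw [← ENNReal.ofReal_natCast, ← ENNReal.ofReal_mul hp'.le, ← ENNReal.ofReal_mul hp'.le]
        congr 1
        field_simp

/-- Chernoff's bound with `t = ± η √p δ`, for which the exponent is `n δ² - 7 n δ² = -6 log p`. -/
theorem SignRadiusLaw.measure_sign_le (h : SignRadiusLaw L Sig η ζ s z) (hp : 0 < p) (hη : 0 < η)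
    {δ : ℝ} (hδ : 0 ≤ δ) (hl : n * δ ^ 2 = Real.log p) :
    (Measure.pi fun _ : Fin n => L) {y | ∃ j, 7 / η * n * δ ≤
      √p * |∑ i, spatialSign (y i) j|} ≤ ENNReal.ofReal (2 / (p : ℝ) ^ 4) := by
  have hp' : (0 : ℝ) < p := by exact_mod_cast hp
  have hp1 : (1 : ℝ) ≤ p := by exact_mod_cast hp
  have hsp : 0 < √(p : ℝ) := Real.sqrt_pos.2 hp'
  have key : ∀ j, ∀ t : ℝ, |t| = η * √p * δ → (Measure.pi fun _ : Fin n => L)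
      {y | 7 * (n * δ ^ 2) ≤ ∑ i, t * spatialSign (y i) j} ≤ ENNReal.ofReal (1 / (p : ℝ) ^ 6) := by
    intro j t ht
    have hm := h.mgf (EuclideanSpace.single j t)
    simp only [EuclideanSpace.inner_single_left, conj_trivial, PiLp.norm_single,
      Real.norm_eq_abs] at hm
    refine (measure_pi_sum_ge_le L n (f := fun x => t * spatialSign x j) (by fun_prop) _ hm).trans ?_
    apply ENNReal.ofReal_le_ofReal
    have e2 := exp_neg_mul_log hp 6
    push_cast at e2
    rw [← e2]
    apply Real.exp_le_exp.2
    rw [ht, ← hl]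
    have e3 : 2 / (η ^ 2 * p) * (η * √p * δ) ^ 2 / 2 = δ ^ 2 := by
      rw [mul_pow, mul_pow, Real.sq_sqrt hp'.le]; field_simp
    rw [e3]
    linarith
  have h2 : {y : Fin n → EuclideanSpace ℝ (Fin p) | ∃ j, 7 / η * n * δ ≤
      √p * |∑ i, spatialSign (y i) j|} ⊆
      ⋃ j, ({y | 7 * (n * δ ^ 2) ≤ ∑ i, (η * √p * δ) * spatialSign (y i) j} ∪
        {y | 7 * (n * δ ^ 2) ≤ ∑ i, (-(η * √p * δ)) * spatialSign (y i) j}) := by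
    rintro y ⟨j, hj⟩
    simp only [Set.mem_iUnion, Set.mem_union, Set.mem_ofPred_eq, ← Finset.mul_sum]
    refine ⟨j, ?_⟩
    have h3 : 7 * (n * δ ^ 2) = η * δ * (7 / η * n * δ) := by field_simp
    have h4 := mul_le_mul_of_nonneg_left hj (by positivity : 0 ≤ η * δ)
    rw [← h3] at h4
    rcases abs_cases (∑ i, spatialSign (y i) j) with ⟨h, _⟩ | ⟨h, _⟩ <;> rw [h] at h4
    · left; linarith
    · right; linarith
  refine (measure_mono h2).trans ((measure_iUnion_fintype_le _ _).trans ?_)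
  calc _ ≤ ∑ _j : Fin p, (ENNReal.ofReal (1 / (p : ℝ) ^ 6) + ENNReal.ofReal (1 / (p : ℝ) ^ 6)) :=
        Finset.sum_le_sum fun j _ => (measure_union_le _ _).trans
          (add_le_add (key j _ (abs_of_nonneg (by positivity)))
            (key j _ (by rw [abs_neg, abs_of_nonneg (by positivity)])))
    _ = ENNReal.ofReal (2 / (p : ℝ) ^ 5) := by
        simp only [Finset.sum_const, Finset.card_univ, Fintype.card_fin, nsmul_eq_mul]
        rw [← ENNReal.ofReal_natCast, ← ENNReal.ofReal_add (by positivity) (by positivity),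
          ← ENNReal.ofReal_mul hp'.le]
        congr 1
        field_simp
        norm_num
    _ ≤ _ := by
        apply ENNReal.ofReal_le_ofReal
        gcongr
        norm_num

/-- The sum of the signs is sub-Gaussian in every direction with proxy `σ = 2 n / (η² p)`, so `exp
(‖·‖² / (4 σ))` has mean at most `2 ^ (p / 2)`. Markov's inequality at level `p` loses nothing to a
union over coordinates. -/
theorem SignRadiusLaw.measure_norm_sum_le (h : SignRadiusLaw L Sig η ζ s z) (hp : 0 < p)
    (hη : 0 < η) (hn : 0 < n) :
    (Measure.pi fun _ : Fin n => L) {y | 3 / η * √n ≤ ‖∑ i, spatialSign (y i)‖} ≤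
      ENNReal.ofReal (Real.exp (-(p / 2))) := by
  have hp' : (0 : ℝ) < p := by exact_mod_cast hp
  have hn' : (0 : ℝ) < n := by exact_mod_cast hn
  set σ : ℝ := 2 * n / (η ^ 2 * p) with hσ
  have h1 := lintegral_exp_sq_norm_le (Measure.pi fun _ : Fin n => L)
    (Z := fun y => ∑ i, spatialSign (y i)) (by fun_prop) (s := σ) (by positivity) (fun a => by
      have := lintegral_pi_exp_sum_le L n (f := fun x => inner ℝ a (spatialSign x)) (by fun_prop)
        (h.mgf a)
      simp_rw [inner_sum]
      refine this.trans (le_of_eq ?_)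
      congr 2
      rw [hσ]; ring)
  have h2 := measure_ge_le_of_lintegral_exp_le (Measure.pi fun _ : Fin n => L)
    (f := fun y => ‖∑ i, spatialSign (y i)‖ ^ 2 / (4 * σ)) (by fun_prop) p h1
  refine (measure_mono fun y hy => ?_).trans (h2.trans ?_)
  · simp only [Set.mem_ofPred_eq] at hy ⊢
    rw [le_div_iff₀ (by positivity)]
    calc p * (4 * σ) = 8 / η ^ 2 * n := by rw [hσ]; field_simp; norm_num
      _ ≤ (3 / η * √n) ^ 2 := by
          rw [mul_pow, Real.sq_sqrt hn'.le, div_pow]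
          gcongr
          norm_num
      _ ≤ _ := by gcongr
  · apply ENNReal.ofReal_le_ofReal
    rw [finrank_euclideanSpace, Fintype.card_fin, Real.rpow_def_of_pos (by norm_num),
      ← Real.exp_add]
    apply Real.exp_le_exp.2
    have := Real.log_two_lt_d9
    nlinarith

theorem SignRadiusLaw.measure_inv_sq_le (h : SignRadiusLaw L Sig η ζ s z) (hs : 0 < s) :
    (Measure.pi fun _ : Fin n => L) {y | 2 / s * n ≤ ∑ i, ((z * ‖y i‖)⁻¹) ^ 2} ≤
      ENNReal.ofReal (Real.exp (-n)) := by
  have h1 := measure_pi_sum_ge_le L n (f := fun x => s * ((z * ‖x‖)⁻¹) ^ 2) (by fun_prop)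
    (b := Real.log 2) (2 * n) (by
      rw [Real.exp_log (by norm_num)]; simpa using h.exp_inv_sq)
  refine (measure_mono fun y hy => ?_).trans (h1.trans ?_)
  · simp only [Set.mem_ofPred_eq, ← Finset.mul_sum] at hy ⊢
    have := mul_le_mul_of_nonneg_left hy hs.le
    calc (2 : ℝ) * n = s * (2 / s * n) := by field_simp
      _ ≤ _ := this
  · apply ENNReal.ofReal_le_ofReal
    apply Real.exp_le_exp.2
    have := Real.log_two_lt_d9
    have hn : (0 : ℝ) ≤ n := by positivity
    nlinarith

theorem SignRadiusLaw.measure_exists_inv_le (h : SignRadiusLaw L Sig η ζ s z) (t : ℝ) :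
    (Measure.pi fun _ : Fin n => L) {y | ∃ i, t ≤ s * ((z * ‖y i‖)⁻¹) ^ 2} ≤
      ENNReal.ofReal (n * (2 * Real.exp (-t))) := by
  have h1 := measure_pi_exists_le L n (A := {x | t ≤ s * ((z * ‖x‖)⁻¹) ^ 2})
    (measurableSet_le measurable_const (by fun_prop))
  refine h1.trans ?_
  have h2 := measure_ge_le_of_lintegral_exp_le L (f := fun x => s * ((z * ‖x‖)⁻¹) ^ 2)
    (by fun_prop) t (K := 2) (by simpa using h.exp_inv_sq)
  rw [ENNReal.ofReal_mul (by positivity), ENNReal.ofReal_natCast]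
  gcongr

/-- A Paley–Zygmund argument inside Chernoff's bound: mean `1` and second moment at most `ζ` force
`ν ≥ 1 / 2` with probability of order `1 / ζ`. The exponent is `-3 n / (20 ζ) + n / (8 ζ) = -n / (40
ζ)`. -/
theorem SignRadiusLaw.measure_card_le (h : SignRadiusLaw L Sig η ζ s z) (hζ : 0 < ζ) :
    (Measure.pi fun _ : Fin n => L)
      {y | ((Finset.univ.filter fun i => 1 / 2 ≤ (z * ‖y i‖)⁻¹).card : ℝ) ≤ n / (8 * ζ)} ≤
      ENNReal.ofReal (Real.exp (-(n / (40 * ζ)))) := by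
  classical
  set f : EuclideanSpace ℝ (Fin p) → ℝ := fun x => if 1 / 2 ≤ (z * ‖x‖)⁻¹ then -1 else 0 with hf
  have hfm : Measurable f := Measurable.ite (measurableSet_le measurable_const (by fun_prop))
    measurable_const measurable_const
  -- The parabola `ν - ν² / (4 ζ)` peaks at `ζ`, so the majorant stays above `2 / 5 ≥ exp (-1)`;
  -- where `ν < 1 / 2` the bracket is nonpositive and the majorant is at least `1`.
  have hpt : ∀ x, Real.exp (f x) ≤
      1 - 3 / (5 * ζ) * ((z * ‖x‖)⁻¹ - 1 / 2 - ((z * ‖x‖)⁻¹) ^ 2 / (4 * ζ)) := by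
    intro x
    set ν := (z * ‖x‖)⁻¹ with hν
    have h3 : 3 / (5 * ζ) * (ν - 1 / 2 - ν ^ 2 / (4 * ζ)) =
        3 / 5 * (1 - (ν / (2 * ζ) - 1) ^ 2) - 3 / (10 * ζ) := by field_simp; ring
    have h5 : 0 < 3 / (10 * ζ) := by positivity
    simp only [hf, ← hν]
    split_ifs with hx
    · rw [h3]
      have h4 : Real.exp (-1) ≤ 2 / 5 := by
        rw [Real.exp_neg, inv_le_comm₀ (Real.exp_pos _) (by norm_num)]
        linarith [Real.exp_one_gt_d9]
      nlinarith [sq_nonneg (ν / (2 * ζ) - 1)]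
    · rw [Real.exp_zero]
      have h6 : ν - 1 / 2 - ν ^ 2 / (4 * ζ) ≤ 0 := by
        have : 0 ≤ ν ^ 2 / (4 * ζ) := by positivity
        push Not at hx
        linarith
      have h7 : 0 ≤ 3 / (5 * ζ) := by positivity
      nlinarith
  have i0 : Integrable (fun x => (z * ‖x‖)⁻¹ - 1 / 2) L :=
    h.integrable_inv.sub (integrable_const _)
  have i1 : Integrable (fun x => (z * ‖x‖)⁻¹ - 1 / 2 - ((z * ‖x‖)⁻¹) ^ 2 / (4 * ζ)) L :=
    i0.sub (h.integrable_inv_sq.div_const _)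
  have i2 : Integrable (fun x => 1 - 3 / (5 * ζ) *
      ((z * ‖x‖)⁻¹ - 1 / 2 - ((z * ‖x‖)⁻¹) ^ 2 / (4 * ζ))) L :=
    (integrable_const _).sub (i1.const_mul _)
  have hmgf : ∫⁻ x, ENNReal.ofReal (Real.exp (f x)) ∂L ≤
      ENNReal.ofReal (Real.exp (-(3 / (20 * ζ)))) := by
    calc _ ≤ ∫⁻ x, ENNReal.ofReal (1 - 3 / (5 * ζ) *
          ((z * ‖x‖)⁻¹ - 1 / 2 - ((z * ‖x‖)⁻¹) ^ 2 / (4 * ζ))) ∂L :=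
          lintegral_mono fun x => ENNReal.ofReal_le_ofReal (hpt x)
      _ = ENNReal.ofReal (∫ x, (1 - 3 / (5 * ζ) *
          ((z * ‖x‖)⁻¹ - 1 / 2 - ((z * ‖x‖)⁻¹) ^ 2 / (4 * ζ))) ∂L) :=
          (ofReal_integral_eq_lintegral_ofReal i2 (Filter.Eventually.of_forall fun x =>
            (Real.exp_pos _).le.trans (hpt x))).symm
      _ ≤ _ := by
          apply ENNReal.ofReal_le_ofReal
          rw [integral_sub (integrable_const _) (i1.const_mul _), integral_const_mul,
            integral_sub i0 (h.integrable_inv_sq.div_const _),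
            integral_sub h.integrable_inv (integrable_const _), h.integral_inv,
            integral_div (4 * ζ) (fun x : EuclideanSpace ℝ (Fin p) => ((z * ‖x‖)⁻¹) ^ 2)]
          simp only [integral_const, probReal_univ, one_smul]
          have h8 : (∫ x, ((z * ‖x‖)⁻¹) ^ 2 ∂L) / (4 * ζ) ≤ 1 / 4 := by
            rw [div_le_iff₀ (by positivity)]; linarith [h.integral_inv_sq]
          have h9 := Real.add_one_le_exp (-(3 / (20 * ζ)))
          have h10 : 3 / (5 * ζ) * (1 / 4) ≤
              3 / (5 * ζ) * (1 - 1 / 2 - (∫ x, ((z * ‖x‖)⁻¹) ^ 2 ∂L) / (4 * ζ)) := by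
            gcongr; linarith
          have h11 : 3 / (5 * ζ) * (1 / 4) = 3 / (20 * ζ) := by field_simp; norm_num
          linarith
  refine (measure_mono fun y hy => ?_).trans
    ((measure_pi_sum_ge_le L n hfm (-(n / (8 * ζ))) hmgf).trans (le_of_eq ?_))
  · simp only [Set.mem_ofPred_eq, hf] at hy ⊢
    rw [Finset.sum_ite]
    simp only [Finset.sum_const, nsmul_eq_mul]
    linarith
  · congr 2
    field_simp
    ring

/-- Prepares a truncation of the sum of `ν w`, where `w` is `p` times a squared sign coordinate.
When `ν² ≥ (24 / s) log p`, the weight `exp (s ν² / 4)` exceeds `p⁶` and compensates the prefactor.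
The tilted product is integrable because `w²` and `ν² exp (s ν² / 2)` are separately dominated by
exponential moments. -/
theorem SignRadiusLaw.lintegral_weighted_le (h : SignRadiusLaw L Sig η ζ s z) (hp : 0 < p)
    (hη : 0 < η) (hs : 0 < s) (j : Fin p) :
    ∫⁻ x, ENNReal.ofReal (1 / (p : ℝ) ^ 6 * ((z * ‖x‖)⁻¹ * (p * (spatialSign x j) ^ 2) *
      Real.exp (s * ((z * ‖x‖)⁻¹) ^ 2 / 4))) ∂L ≤
      ENNReal.ofReal ((128 / η ^ 4 + 2 / s) / (p : ℝ) ^ 6) := by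
  have hp' : (0 : ℝ) < p := by exact_mod_cast hp
  have hy := lintegral_exp_abs_mul_le L hp measurable_spatialSign hη h.mgf j j
  have hexp2 : ∀ t : ℝ, 0 ≤ t → t ^ 2 ≤ 2 * Real.exp t := fun t ht => by
    have := Real.pow_div_factorial_le_exp t ht 2
    norm_num [Nat.factorial] at this
    linarith
  have hexp1 : ∀ t : ℝ, t ≤ Real.exp t := fun t => by linarith [Real.add_one_le_exp t]
  have hpt : ∀ x : EuclideanSpace ℝ (Fin p),
      1 / (p : ℝ) ^ 6 * ((z * ‖x‖)⁻¹ * (p * (spatialSign x j) ^ 2) *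
        Real.exp (s * ((z * ‖x‖)⁻¹) ^ 2 / 4)) ≤
      64 / η ^ 4 / (p : ℝ) ^ 6 *
        Real.exp (η ^ 2 / 8 * |p * (spatialSign x j * spatialSign x j)|) +
      1 / s / (p : ℝ) ^ 6 * Real.exp (s * ((z * ‖x‖)⁻¹) ^ 2) := by
    intro x
    set ν := (z * ‖x‖)⁻¹
    have e0 : |(p : ℝ) * (spatialSign x j * spatialSign x j)| = p * (spatialSign x j) ^ 2 := by
      rw [abs_of_nonneg (mul_nonneg hp'.le (mul_self_nonneg _))]; ring
    rw [e0]
    set w := (p : ℝ) * (spatialSign x j) ^ 2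
    have hw : 0 ≤ w := by positivity
    have a1 : w ^ 2 ≤ 128 / η ^ 4 * Real.exp (η ^ 2 / 8 * w) := by
      have h1 := hexp2 (η ^ 2 / 8 * w) (by positivity)
      have h2 : w ^ 2 = 64 / η ^ 4 * (η ^ 2 / 8 * w) ^ 2 := by field_simp; norm_num
      rw [h2]
      calc _ ≤ 64 / η ^ 4 * (2 * Real.exp (η ^ 2 / 8 * w)) := by gcongr
        _ = _ := by ring
    have a2 : (ν * Real.exp (s * ν ^ 2 / 4)) ^ 2 ≤ 2 / s * Real.exp (s * ν ^ 2) := by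
      have h1 := hexp1 (s * ν ^ 2 / 2)
      have h2 : (ν * Real.exp (s * ν ^ 2 / 4)) ^ 2 =
          2 / s * (s * ν ^ 2 / 2 * Real.exp (s * ν ^ 2 / 2)) := by
        rw [mul_pow, ← Real.exp_nat_mul]
        have : ((2 : ℕ) : ℝ) * (s * ν ^ 2 / 4) = s * ν ^ 2 / 2 := by push_cast; ring
        rw [this]
        field_simp
      rw [h2]
      have h3 : Real.exp (s * ν ^ 2) = Real.exp (s * ν ^ 2 / 2) * Real.exp (s * ν ^ 2 / 2) := by
        rw [← Real.exp_add]; congr 1; ring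
      rw [h3]
      gcongr
    have a3 : ν * w * Real.exp (s * ν ^ 2 / 4) ≤ 64 / η ^ 4 * Real.exp (η ^ 2 / 8 * w) +
        1 / s * Real.exp (s * ν ^ 2) := by
      have h1 := two_mul_le_add_sq w (ν * Real.exp (s * ν ^ 2 / 4))
      have h2 : 128 / η ^ 4 * Real.exp (η ^ 2 / 8 * w) =
        2 * (64 / η ^ 4 * Real.exp (η ^ 2 / 8 * w)) := by ring
      have h3 : 2 / s * Real.exp (s * ν ^ 2) = 2 * (1 / s * Real.exp (s * ν ^ 2)) := by ring
      linarith
    calc _ ≤ 1 / (p : ℝ) ^ 6 * (64 / η ^ 4 * Real.exp (η ^ 2 / 8 * w) +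
        1 / s * Real.exp (s * ν ^ 2)) := by gcongr
      _ = _ := by ring
  calc _ ≤ ∫⁻ x, (ENNReal.ofReal (64 / η ^ 4 / (p : ℝ) ^ 6) * ENNReal.ofReal
        (Real.exp (η ^ 2 / 8 * |p * (spatialSign x j * spatialSign x j)|)) +
      ENNReal.ofReal (1 / s / (p : ℝ) ^ 6) *
        ENNReal.ofReal (Real.exp (s * ((z * ‖x‖)⁻¹) ^ 2))) ∂L := by
        refine lintegral_mono fun x => ?_
        rw [← ENNReal.ofReal_mul (by positivity), ← ENNReal.ofReal_mul (by positivity),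
          ← ENNReal.ofReal_add (by positivity) (by positivity)]
        exact ENNReal.ofReal_le_ofReal (hpt x)
    _ ≤ ENNReal.ofReal (64 / η ^ 4 / (p : ℝ) ^ 6) * 2 +
        ENNReal.ofReal (1 / s / (p : ℝ) ^ 6) * 2 := by
        rw [lintegral_add_left (by fun_prop), lintegral_const_mul _ (by fun_prop),
          lintegral_const_mul _ (by fun_prop)]
        gcongr
        exact h.exp_inv_sq
    _ = _ := by
        have h2 : (2 : ℝ≥0∞) = ENNReal.ofReal 2 := by simp
        rw [h2, ← ENNReal.ofReal_mul (by positivity), ← ENNReal.ofReal_mul (by positivity),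
          ← ENNReal.ofReal_add (by positivity) (by positivity)]
        congr 1
        ring

theorem SignRadiusLaw.measure_weighted_le (h : SignRadiusLaw L Sig η ζ s z) (hp : 0 < p)
    (hη : 0 < η) (hs : 0 < s) (hn : 0 < n) :
    (Measure.pi fun _ : Fin n => L) {y | ∃ j, (n : ℝ) ≤ ∑ i, 1 / (p : ℝ) ^ 6 *
      ((z * ‖y i‖)⁻¹ * (p * (spatialSign (y i) j) ^ 2) *
        Real.exp (s * ((z * ‖y i‖)⁻¹) ^ 2 / 4))} ≤
      ENNReal.ofReal ((128 / η ^ 4 + 2 / s) / (p : ℝ) ^ 5) := by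
  have hp' : (0 : ℝ) < p := by exact_mod_cast hp
  have hz := h.z_pos
  rw [Set.ofPred_exists]
  refine (measure_iUnion_fintype_le _ _).trans ?_
  calc _ ≤ ∑ _j : Fin p, ENNReal.ofReal ((128 / η ^ 4 + 2 / s) / (p : ℝ) ^ 6) :=
        Finset.sum_le_sum fun j _ => (measure_pi_sum_ge_le_lintegral L n
          (f := fun x => 1 / (p : ℝ) ^ 6 * ((z * ‖x‖)⁻¹ * (p * (spatialSign x j) ^ 2) *
            Real.exp (s * ((z * ‖x‖)⁻¹) ^ 2 / 4))) (by fun_prop)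
          (fun x => by positivity) hn).trans (h.lintegral_weighted_le hp hη hs j)
    _ = _ := by
        simp only [Finset.sum_const, Finset.card_univ, Fintype.card_fin, nsmul_eq_mul]
        rw [← ENNReal.ofReal_natCast, ← ENNReal.ofReal_mul hp'.le]
        congr 1
        field_simp

theorem SignRadiusLaw.measure_exists_eq_zero (h : SignRadiusLaw L Sig η ζ s z) :
    (Measure.pi fun _ : Fin n => L) {y | ∃ i, y i = 0} = 0 := by
  have h1 := measure_pi_exists_le L n (A := {0}) (measurableSet_singleton _)
  have h2 : L {0} = 0 := by
    have := h.ae_ne_zero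
    rw [ae_iff] at this
    simpa using this
  rw [h2, mul_zero] at h1
  simpa using h1

/-- Entrywise control of a matrix controls its quadratic form. -/
theorem abs_sum_sum_mul_le {A : Fin p → Fin p → ℝ} {b : ℝ} (hb : 0 ≤ b)
    (hA : ∀ j k, |A j k| ≤ b) (a : EuclideanSpace ℝ (Fin p)) :
    |∑ j, ∑ k, a j * a k * A j k| ≤ p * b * ‖a‖ ^ 2 := by
  calc _ ≤ ∑ j, ∑ k, |a j| * |a k| * b := by
        refine (Finset.abs_sum_le_sum_abs _ _).trans (Finset.sum_le_sum fun j _ =>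
          (Finset.abs_sum_le_sum_abs _ _).trans (Finset.sum_le_sum fun k _ => ?_))
        rw [abs_mul, abs_mul]
        gcongr
        exact hA j k
    _ = b * (∑ j, |a j|) ^ 2 := by
        simp_rw [← Finset.sum_mul]
        rw [sq, Finset.sum_mul_sum]
        ring
    _ ≤ b * (p * ∑ j, |a j| ^ 2) := by
        gcongr
        have := sq_sum_le_card_mul_sum_sq (s := (Finset.univ : Finset (Fin p))) (f := fun j => |a j|)
        simpa using this
    _ = _ := by
        rw [EuclideanSpace.norm_sq_eq]
        simp only [Real.norm_eq_abs]
        ring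

theorem sum_inner_sq_eq (y : Fin n → EuclideanSpace ℝ (Fin p)) (a : EuclideanSpace ℝ (Fin p)) :
    ∑ i, (inner ℝ (y i) a) ^ 2 = ∑ j, ∑ k, a j * a k * ∑ i, y i j * y i k := by
  have h1 : ∀ i, (inner ℝ (y i) a : ℝ) ^ 2 = ∑ j, ∑ k, a j * a k * (y i j * y i k) := by
    intro i
    rw [PiLp.inner_apply, sq, Finset.sum_mul_sum]
    refine Finset.sum_congr rfl fun j _ => Finset.sum_congr rfl fun k _ => ?_
    simp
    ring
  simp_rw [h1, Finset.mul_sum]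
  rw [Finset.sum_comm]
  refine Finset.sum_congr rfl fun j _ => ?_
  rw [Finset.sum_comm]

theorem integral_inner_sq_eq (a : EuclideanSpace ℝ (Fin p)) :
    p * ∫ x, (inner ℝ a (spatialSign x)) ^ 2 ∂L =
      ∑ j, ∑ k, a j * a k * ∫ x, (p : ℝ) * (spatialSign x j * spatialSign x k) ∂L := by
  have h1 : ∀ x, p * (inner ℝ a (spatialSign x) : ℝ) ^ 2 =
      ∑ j, ∑ k, a j * a k * (p * (spatialSign x j * spatialSign x k)) := by
    intro x
    rw [PiLp.inner_apply, sq, Finset.sum_mul_sum, Finset.mul_sum]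
    refine Finset.sum_congr rfl fun j _ => ?_
    rw [Finset.mul_sum]
    refine Finset.sum_congr rfl fun k _ => ?_
    simp
    ring
  rw [← integral_const_mul]
  simp_rw [h1]
  rw [integral_finsetSum _ fun j _ => integrable_finsetSum _ fun k _ =>
    (integrable_sign_mul_sign j k).const_mul _]
  refine Finset.sum_congr rfl fun j _ => ?_
  rw [integral_finsetSum _ fun k _ => (integrable_sign_mul_sign j k).const_mul _]
  simp_rw [integral_const_mul]

/-- Passing from entries to the quadratic form costs a factor `p`, which the normalization of the
products by `p` exactly returns. -/
theorem SignRadiusLaw.sum_inner_sq_le (h : SignRadiusLaw L Sig η ζ s z) (hp : 0 < p) (hη : 0 < η)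
    {y : Fin n → EuclideanSpace ℝ (Fin p)} {b : ℝ} (hb : 0 ≤ b)
    (hc : ∀ j k, |∑ i, (p : ℝ) * (spatialSign (y i) j * spatialSign (y i) k) -
        n * ∫ x, (p : ℝ) * (spatialSign x j * spatialSign x k) ∂L| ≤ n * b)
    (a : EuclideanSpace ℝ (Fin p)) :
    ∑ i, (inner ℝ (spatialSign (y i)) a) ^ 2 ≤ n * ‖a‖ ^ 2 * (12 / (η ^ 2 * p) + b) := by
  have hp' : (0 : ℝ) < p := by exact_mod_cast hp
  have h1 := (abs_le.1 (abs_sum_sum_mul_le (by positivity) hc a)).2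
  have h2 : ∑ j, ∑ k, a j * a k * (∑ i, (p : ℝ) * (spatialSign (y i) j * spatialSign (y i) k) -
        n * ∫ x, (p : ℝ) * (spatialSign x j * spatialSign x k) ∂L) =
      p * ∑ i, (inner ℝ (spatialSign (y i)) a) ^ 2 -
        n * (p * ∫ x, (inner ℝ a (spatialSign x)) ^ 2 ∂L) := by
    rw [sum_inner_sq_eq, integral_inner_sq_eq a, Finset.mul_sum, Finset.mul_sum,
      ← Finset.sum_sub_distrib]
    refine Finset.sum_congr rfl fun j _ => ?_
    rw [Finset.mul_sum, Finset.mul_sum, ← Finset.sum_sub_distrib]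
    refine Finset.sum_congr rfl fun k _ => ?_
    rw [← Finset.mul_sum]
    ring
  rw [h2] at h1
  have h3 : n * (p * ∫ x, (inner ℝ a (spatialSign x)) ^ 2 ∂L) ≤
      n * (p * (12 / (η ^ 2 * p) * ‖a‖ ^ 2)) := by
    gcongr
    exact h.integral_inner_sq_le hp hη a
  refine le_of_mul_le_mul_left ?_ hp'
  linarith

end GoodEvent

/-! ### Regularity of one class with probability at least `1 - p⁻²` -/

section OneClass
variable {p n : ℕ} {L : Measure (EuclideanSpace ℝ (Fin p))} [IsProbabilityMeasure L]
  {Sig : Matrix (Fin p) (Fin p) ℝ} {η ζ s z : ℝ}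

/-- A constant `H` that dominates the constants of the concentration inequalities. -/
structure DominatingConst (H η ζ s : ℝ) : Prop where
  one_le : 1 ≤ H
  zeta_le : 8 * ζ ≤ H
  s_le : 2 / s ≤ H
  eta_sq_le : 100 / η ^ 2 ≤ H
  eta_le : 7 / η ≤ H
  mixed_le : √(24 / s) * (13 / η ^ 2) + 1 ≤ H

theorem SignRadiusLaw.regularSample (h : SignRadiusLaw L Sig η ζ s z) {H δ : ℝ} (hp : 3 ≤ p)
    (hη : 0 < η) (hs : 0 < s) (hn : 0 < n) (hH : DominatingConst H η ζ s)
    (hpH : H ^ 2 ≤ p) (hδ : 0 ≤ δ) (hδH : 5000 * H ^ 5 * δ ≤ 1) (hl : n * δ ^ 2 = Real.log p)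
    {y : Fin n → EuclideanSpace ℝ (Fin p)} (h0 : ∀ i, y i ≠ 0)
    (hcov : ∀ j k, |∑ i, (p : ℝ) * (spatialSign (y i) j * spatialSign (y i) k) -
        n * ∫ x, (p : ℝ) * (spatialSign x j * spatialSign x k) ∂L| ≤ n * (176 / η ^ 2 * δ))
    (hsign : ∀ j, √p * |∑ i, spatialSign (y i) j| ≤ 7 / η * n * δ)
    (hnorm : ‖∑ i, spatialSign (y i)‖ ≤ 3 / η * √n)
    (hinv : ∑ i, ((z * ‖y i‖)⁻¹) ^ 2 ≤ 2 / s * n)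
    (hsep : ∀ i, s * ((z * ‖y i‖)⁻¹) ^ 2 ≤ n / (512 * H ^ 5))
    (hcard : (n : ℝ) / (8 * ζ) ≤ (Finset.univ.filter fun i => 1 / 2 ≤ (z * ‖y i‖)⁻¹).card)
    (hζ : 0 < ζ)
    (hw : ∀ j, ∑ i, 1 / (p : ℝ) ^ 6 * ((z * ‖y i‖)⁻¹ * (p * (spatialSign (y i) j) ^ 2) *
        Real.exp (s * ((z * ‖y i‖)⁻¹) ^ 2 / 4)) ≤ (n : ℝ)) :
    RegularSample y z H δ := by
  have hp' : (0 : ℝ) < p := by exact_mod_cast (by omega : 0 < p)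
  have hn' : (0 : ℝ) < n := by exact_mod_cast hn
  have hH1 := hH.one_le
  have hH0 : 0 < H := by linarith
  have hz := h.z_pos
  have hδ5 : δ ≤ 1 / (5000 * H ^ 5) := by rw [le_div_iff₀ (by positivity)]; linarith
  have hη2 : 1 / η ^ 2 ≤ H / 100 := by
    have := hH.eta_sq_le
    have h2 : 100 / η ^ 2 = 100 * (1 / η ^ 2) := by ring
    linarith
  have hb : 176 / η ^ 2 * δ ≤ 1 / (2500 * H ^ 4) := by
    calc 176 / η ^ 2 * δ = 176 * (1 / η ^ 2) * δ := by ring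
      _ ≤ 176 * (H / 100) * (1 / (5000 * H ^ 5)) := by gcongr
      _ ≤ 1 / (2500 * H ^ 4) := by
          rw [← sub_nonneg]
          have : 1 / (2500 * H ^ 4) - 176 * (H / 100) * (1 / (5000 * H ^ 5)) =
            24 / (500000 * H ^ 4) := by field_simp; norm_num
          rw [this]; positivity
  have hquad := h.sum_inner_sq_le (by omega) hη (y := y) (b := 176 / η ^ 2 * δ) (by positivity) hcov
  have hsq : ∀ j, ∑ i, p * (spatialSign (y i) j) ^ 2 ≤ n * (13 / η ^ 2) := by
    intro j
    have h1 := (abs_le.1 (hcov j j)).2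
    have h2 : ∫ x, (p : ℝ) * (spatialSign x j * spatialSign x j) ∂L ≤ 12 / η ^ 2 := by
      have := h.integral_inner_sq_le (by omega) hη (EuclideanSpace.single j 1)
      simp only [EuclideanSpace.inner_single_left, map_one, one_mul, PiLp.norm_single,
        norm_one, one_pow, mul_one] at this
      rw [integral_const_mul]
      simp_rw [← sq]
      calc _ ≤ p * (12 / (η ^ 2 * p)) := by gcongr
        _ = _ := by field_simp
    have h3 : 176 / η ^ 2 * δ ≤ 1 / η ^ 2 := by
      have : δ ≤ 1 / 5000 := by
        refine hδ5.trans ?_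
        gcongr
        nlinarith [one_le_pow₀ (n := 5) hH1]
      calc 176 / η ^ 2 * δ ≤ 176 / η ^ 2 * (1 / 5000) := by gcongr
        _ = 176 / 5000 * (1 / η ^ 2) := by ring
        _ ≤ 1 * (1 / η ^ 2) := by gcongr; norm_num
        _ = _ := one_mul _
    have h4 : ∑ i, p * (spatialSign (y i) j) ^ 2 ≤ n * (12 / η ^ 2) + n * (1 / η ^ 2) := by
      simp_rw [← sq] at h1 h2
      have h5 := mul_le_mul_of_nonneg_left h2 hn'.le
      have h6 := mul_le_mul_of_nonneg_left h3 hn'.le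
      linarith
    refine h4.trans (le_of_eq ?_)
    ring
  have hℓ : √(n : ℝ) * δ = √(Real.log p) := by
    rw [← hl, Real.sqrt_mul hn'.le, Real.sqrt_sq hδ]
  have hℓ1 : 1 ≤ Real.log p := by
    rw [Real.le_log_iff_exp_le hp']
    have : (3 : ℝ) ≤ p := by exact_mod_cast hp
    linarith [Real.exp_one_lt_d9]
  constructor
  · exact h0
  · intro j
    refine (hsign j).trans ?_
    gcongr
    exact hH.eta_le
  · intro j
    refine (hsq j).trans ?_
    rw [mul_comm]
    gcongr
    calc 13 / η ^ 2 = 13 * (1 / η ^ 2) := by ring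
      _ ≤ H := by linarith
  · refine hnorm.trans ?_
    gcongr
    refine le_trans ?_ hH.eta_le
    gcongr
    norm_num
  · refine hinv.trans ?_
    gcongr
    exact hH.s_le
  · rw [div_le_iff₀ (by positivity)] at hcard
    refine hcard.trans ?_
    rw [mul_comm]
    gcongr
    exact hH.zeta_le
  · intro a
    refine (hquad a).trans ?_
    rw [mul_div_assoc, mul_assoc]
    -- The population part is small because `H² ≤ p`, the fluctuation because `δ` is at most `1 /
    -- (5000 H⁵)`.
    have h1 : 12 / (η ^ 2 * p) + 176 / η ^ 2 * δ ≤ 1 / (2 * H) := by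
      have h2 : 12 / (η ^ 2 * p) ≤ 12 / (100 * H) := by
        calc 12 / (η ^ 2 * p) = 12 * (1 / η ^ 2) / p := by field_simp
          _ ≤ 12 * (H / 100) / H ^ 2 := by gcongr
          _ = _ := by field_simp
      have h3 : 1 / (2500 * H ^ 4) ≤ 1 / (2500 * H) := by
        gcongr
        exact le_self_pow₀ hH1 (by norm_num)
      have h4 : 1 / (2 * H) - (12 / (100 * H) + 1 / (2500 * H)) = 949 / (2500 * H) := by
        field_simp; norm_num
      have h5 : 0 < 949 / (2500 * H) := by positivity
      linarith
    calc (n : ℝ) * (‖a‖ ^ 2 * (12 / (η ^ 2 * p) + 176 / η ^ 2 * δ)) ≤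
        n * (‖a‖ ^ 2 * (1 / (2 * H))) := by gcongr
      _ = _ := by ring
  · intro i
    set ν := (z * ‖y i‖)⁻¹ with hν
    have hν0 : 0 ≤ ν := by positivity
    apply Real.le_sqrt_of_sq_le
    have h1 : ν ^ 2 ≤ n / (1024 * H ^ 4) := by
      have h2 := hH.s_le
      rw [div_le_iff₀ hs] at h2
      have h3 := hsep i
      rw [← hν, le_div_iff₀ (by positivity)] at h3
      rw [le_div_iff₀ (by positivity)]
      have h4 : 2 * (ν ^ 2 * (512 * H ^ 4)) ≤ H * s * (ν ^ 2 * (512 * H ^ 4)) := by gcongr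
      linarith
    rw [le_div_iff₀ (by positivity)] at h1
    linarith
  · intro j
    have h1 : ∀ i, (z * ‖y i‖)⁻¹ * (p * (spatialSign (y i) j) ^ 2) ≤
        √(24 / s) * (√n * δ) * (p * (spatialSign (y i) j) ^ 2) +
        1 / (p : ℝ) ^ 6 * ((z * ‖y i‖)⁻¹ * (p * (spatialSign (y i) j) ^ 2) *
        Real.exp (s * ((z * ‖y i‖)⁻¹) ^ 2 / 4)) := by
      intro i
      set ν := (z * ‖y i‖)⁻¹ with hν
      have hν0 : 0 ≤ ν := by positivity
      set w := (p : ℝ) * (spatialSign (y i) j) ^ 2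
      have hw0 : 0 ≤ w := by positivity
      -- Below the threshold `ν` is at most `√(24 / s) √n δ`, since `√n δ = √(log p)`; above it the
      -- exponential weight is at least `p⁶`.
      rcases le_total (ν ^ 2) (24 / s * Real.log p) with h2 | h2
      · have h3 : ν ≤ √(24 / s) * (√n * δ) := by
          rw [hℓ, ← Real.sqrt_mul (by positivity)]
          exact Real.le_sqrt_of_sq_le h2
        have h4 : 0 ≤ 1 / (p : ℝ) ^ 6 * (ν * w * Real.exp (s * ν ^ 2 / 4)) := by positivity
        have h5 := mul_le_mul_of_nonneg_right h3 hw0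
        linarith
      · have h3 : 6 * Real.log p ≤ s * ν ^ 2 / 4 := by
          have := mul_le_mul_of_nonneg_left h2 hs.le
          have h6 : s * (24 / s * Real.log p) = 24 * Real.log p := by field_simp
          linarith
        have h4 : (p : ℝ) ^ 6 ≤ Real.exp (s * ν ^ 2 / 4) := by
          refine le_trans (le_of_eq ?_) (Real.exp_le_exp.2 h3)
          have := Real.exp_nat_mul (Real.log p) 6
          push_cast at this
          rw [this, Real.exp_log hp']
        have h5 : ν * w ≤ 1 / (p : ℝ) ^ 6 * (ν * w * Real.exp (s * ν ^ 2 / 4)) := by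
          rw [one_div_mul_eq_div, le_div_iff₀ (by positivity)]
          gcongr
        have h6 : 0 ≤ √(24 / s) * (√n * δ) * w := by positivity
        linarith
    have hr : 1 ≤ √(n : ℝ) * δ := by rw [hℓ]; exact Real.one_le_sqrt.2 hℓ1
    calc _ ≤ ∑ i, (√(24 / s) * (√n * δ) * (p * (spatialSign (y i) j) ^ 2) +
        1 / (p : ℝ) ^ 6 * ((z * ‖y i‖)⁻¹ * (p * (spatialSign (y i) j) ^ 2) *
        Real.exp (s * ((z * ‖y i‖)⁻¹) ^ 2 / 4))) := Finset.sum_le_sum fun i _ => h1 i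
      _ ≤ √(24 / s) * (√n * δ) * (n * (13 / η ^ 2)) + n := by
          rw [Finset.sum_add_distrib, ← Finset.mul_sum]
          have := hsq j
          refine add_le_add ?_ (hw j)
          gcongr
      _ ≤ √(24 / s) * (√n * δ) * (n * (13 / η ^ 2)) + n * (√n * δ) := by nlinarith
      _ = (√(24 / s) * (13 / η ^ 2) + 1) * (n * (√n * δ)) := by ring
      _ ≤ H * (n * (√n * δ)) := by gcongr; exact hH.mixed_le
      _ = _ := by ring

omit [IsProbabilityMeasure L] in
theorem SignRadiusLaw.abs_sampleSignCov_zero_sub_le (h : SignRadiusLaw L Sig η ζ s z)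
    (hn : 0 < n) {H δ : ℝ} (hH : 100 / η ^ 2 ≤ H) (hδ : 0 ≤ δ)
    {y : Fin n → EuclideanSpace ℝ (Fin p)}
    (hcov : ∀ j k, |∑ i, (p : ℝ) * (spatialSign (y i) j * spatialSign (y i) k) -
        n * ∫ x, (p : ℝ) * (spatialSign x j * spatialSign x k) ∂L| ≤ n * (176 / η ^ 2 * δ))
    (j k : Fin p) :
    |p * sampleSignCov y 0 j k - p * Sig j k / Sig.trace| ≤ 2 * H * δ + 320 / η ^ 4 / √p := by
  have hn' : (0 : ℝ) < n := by exact_mod_cast hn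
  have h1 : p * sampleSignCov y 0 j k =
      (n : ℝ)⁻¹ * ∑ i, (p : ℝ) * (spatialSign (y i) j * spatialSign (y i) k) := by
    rw [← Finset.mul_sum]
    simp only [sampleSignCov, Matrix.smul_apply, Matrix.sum_apply, signOuter, Matrix.of_apply,
      sub_zero, smul_eq_mul]
    ring
  set I := ∫ x, (p : ℝ) * (spatialSign x j * spatialSign x k) ∂L
  set A := ∑ i, (p : ℝ) * (spatialSign (y i) j * spatialSign (y i) k)
  have h2 : |(n : ℝ)⁻¹ * A - I| ≤ 2 * H * δ := by
    have h3 : (n : ℝ)⁻¹ * A - I = (n : ℝ)⁻¹ * (A - n * I) := by field_simp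
    rw [h3, abs_mul, abs_of_pos (inv_pos.2 hn')]
    calc _ ≤ (n : ℝ)⁻¹ * (n * (176 / η ^ 2 * δ)) := by gcongr; exact hcov j k
      _ = 1.76 * (100 / η ^ 2) * δ := by
        rw [inv_mul_cancel_left₀ hn'.ne']; ring
      _ ≤ 1.76 * H * δ := by gcongr
      _ ≤ _ := by
        have : 0 ≤ 100 / η ^ 2 := by positivity
        gcongr ?_ * _ * _
        · linarith
        · norm_num
  rw [h1]
  calc _ = |((n : ℝ)⁻¹ * A - I) + (I - p * Sig j k / Sig.trace)| := by congr 1; ring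
    _ ≤ _ := (abs_add_le _ _).trans (add_le_add h2 (h.cov j k))

theorem SignRadiusLaw.measure_not_regularSample_le (h : SignRadiusLaw L Sig η ζ s z) {H δ : ℝ}
    (hp : 3 ≤ p) (hη : 0 < η) (hs : 0 < s) (hζ : 0 < ζ) (hn : 0 < n)
    (hH : DominatingConst H η ζ s) (hpH : H ^ 2 ≤ p)
    (hpw : 128 / η ^ 4 + 2 / s ≤ p) (hpe : Real.exp (-(p / 2)) ≤ 1 / (p : ℝ) ^ 4)
    (hne : n * (2 * Real.exp (-(n / (1024 * H ^ 5)))) ≤ 1)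
    (hδ : 0 ≤ δ) (hδH : 5000 * H ^ 5 * δ ≤ 1) (hl : n * δ ^ 2 = Real.log p) :
    (Measure.pi fun _ : Fin n => L) {y | ¬ (RegularSample y z H δ ∧
      ∀ j k, |p * sampleSignCov y 0 j k - p * Sig j k / Sig.trace| ≤
        2 * H * δ + 320 / η ^ 4 / √p)} ≤ ENNReal.ofReal (1 / (p : ℝ) ^ 2) := by
  have hp0 : 0 < p := by omega
  have hp' : (0 : ℝ) < p := by exact_mod_cast hp0
  have hn' : (0 : ℝ) < n := by exact_mod_cast hn
  have hH1 := hH.one_le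
  have hH0 : 0 < H := by linarith
  have hδ5 : δ ≤ 1 / (5000 * H ^ 5) := by rw [le_div_iff₀ (by positivity)]; linarith
  have hH5 : (1 : ℝ) ≤ H ^ 5 := one_le_pow₀ hH1
  have hδ1 : δ ≤ 1 / 2 := by
    refine hδ5.trans ?_
    gcongr
    linarith
  -- Smallness of `δ` gives `4 log p = 4 n δ² ≤ n / (1024 H⁵)`, so bounds exponential in `n` become
  -- `p⁻⁴`.
  have hlog : ∀ t : ℝ, n / (1024 * H ^ 5) ≤ t → Real.exp (-t) ≤ 1 / (p : ℝ) ^ 4 := by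
    intro t ht
    rw [← exp_neg_mul_log hp0 4, Real.exp_le_exp, neg_le_neg_iff, ← hl]
    refine le_trans ?_ ht
    rw [le_div_iff₀ (by positivity)]
    push_cast
    have h1 : δ ^ 2 ≤ 1 / 2 * (1 / (5000 * H ^ 5)) := by rw [sq]; gcongr
    calc (4 : ℝ) * ((n : ℝ) * δ ^ 2) * (1024 * H ^ 5) ≤
        4 * ((n : ℝ) * (1 / 2 * (1 / (5000 * H ^ 5)))) * (1024 * H ^ 5) := by gcongr
      _ = (n : ℝ) * (2048 / 5000) := by field_simp; norm_num
      _ ≤ _ := by linarith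
  have hB0 := h.measure_exists_eq_zero (n := n)
  have hB1 := h.measure_cov_le hp0 hη hδ hδ1 hl
  have hB2 := h.measure_sign_le hp0 hη hδ hl
  have hB3 := (h.measure_norm_sum_le hp0 hη hn).trans (ENNReal.ofReal_le_ofReal hpe)
  have hB4 := (h.measure_inv_sq_le (n := n) hs).trans (ENNReal.ofReal_le_ofReal
    (hlog n (by rw [div_le_iff₀ (by positivity)]; nlinarith)))
  -- Half of the exponent pays for the factor `2 n` of the union over observations, the other half
  -- gives `p⁻⁴`.
  have hB5 := (h.measure_exists_inv_le (n := n) (n / (512 * H ^ 5))).trans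
    (ENNReal.ofReal_le_ofReal (q := 1 / (p : ℝ) ^ 4) (by
      have e : -((n : ℝ) / (512 * H ^ 5)) = -(n / (1024 * H ^ 5)) + -(n / (1024 * H ^ 5)) := by
        field_simp; norm_num
      rw [e, Real.exp_add]
      have := hlog _ le_rfl
      calc _ = n * (2 * Real.exp (-(n / (1024 * H ^ 5)))) * Real.exp (-(n / (1024 * H ^ 5))) := by
            ring
        _ ≤ 1 * (1 / (p : ℝ) ^ 4) := by gcongr
        _ = _ := one_mul _))
  have hB6 := (h.measure_card_le (n := n) hζ).trans (ENNReal.ofReal_le_ofReal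
    (hlog (n / (40 * ζ)) (by
      gcongr n / ?_
      have := hH.zeta_le
      have : H ≤ H ^ 5 := le_self_pow₀ hH1 (by norm_num)
      linarith)))
  have hB7 := (h.measure_weighted_le hp0 hη hs hn).trans (ENNReal.ofReal_le_ofReal
    (q := 1 / (p : ℝ) ^ 4) (by
      rw [div_le_div_iff₀ (by positivity) (by positivity)]
      calc _ ≤ (p : ℝ) * (p : ℝ) ^ 4 := by gcongr
        _ = _ := by ring))
  -- In total `9 / p⁴`, at most `1 / p²` because `p ≥ 3`.
  have hsum : ENNReal.ofReal (2 / (p : ℝ) ^ 4) + (ENNReal.ofReal (2 / (p : ℝ) ^ 4) +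
      (ENNReal.ofReal (1 / (p : ℝ) ^ 4) + (ENNReal.ofReal (1 / (p : ℝ) ^ 4) +
      (ENNReal.ofReal (1 / (p : ℝ) ^ 4) + (ENNReal.ofReal (1 / (p : ℝ) ^ 4) +
      ENNReal.ofReal (1 / (p : ℝ) ^ 4)))))) ≤ ENNReal.ofReal (1 / (p : ℝ) ^ 2) := by
    repeat rw [← ENNReal.ofReal_add (by positivity) (by positivity)]
    apply ENNReal.ofReal_le_ofReal
    have h9 : (9 : ℝ) ≤ (p : ℝ) ^ 2 := by
      have : (3 : ℝ) ≤ p := by exact_mod_cast hp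
      nlinarith
    have h10 : 1 / (p : ℝ) ^ 2 = (p : ℝ) ^ 2 / (p : ℝ) ^ 4 := by field_simp
    rw [h10]
    calc _ = 9 / (p : ℝ) ^ 4 := by ring
      _ ≤ _ := by gcongr
  refine le_trans ?_ ((zero_add _).le.trans hsum)
  refine le_trans ?_ (add_le_add hB0.le (add_le_add hB1 (add_le_add hB2 (add_le_add hB3 (add_le_add hB4
    (add_le_add hB5 (add_le_add hB6 hB7)))))))
  refine le_trans (measure_mono fun y hy => ?_) ((measure_union_le _ _).trans (add_le_add le_rfl
    ((measure_union_le _ _).trans (add_le_add le_rfl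
    ((measure_union_le _ _).trans (add_le_add le_rfl
    ((measure_union_le _ _).trans (add_le_add le_rfl
    ((measure_union_le _ _).trans (add_le_add le_rfl
    ((measure_union_le _ _).trans (add_le_add le_rfl (measure_union_le _ _)))))))))))))
  by_contra hc
  simp only [Set.mem_union, not_or, Set.mem_ofPred_eq, not_exists, not_le] at hc
  obtain ⟨c0, c1, c2, c3, c4, c5, c6, c7⟩ := hc
  exact hy ⟨h.regularSample hp hη hs hn hH hpH hδ hδH hl c0 (fun j k => (c1 j k).le)
    (fun j => (c2 j).le) c3.le c4.le (fun i => (c5 i).le) c6.le hζ (fun j => (c7 j).le),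
    h.abs_sampleSignCov_zero_sub_le hn hH.eta_sq_le hδ (fun j k => (c1 j k).le)⟩

end OneClass

/-! ### Elliptical laws satisfying the assumptions -/

section SubGaussian
variable {α : Type*} [MeasurableSpace α]

theorem lintegral_even_pow_le_of_psi2Norm_le {μ : Measure α} {f : α → ℝ} {K : ℝ} (hK : 0 ≤ K)
    (h : psi2Norm f μ ≤ ENNReal.ofReal K) {k : ℕ} (hk : k ≠ 0) :
    ∫⁻ x, ENNReal.ofReal (f x ^ (2 * k)) ∂μ ≤ ENNReal.ofReal ((2 * k * K ^ 2) ^ k) := by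
  have hk0 : (0 : ℝ) < k := by exact_mod_cast Nat.pos_of_ne_zero hk
  have h1 : ENNReal.ofReal (((2 * k : ℕ) : ℝ) ^ (-(1 / 2) : ℝ)) *
      eLpNorm f ((2 * k : ℕ) : ℝ≥0∞) μ ≤ ENNReal.ofReal K :=
    (le_iSup₂ (f := fun (k : ℕ) (_ : 1 ≤ k) => ENNReal.ofReal ((k : ℝ) ^ (-(1 / 2) : ℝ)) *
      eLpNorm f (k : ℝ≥0∞) μ) (2 * k) (by omega)).trans h
  have h2 : ∫⁻ x, ENNReal.ofReal (f x ^ (2 * k)) ∂μ =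
      eLpNorm f ((2 * k : ℕ) : ℝ≥0∞) μ ^ (2 * k) := by
    have := eLpNorm_nnreal_pow_eq_lintegral (μ := μ) (f := f) (p := ((2 * k : ℕ) : NNReal))
      (by positivity)
    simp only [NNReal.coe_natCast, ENNReal.rpow_natCast, ENNReal.coe_natCast] at this
    rw [this]
    refine lintegral_congr fun x => ?_
    rw [← ofReal_norm, ← ENNReal.ofReal_pow (norm_nonneg _), Real.norm_eq_abs,
      (even_two_mul k).pow_abs]
  have h3 : (ENNReal.ofReal (((2 * k : ℕ) : ℝ) ^ (-(1 / 2) : ℝ))) ^ (2 * k) =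
      ENNReal.ofReal (((2 * k : ℝ) ^ k)⁻¹) := by
    rw [← ENNReal.ofReal_pow (by positivity)]
    congr 1
    rw [← Real.rpow_natCast, ← Real.rpow_mul (by positivity)]
    push_cast
    rw [← Real.rpow_natCast, ← Real.rpow_neg (by positivity)]
    congr 1
    ring
  have h4 := pow_le_pow_left' h1 (2 * k)
  rw [mul_pow, h3, ← h2, ← ENNReal.ofReal_pow hK] at h4
  have h5 : (0 : ℝ) < (2 * k : ℝ) ^ k := by positivity
  calc _ = ENNReal.ofReal ((2 * k : ℝ) ^ k) * (ENNReal.ofReal (((2 * k : ℝ) ^ k)⁻¹) *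
        ∫⁻ x, ENNReal.ofReal (f x ^ (2 * k)) ∂μ) := by
        rw [← mul_assoc, ← ENNReal.ofReal_mul h5.le, mul_inv_cancel₀ h5.ne']
        simp
    _ ≤ ENNReal.ofReal ((2 * k : ℝ) ^ k) * ENNReal.ofReal (K ^ (2 * k)) := by gcongr
    _ = _ := by
        rw [← ENNReal.ofReal_mul h5.le]
        congr 1
        rw [mul_pow, mul_pow, mul_pow, ← pow_mul]

/-- Expand the exponential and use the even moments. With `s = 1 / (12 K²)` the term of order `k` is
at most `6⁻ᵏ kᵏ / k!`, hence at most `(e / 6)ᵏ ≤ 2⁻ᵏ`, and the geometric series sums to `2`. -/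
theorem lintegral_exp_sq_le_of_psi2Norm_le {μ : Measure α} [IsProbabilityMeasure μ] {f : α → ℝ}
    (hf : Measurable f) {K : ℝ} (hK : 0 < K) (h : psi2Norm f μ ≤ ENNReal.ofReal K) :
    ∫⁻ x, ENNReal.ofReal (Real.exp (1 / (12 * K ^ 2) * f x ^ 2)) ∂μ ≤ 2 := by
  set s := 1 / (12 * K ^ 2) with hs
  have hs0 : 0 < s := by positivity
  have h1 : ∀ x, ENNReal.ofReal (Real.exp (s * f x ^ 2)) =
      ∑' k : ℕ, ENNReal.ofReal (s ^ k / k.factorial) * ENNReal.ofReal (f x ^ (2 * k)) := by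
    intro x
    have hh := NormedSpace.expSeries_div_hasSum_exp (s * f x ^ 2)
    rw [← Real.exp_eq_exp_ℝ] at hh
    rw [← hh.tsum_eq, ENNReal.ofReal_tsum_of_nonneg (fun k => by positivity) hh.summable]
    refine tsum_congr fun k => ?_
    rw [← ENNReal.ofReal_mul (by positivity)]
    congr 1
    rw [mul_pow, ← pow_mul]
    ring
  simp_rw [h1]
  rw [lintegral_tsum fun k => by fun_prop]
  have h2 : ∀ k : ℕ, ∫⁻ x, ENNReal.ofReal (s ^ k / k.factorial) * ENNReal.ofReal (f x ^ (2 * k)) ∂μ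
      ≤ 2⁻¹ ^ k := by
    intro k
    rw [lintegral_const_mul _ (by fun_prop)]
    rcases eq_or_ne k 0 with rfl | hk
    · simp
    refine (mul_le_mul_right (lintegral_even_pow_le_of_psi2Norm_le hK.le h hk) _).trans ?_
    rw [← ENNReal.ofReal_mul (by positivity)]
    have e1 : (2⁻¹ : ℝ≥0∞) ^ k = ENNReal.ofReal ((1 / 2) ^ k) := by
      rw [ENNReal.ofReal_pow (by norm_num), one_div, ENNReal.ofReal_inv_of_pos (by norm_num)]
      simp
    rw [e1]
    apply ENNReal.ofReal_le_ofReal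
    have e2 : s ^ k / k.factorial * (2 * k * K ^ 2) ^ k = (1 / 6) ^ k * ((k : ℝ) ^ k / k.factorial) := by
      have e3 : s * (2 * k * K ^ 2) = 1 / 6 * k := by rw [hs]; field_simp; norm_num
      calc _ = (s * (2 * k * K ^ 2)) ^ k / k.factorial := by
            rw [mul_pow s]; ring
        _ = _ := by rw [e3, mul_pow]; ring
    rw [e2]
    have e3 := Real.pow_div_factorial_le_exp k (Nat.cast_nonneg k) k
    have e4 : Real.exp k = Real.exp 1 ^ k := by rw [← Real.exp_nat_mul, mul_one]
    rw [e4] at e3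
    calc (1 / 6 : ℝ) ^ k * ((k : ℝ) ^ k / k.factorial) ≤ (1 / 6) ^ k * Real.exp 1 ^ k := by gcongr
      _ = (1 / 6 * Real.exp 1) ^ k := by rw [mul_pow]
      _ ≤ _ := by
          gcongr
          linarith [Real.exp_one_lt_d9]
  exact (ENNReal.tsum_le_tsum h2).trans ENNReal.tsum_geometric_two.le

end SubGaussian

/-! ### The elliptical model supplies the concentration hypotheses -/

section Model
variable {p : ℕ} {Sig : Matrix (Fin p) (Fin p) ℝ} {rho : Measure ℝ}
  {m : EuclideanSpace ℝ (Fin p)} {η ζ ψ Kν : ℝ}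

theorem isProbabilityMeasure_ellipticalLaw (hp : 0 < p) (m : EuclideanSpace ℝ (Fin p))
    (Sig : Matrix (Fin p) (Fin p) ℝ) (rho : Measure ℝ) [IsProbabilityMeasure rho] :
    IsProbabilityMeasure (ellipticalLaw m Sig rho) := by
  have := isProbabilityMeasure_sphereUniform hp
  rw [ellipticalLaw_eq]
  exact Measure.isProbabilityMeasure_map (measurable_elliptical m Sig).aemeasurable

theorem invMoment_ellipticalLaw (m : EuclideanSpace ℝ (Fin p)) (Sig : Matrix (Fin p) (Fin p) ℝ)
    (rho : Measure ℝ) (k : ℕ) :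
    invMoment (ellipticalLaw m Sig rho) m k = ∫ x, (‖x‖⁻¹) ^ k ∂(ellipticalLaw 0 Sig rho) := by
  rw [← ellipticalLaw_map_sub m, integral_map (by fun_prop)
    (Measurable.aestronglyMeasurable (by fun_prop))]
  rfl

theorem zetaOne_eq (Sig : Matrix (Fin p) (Fin p) ℝ) (rho : Measure ℝ) :
    zetaOne Sig rho = ∫ x, ‖x‖⁻¹ ∂(ellipticalLaw 0 Sig rho) := by
  rw [zetaOne, invMoment_ellipticalLaw]
  simp

theorem RadiusAssumptions.ae_ne_zero (h : RadiusAssumptions (ellipticalLaw m Sig rho) m ζ ψ Kν) :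
    ∀ᵐ x ∂(ellipticalLaw 0 Sig rho), x ≠ 0 := by
  rw [← ellipticalLaw_map_sub m]
  refine (ae_map_iff (p := fun x => x ≠ 0) (by fun_prop) (measurableSet_singleton _).compl).2 ?_
  filter_upwards [h.ne_center] with x hx
  exact sub_ne_zero.2 hx

theorem RadiusAssumptions.integrable_pow
    (h : RadiusAssumptions (ellipticalLaw m Sig rho) m ζ ψ Kν) {k : ℕ} (hk : k ∈ Finset.Icc 1 4) :
    Integrable (fun x => (‖x‖⁻¹) ^ k) (ellipticalLaw 0 Sig rho) := by
  rw [← ellipticalLaw_map_sub m, integrable_map_measure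
    (Measurable.aestronglyMeasurable (by fun_prop)) (by fun_prop)]
  exact h.integrable k hk

theorem RadiusAssumptions.psi2Norm_le
    (h : RadiusAssumptions (ellipticalLaw m Sig rho) m ζ ψ Kν) :
    psi2Norm (fun x => (zetaOne Sig rho * ‖x‖)⁻¹) (ellipticalLaw 0 Sig rho) ≤
      ENNReal.ofReal Kν := by
  refine le_trans (le_of_eq ?_) h.subGaussian
  unfold psi2Norm
  rw [← ellipticalLaw_map_sub m]
  refine iSup_congr fun k => iSup_congr fun _ => ?_
  rw [eLpNorm_map_measure (Measurable.aestronglyMeasurable (by fun_prop)) (by fun_prop)]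
  congr 2
  ext x
  rw [zetaOne, invMoment_ellipticalLaw, invMoment_ellipticalLaw]
  simp [mul_comm]

/-- The inverse is a convex function of `t²`; this is its tangent at `R²`. It bounds a negative
moment below by the second moment. -/
theorem inv_ge_of_sq {t R : ℝ} (ht : 0 < t) (hR : 0 < R) :
    3 / (2 * R) - t ^ 2 / (2 * R ^ 3) ≤ t⁻¹ := by
  rw [← sub_nonneg]
  have : t⁻¹ - (3 / (2 * R) - t ^ 2 / (2 * R ^ 3)) =
      (t - R) ^ 2 * (t + 2 * R) / (2 * R ^ 3 * t) := by
    field_simp; ring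
  rw [this]
  positivity

/-- The inverse radius of an elliptical law is at least of order `p ^ (-1/2)`. -/
theorem sqrt_div_le_zetaOne (hp : 0 < p) [IsProbabilityMeasure rho] (h : Sig.PosDef) (hη : 0 < η)
    (h2 : ∀ i, h.isHermitian.eigenvalues i ≤ 1 / η) (hi : Integrable (fun r : ℝ => r ^ 2) rho)
    (hr : ∫ r, r ^ 2 ∂rho = p) (h0 : ∀ᵐ x ∂(ellipticalLaw 0 Sig rho), x ≠ 0)
    (hint : Integrable (fun x => ‖x‖⁻¹) (ellipticalLaw 0 Sig rho)) :
    √(η / p) ≤ zetaOne Sig rho := by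
  have := isProbabilityMeasure_sphereUniform hp
  have hp' : (0 : ℝ) < p := by exact_mod_cast hp
  have hm := (measurable_elliptical (0 : EuclideanSpace ℝ (Fin p)) Sig)
  -- `R² = p / η` bounds the second moment of the norm, so the tangent bound has mean at least `3 /
  -- (2 R) - 1 / (2 R) = 1 / R`.
  set R := √(p / η) with hR
  have hR0 : 0 < R := by positivity
  have hR2 : R ^ 2 = p / η := Real.sq_sqrt (by positivity)
  have e1 : √(η / p) = R⁻¹ := by rw [hR, ← Real.sqrt_inv, inv_div]
  rw [ellipticalLaw_eq] at h0
  replace h0 := (ae_map_iff (p := fun x => x ≠ 0) hm.aemeasurable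
    (measurableSet_singleton _).compl).1 h0
  rw [ellipticalLaw_eq, integrable_map_measure (Measurable.aestronglyMeasurable (by fun_prop))
    hm.aemeasurable] at hint
  rw [zetaOne_eq, ellipticalLaw_eq, integral_map hm.aemeasurable
    (Measurable.aestronglyMeasurable (by fun_prop)), e1]
  have i1 : Integrable (fun z : ℝ × EuclideanSpace ℝ (Fin p) => z.1 ^ 2 / (η * (2 * R ^ 3)))
      (rho.prod (sphereUniform p)) := (hi.comp_fst (sphereUniform p)).div_const _
  have hu : ∀ᵐ z ∂(rho.prod (sphereUniform p)), ‖z.2‖ = 1 :=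
    Measure.quasiMeasurePreserving_snd.ae ae_norm_eq_one_sphereUniform
  have h3 : ∫ z, (3 / (2 * R) - z.1 ^ 2 / (η * (2 * R ^ 3))) ∂(rho.prod (sphereUniform p)) ≤
      ∫ z, ‖(0 : EuclideanSpace ℝ (Fin p)) + z.1 • scatterRoot Sig z.2‖⁻¹
        ∂(rho.prod (sphereUniform p)) := by
    refine integral_mono_ae ((integrable_const _).sub i1) hint ?_
    filter_upwards [h0, hu] with z hz hz1
    have ht : 0 < ‖(0 : EuclideanSpace ℝ (Fin p)) + z.1 • scatterRoot Sig z.2‖ := norm_pos_iff.2 hz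
    refine le_trans ?_ (inv_ge_of_sq ht hR0)
    have h4 : ‖(0 : EuclideanSpace ℝ (Fin p)) + z.1 • scatterRoot Sig z.2‖ ^ 2 ≤ z.1 ^ 2 / η := by
      have := sq_norm_scatterRoot_le h h2 z.2
      rw [zero_add, norm_smul, mul_pow, Real.norm_eq_abs, sq_abs]
      rw [hz1, one_pow, mul_one] at this
      calc _ ≤ z.1 ^ 2 * (1 / η) := by gcongr
        _ = _ := by ring
    have h5 : z.1 ^ 2 / (η * (2 * R ^ 3)) = z.1 ^ 2 / η / (2 * R ^ 3) := by rw [div_div]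
    rw [h5]
    gcongr
  refine le_trans (le_of_eq ?_) h3
  rw [integral_sub (integrable_const _) i1,
    integral_fun_fst (fun r : ℝ => r ^ 2 / (η * (2 * R ^ 3))), integral_div _ (fun r : ℝ => r ^ 2),
    hr]
  simp only [integral_const, probReal_univ, one_smul]
  have h6 : (p : ℝ) / (η * (2 * R ^ 3)) = 1 / (2 * R) := by
    have : (p : ℝ) = R ^ 2 * η := by rw [hR2]; field_simp
    rw [this]; field_simp
  rw [h6]
  field_simp
  norm_num

theorem signRadiusLaw_ellipticalLaw (hp : 2 ≤ p) [IsProbabilityMeasure rho] (h : Sig.PosDef)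
    (hη : 0 < η) (h1 : ∀ i, η ≤ h.isHermitian.eigenvalues i)
    (h2 : ∀ i, h.isHermitian.eigenvalues i ≤ 1 / η) (hi : Integrable (fun r : ℝ => r ^ 2) rho)
    (hr : ∫ r, r ^ 2 ∂rho = p) (hK : 0 < Kν)
    (hR : RadiusAssumptions (ellipticalLaw m Sig rho) m ζ ψ Kν) :
    SignRadiusLaw (ellipticalLaw 0 Sig rho) Sig η ζ (1 / (12 * Kν ^ 2)) (zetaOne Sig rho) := by
  have hp0 : 0 < p := by omega
  have hp' : (0 : ℝ) < p := by exact_mod_cast hp0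
  have := isProbabilityMeasure_ellipticalLaw hp0 0 Sig rho
  have h0 := hR.ae_ne_zero
  have hint : Integrable (fun x => ‖x‖⁻¹) (ellipticalLaw 0 Sig rho) := by
    simpa using hR.integrable_pow (k := 1) (by simp)
  have hint2 := hR.integrable_pow (k := 2) (by simp)
  have hz : 0 < zetaOne Sig rho :=
    lt_of_lt_of_le (by positivity) (sqrt_div_le_zetaOne hp0 h hη h2 hi hr h0 hint)
  have hmap := ellipticalLaw_map_spatialSign hp0 Sig rho h0
  refine ⟨h0, hz, fun a => ?_, fun j k => ?_, ?_, ?_, ?_, ?_, ?_⟩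
  · refine le_trans (le_of_eq ?_) (lintegral_exp_inner_spatialSign_le hp h hη h1 h2 a)
    have e1 := lintegral_map (μ := ellipticalLaw 0 Sig rho)
      (f := fun v : EuclideanSpace ℝ (Fin p) => ENNReal.ofReal (Real.exp (inner ℝ a v)))
      (by fun_prop) measurable_spatialSign
    rw [← e1, hmap, lintegral_map (by fun_prop) (by fun_prop)]
  · refine le_trans (le_of_eq ?_) (abs_integral_sign_mul_sign_sub_le hp h hη h1 h2 j k)
    have e1 := integral_map (μ := ellipticalLaw 0 Sig rho) measurable_spatialSign.aemeasurable
      (f := fun v : EuclideanSpace ℝ (Fin p) => (p : ℝ) * (v j * v k))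
      (Measurable.aestronglyMeasurable (by fun_prop))
    rw [← e1, hmap, integral_map (by fun_prop) (Measurable.aestronglyMeasurable (by fun_prop))]
  · simp_rw [mul_inv]
    exact hint.const_mul _
  · simp_rw [mul_inv]
    rw [integral_const_mul, ← zetaOne_eq, inv_mul_cancel₀ hz.ne']
  · simp_rw [mul_inv, mul_pow]
    exact hint2.const_mul _
  · simp_rw [mul_inv, mul_pow]
    have := hR.moment_ratio 2 (by simp)
    rw [integral_const_mul]
    rw [invMoment_ellipticalLaw, invMoment_ellipticalLaw] at this
    simp only [pow_one] at this
    rw [← zetaOne_eq] at this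
    rw [inv_pow, mul_comm]
    exact this.le
  · exact lintegral_exp_sq_le_of_psi2Norm_le (by fun_prop) hK hR.psi2Norm_le

end Model

/-! ### From regular samples to the direction error -/

section Accurate
variable {p n n₀ n₁ : ℕ} {Sig : Matrix (Fin p) (Fin p) ℝ}

/-- Every spatial median of the sample is within `b` of `m` in each coordinate, and the sign
covariance matrix centred at it is within `e` of the shape matrix in each entry. -/
def AccurateSample (x : Fin n → EuclideanSpace ℝ (Fin p)) (m : EuclideanSpace ℝ (Fin p))
    (Sig : Matrix (Fin p) (Fin p) ℝ) (b e : ℝ) : Prop :=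
  ∀ a, IsSpatialMedian x a → (∀ j, |a j - m j| ≤ b) ∧
    ∀ j k, |p * sampleSignCov x a j k - p * Sig j k / Sig.trace| ≤ e

theorem AccurateSample.mono {x : Fin n → EuclideanSpace ℝ (Fin p)} {m : EuclideanSpace ℝ (Fin p)}
    {b e b' e' : ℝ} (h : AccurateSample x m Sig b e) (hb : b ≤ b') (he : e ≤ e') :
    AccurateSample x m Sig b' e' :=
  fun a ha => ⟨fun j => ((h a ha).1 j).trans hb, fun j k => ((h a ha).2 j k).trans he⟩

theorem RegularSample.accurateSample {x : Fin n → EuclideanSpace ℝ (Fin p)}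
    {m : EuclideanSpace ℝ (Fin p)} {z H δ e : ℝ}
    (h : RegularSample (fun i => x i - m) z H δ) (hn : 0 < n) (hp : 0 < p) (hz : 0 < z)
    (hH : 1 ≤ H) (hδ : 1 ≤ √n * δ) (hδ1 : δ ≤ 1)
    (he : ∀ j k, |p * sampleSignCov (fun i => x i - m) 0 j k - p * Sig j k / Sig.trace| ≤ e) :
    AccurateSample x m Sig (100 * H ^ 4 * δ / (z * √p)) (41000 * H ^ 9 * δ + e) := by
  intro a ha
  refine ⟨fun j => h.abs_median_apply_le hn hp hz hH hδ (ha.sub m) j, fun j k => ?_⟩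
  have h1 := h.abs_sampleSignCov_sub_le hn hp hz hH hδ hδ1 (ha.sub m) j k
  rw [sampleSignCov_sub] at h1
  exact (abs_sub_le _ _ _).trans (add_le_add h1 (he j k))

theorem transpose_sampleSignCov (x : Fin n → EuclideanSpace ℝ (Fin p))
    (a : EuclideanSpace ℝ (Fin p)) : (sampleSignCov x a)ᵀ = sampleSignCov x a := by
  ext i j
  simp [sampleSignCov, Matrix.sum_apply, signOuter, mul_comm]

theorem transpose_pooledSignCov (x₀ : Fin n₀ → EuclideanSpace ℝ (Fin p))
    (x₁ : Fin n₁ → EuclideanSpace ℝ (Fin p)) (a₀ a₁ : EuclideanSpace ℝ (Fin p)) :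
    (pooledSignCov x₀ x₁ a₀ a₁)ᵀ = pooledSignCov x₀ x₁ a₀ a₁ := by
  simp [pooledSignCov, transpose_sampleSignCov]

theorem directionErrorLE_of_accurateSample {x₀ : Fin n₀ → EuclideanSpace ℝ (Fin p)}
    {x₁ : Fin n₁ → EuclideanSpace ℝ (Fin p)} {m₀ m₁ : EuclideanSpace ℝ (Fin p)}
    {b e T lam Ms B : ℝ} (hp : 0 < p) (hn₀ : 0 < n₀) (hn₁ : 0 < n₁) (h : Sig.PosDef)
    (h₀ : AccurateSample x₀ m₀ Sig b e) (h₁ : AccurateSample x₁ m₁ Sig b e) (hb : 0 ≤ b)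
    (he : 0 ≤ e) (hT0 : 0 ≤ T) (hT : colSumNorm (shapePrecision Sig) ≤ T) (hlam : T * e ≤ lam)
    (hMs : ∑ i, |(m₁ i - m₀ i) / 2| ≤ Ms) (hB : T * b + 4 * T * lam * Ms ≤ B) :
    DirectionErrorLE x₀ x₁ Sig m₀ m₁ lam B := by
  refine ⟨exists_isSpatialMedian hn₀ x₀, exists_isSpatialMedian hn₁ x₁, fun a₀ a₁ ha₀ ha₁ => ?_⟩
  have hS : ∀ j k, |p * pooledSignCov x₀ x₁ a₀ a₁ j k - p * Sig j k / Sig.trace| ≤ e := by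
    intro j k
    have e0 := (h₀ a₀ ha₀).2 j k
    have e1 := (h₁ a₁ ha₁).2 j k
    have hn0' : (0 : ℝ) < n₀ := by exact_mod_cast hn₀
    have hn1' : (0 : ℝ) < n₁ := by exact_mod_cast hn₁
    set w₀ : ℝ := n₀ / (n₀ + n₁)
    set w₁ : ℝ := n₁ / (n₀ + n₁)
    have hw0 : 0 ≤ w₀ := by positivity
    have hw1 : 0 ≤ w₁ := by positivity
    have hw : w₀ + w₁ = 1 := by simp only [w₀, w₁]; field_simp
    have e2 : p * pooledSignCov x₀ x₁ a₀ a₁ j k - p * Sig j k / Sig.trace =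
        w₀ * (p * sampleSignCov x₀ a₀ j k - p * Sig j k / Sig.trace) +
        w₁ * (p * sampleSignCov x₁ a₁ j k - p * Sig j k / Sig.trace) := by
      have : p * Sig j k / Sig.trace = (w₀ + w₁) * (p * Sig j k / Sig.trace) := by
        rw [hw, one_mul]
      conv_lhs => rw [this]
      simp only [pooledSignCov, Matrix.add_apply, Matrix.smul_apply, smul_eq_mul, w₀, w₁]
      ring
    rw [e2]
    calc _ ≤ w₀ * e + w₁ * e := by
          refine (abs_add_le _ _).trans ?_
          rw [abs_mul, abs_mul, abs_of_nonneg hw0, abs_of_nonneg hw1]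
          gcongr
      _ = e := by rw [← add_mul, hw, one_mul]
  have hW := (maxNorm_mul_shapePrecision_sub_one_le h hp he hT hS).trans hlam
  refine ⟨exists_isClimeSolution hW, fun V hV => le_trans ?_ hB⟩
  refine directionError_le h hV (transpose_pooledSignCov _ _ _ _) hW hT0 hT hb (fun j => ?_) hMs
  have e0 := abs_le.1 ((h₀ a₀ ha₀).1 j)
  have e1 := abs_le.1 ((h₁ a₁ ha₁).1 j)
  exact abs_le.2 ⟨by linarith, by linarith⟩

theorem directionErrorLE_of_one_le {x₀ : Fin n₀ → EuclideanSpace ℝ (Fin p)}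
    {x₁ : Fin n₁ → EuclideanSpace ℝ (Fin p)} {m₀ m₁ : EuclideanSpace ℝ (Fin p)}
    {T lam Ms B : ℝ} (hn₀ : 0 < n₀) (hn₁ : 0 < n₁) (hT0 : 0 ≤ T)
    (hT : colSumNorm (shapePrecision Sig) ≤ T) (hlam : 1 ≤ lam)
    (hMs : ∑ i, |(m₁ i - m₀ i) / 2| ≤ Ms) (hB : T * Ms ≤ B) :
    DirectionErrorLE x₀ x₁ Sig m₀ m₁ lam B := by
  refine ⟨exists_isSpatialMedian hn₀ x₀, exists_isSpatialMedian hn₁ x₁, fun a₀ a₁ _ _ =>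
    ⟨exists_isClimeSolution_of_one_le _ hlam, fun V hV => ?_⟩⟩
  rw [hV.eq_zero_of_one_le hlam]
  exact (directionError_zero_le hT0 hT hMs).trans hB

theorem DirectionErrorLE.mono {x₀ : Fin n₀ → EuclideanSpace ℝ (Fin p)}
    {x₁ : Fin n₁ → EuclideanSpace ℝ (Fin p)} {m₀ m₁ : EuclideanSpace ℝ (Fin p)} {lam B B' : ℝ}
    (h : DirectionErrorLE x₀ x₁ Sig m₀ m₁ lam B) (hB : B ≤ B') :
    DirectionErrorLE x₀ x₁ Sig m₀ m₁ lam B' :=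
  ⟨h.1, h.2.1, fun a₀ a₁ ha₀ ha₁ =>
    ⟨(h.2.2 a₀ a₁ ha₀ ha₁).1, fun V hV => ((h.2.2 a₀ a₁ ha₀ ha₁).2 V hV).trans hB⟩⟩

end Accurate

/-! ### Transfer from product laws to the given observations -/

section Sample
variable {Ω : Type*} [MeasurableSpace Ω] {P : Measure Ω} [IsProbabilityMeasure P] {p n : ℕ}
  {m : EuclideanSpace ℝ (Fin p)} {Sig : Matrix (Fin p) (Fin p) ℝ} {rho : Measure ℝ}
  {X : Fin n → Ω → EuclideanSpace ℝ (Fin p)}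

/-- Events about the centred sample are bounded through the product of the centred laws. -/
theorem measure_centred_sample_le (hX : ∀ i, HasLaw (X i) (ellipticalLaw m Sig rho) P)
    (hi : iIndepFun X P) (B : Set (Fin n → EuclideanSpace ℝ (Fin p))) :
    P {ω | (fun i => X i ω - m) ∈ B} ≤ (Measure.pi fun _ : Fin n => ellipticalLaw 0 Sig rho) B := by
  have hm : ∀ i, AEMeasurable (fun ω => X i ω - m) P := fun i => (hX i).aemeasurable.sub_const m
  have hi' : iIndepFun (fun i ω => X i ω - m) P :=
    hi.comp (fun _ x => x - m) fun _ => by fun_prop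
  have h1 := (iIndepFun_iff_map_fun_eq_pi_map hm).1 hi'
  have h2 : ∀ i, P.map (fun ω => X i ω - m) = ellipticalLaw 0 Sig rho := fun i => by
    rw [← ellipticalLaw_map_sub m, ← (hX i).map_eq,
      AEMeasurable.map_map_of_aemeasurable (by fun_prop) (hX i).aemeasurable]
    rfl
  simp_rw [h2] at h1
  rw [← h1]
  -- This inequality holds for arbitrary sets, so the measurability of events quantifying over all
  -- medians plays no role.
  exact Measure.le_map_apply (aemeasurable_pi_lambda _ hm) B

theorem measure_not_accurateSample_le {η ζ s H δ : ℝ} [IsProbabilityMeasure rho]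
    (h : SignRadiusLaw (ellipticalLaw 0 Sig rho) Sig η ζ s (zetaOne Sig rho))
    (hX : ∀ i, HasLaw (X i) (ellipticalLaw m Sig rho) P) (hi : iIndepFun X P)
    (hp : 3 ≤ p) (hη : 0 < η) (hs : 0 < s) (hζ : 0 < ζ) (hn : 0 < n)
    (hH : DominatingConst H η ζ s) (hpH : H ^ 2 ≤ p)
    (hpw : 128 / η ^ 4 + 2 / s ≤ p) (hpe : Real.exp (-(p / 2)) ≤ 1 / (p : ℝ) ^ 4)
    (hne : n * (2 * Real.exp (-(n / (1024 * H ^ 5)))) ≤ 1)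
    (hδ : 0 ≤ δ) (hδH : 5000 * H ^ 5 * δ ≤ 1) (hl : n * δ ^ 2 = Real.log p) :
    P {ω | ¬ AccurateSample (fun i => X i ω) m Sig (100 * H ^ 4 * δ / (zetaOne Sig rho * √p))
      (41000 * H ^ 9 * δ + (2 * H * δ + 320 / η ^ 4 / √p))} ≤ ENNReal.ofReal (1 / (p : ℝ) ^ 2) := by
  have := isProbabilityMeasure_ellipticalLaw (by omega) 0 Sig rho
  refine le_trans (measure_mono fun ω hω => ?_) ((measure_centred_sample_le hX hi _).trans
    (h.measure_not_regularSample_le hp hη hs hζ hn hH hpH hpw hpe hne hδ hδH hl))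
  intro hc
  refine hω (hc.1.accurateSample hn (by omega) h.z_pos hH.one_le ?_ ?_ hc.2)
  · have hn' : (0 : ℝ) ≤ n := by positivity
    rw [← Real.sqrt_sq hδ, ← Real.sqrt_mul hn', hl]
    apply Real.one_le_sqrt.2
    have : (3 : ℝ) ≤ p := by exact_mod_cast hp
    rw [Real.le_log_iff_exp_le (by linarith)]
    linarith [Real.exp_one_lt_d9]
  · have : 1 ≤ H ^ 5 := one_le_pow₀ hH.one_le
    nlinarith

end Sample

/-! ### Choice of the constants -/

section Constants

/-- The contribution of the radius to the constants. -/
def radiusFactor (ζ Kν : ℝ) : ℝ := 24 * (1 + |ζ| + |Kν|) ^ 2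

/-- The contribution of the eigenvalue bound to the constants. -/
def scatterFactor (η : ℝ) : ℝ := 100 * (1 + 1 / η ^ 2)

/-- The coefficient of the population bias in the tuning parameter. -/
def biasConst (η T : ℝ) : ℝ := 41002 * scatterFactor η ^ 9 * (1 + 1 / |T|) + 320 / η ^ 4

theorem one_le_radiusFactor (ζ Kν : ℝ) : 1 ≤ radiusFactor ζ Kν := by
  unfold radiusFactor
  nlinarith [abs_nonneg ζ, abs_nonneg Kν]

theorem one_le_scatterFactor (η : ℝ) : 1 ≤ scatterFactor η := by
  have : 0 ≤ 1 / η ^ 2 := by positivity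
  unfold scatterFactor
  linarith

theorem biasConst_pos (η T : ℝ) : 0 < biasConst η T := by
  have := one_le_scatterFactor η
  unfold biasConst
  positivity

/-- Every requirement involves only the radius, only `η`, or a product of the two, so a product of
separate factors dominates them all. The product form is what allows `C` and `D` to depend on
disjoint sets of parameters. -/
theorem dominatingConst_mul {η ζ Kν : ℝ} (hη : 0 < η) (hζ : 0 < ζ) (hK : 0 < Kν) :
    DominatingConst (radiusFactor ζ Kν * scatterFactor η) η ζ (1 / (12 * Kν ^ 2)) := by
  have hF1 := one_le_radiusFactor ζ Kν
  have hG1 := one_le_scatterFactor η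
  set t := 1 / η with ht
  have ht0 : 0 < t := by positivity
  have ht2 : 1 / η ^ 2 = t ^ 2 := by rw [ht, one_div_pow]
  have hF : radiusFactor ζ Kν = 24 * (1 + ζ + Kν) ^ 2 := by
    rw [radiusFactor, abs_of_pos hζ, abs_of_pos hK]
  have hG : scatterFactor η = 100 * (1 + t ^ 2) := by rw [scatterFactor, ht2]
  have hFG : radiusFactor ζ Kν ≤ radiusFactor ζ Kν * scatterFactor η :=
    le_mul_of_one_le_right (by linarith) hG1
  have hGF : scatterFactor η ≤ radiusFactor ζ Kν * scatterFactor η :=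
    le_mul_of_one_le_left (by linarith) hF1
  have hFlow : 24 + 24 * Kν ≤ radiusFactor ζ Kν := by rw [hF]; nlinarith [mul_pos hζ hK]
  refine ⟨hF1.trans hFG, ?_, ?_, ?_, ?_, ?_⟩
  · refine le_trans ?_ hFG
    rw [hF]; nlinarith [mul_pos hζ hK]
  · refine le_trans ?_ hFG
    have : 2 / (1 / (12 * Kν ^ 2)) = 24 * Kν ^ 2 := by field_simp; norm_num
    rw [this, hF]; nlinarith [mul_pos hζ hK]
  · refine le_trans ?_ hGF
    have : 100 / η ^ 2 = 100 * t ^ 2 := by rw [← ht2]; ring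
    rw [this, hG]; linarith
  · refine le_trans ?_ hGF
    have : 7 / η = 7 * t := by rw [ht]; ring
    rw [this, hG]; nlinarith [sq_nonneg (t - 1)]
  · have h1 : √(24 / (1 / (12 * Kν ^ 2))) ≤ 17 * Kν := by
      rw [Real.sqrt_le_left (by positivity)]
      have : 24 / (1 / (12 * Kν ^ 2)) = 288 * Kν ^ 2 := by field_simp; norm_num
      rw [this]; nlinarith
    have h2 : 13 / η ^ 2 = 13 * t ^ 2 := by rw [← ht2]; ring
    rw [h2]
    calc _ ≤ 17 * Kν * (13 * t ^ 2) + 1 := by gcongr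
      _ ≤ (24 + 24 * Kν) * scatterFactor η := by
          rw [hG]; nlinarith [mul_pos hK (pow_pos ht0 2)]
      _ ≤ _ := by gcongr

/-- The summand `η² D` inside `8 + η² D` produces `2 C D √(log p / n)`; this product absorbs `H⁹`,
which neither constant could absorb alone. -/
theorem tuning_ge {C D η T H : ℝ} {n p : ℕ} (hη : 0 < η) (hT : 0 < T) (hC : 0 < C)
    (hCD : 41002 * H ^ 9 ≤ C * D) (hD' : 320 / η ^ 4 ≤ D) :
    T * (82004 * H ^ 9 * √(Real.log p / n) + 320 / η ^ 4 / √p) ≤ tuning C D η T n p := by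
  unfold tuning
  have h1 : 82004 * H ^ 9 ≤ 2 * C * (8 + η ^ 2 * D) / η ^ 2 := by
    rw [le_div_iff₀ (by positivity)]
    have : 41002 * H ^ 9 * η ^ 2 ≤ C * D * η ^ 2 := by gcongr
    nlinarith
  gcongr

/-- Here the product `C D` must also absorb `1 / T`; the term `1 + 1 / |T|` in `biasConst` serves
this purpose. -/
theorem lt_one_of_tuning_lt_one {C D η T H : ℝ} {n p : ℕ} (hη : 0 < η) (hT : 0 < T)
    (hC : 0 < C) (hD : 0 < D) (hTD : 41002 * H ^ 9 ≤ T * (C * D))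
    (h : tuning C D η T n p < 1) : 82004 * H ^ 9 * √(Real.log p / n) < 1 := by
  refine lt_of_le_of_lt ?_ h
  unfold tuning
  have h1 : 2 * (C * D) ≤ 2 * C * (8 + η ^ 2 * D) / η ^ 2 := by
    rw [le_div_iff₀ (by positivity)]
    nlinarith
  have h2 : 0 ≤ D / √(p : ℝ) := by positivity
  calc 82004 * H ^ 9 * √(Real.log p / n) = 2 * (41002 * H ^ 9) * √(Real.log p / n) := by ring
    _ ≤ 2 * (T * (C * D)) * √(Real.log p / n) := by gcongr
    _ = T * (2 * (C * D) * √(Real.log p / n)) := by ring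
    _ ≤ T * (2 * C * (8 + η ^ 2 * D) / η ^ 2 * √(Real.log p / n) + D / √p) := by
        gcongr
        have := mul_le_mul_of_nonneg_right h1 (Real.sqrt_nonneg (Real.log p / n))
        linarith

/-- The constant in the rate of convergence. -/
def rateConst (C D η T Ms H : ℝ) : ℝ :=
  T * (200 * H ^ 4 / √η) + 4 * Ms * T ^ 2 * (2 * C * (8 + η ^ 2 * D) / η ^ 2 + D)

theorem rateConst_nonneg {C D η T Ms H : ℝ} (hη : 0 < η) (hT : 0 < T) (hC : 0 < C) (hD : 0 < D)
    (hMs : 0 ≤ Ms) : 0 ≤ rateConst C D η T Ms H := by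
  unfold rateConst; positivity

theorem add_tuning_le_errorBound {C D z η T Ms t : ℝ} {n p : ℕ} (hT : 0 < T)
    (ht : t ≤ 2 * √6 / (z * η ^ 2) * √(Real.log p / n)) :
    T * t + 4 * T * tuning C D η T n p * Ms ≤ errorBound 1 C D z η T Ms n p := by
  have h1 := mul_le_mul_of_nonneg_left ht hT.le
  refine (add_le_add_left h1 _).trans (le_of_eq ?_)
  unfold tuning errorBound
  ring

theorem add_tuning_le_rate {C D η T Ms H t : ℝ} {n p : ℕ} (hη : 0 < η) (hT : 0 < T)
    (hC : 0 < C) (hD : 0 < D) (hMs : 0 ≤ Ms)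
    (ht : t ≤ 200 * H ^ 4 / √η * √(Real.log p / n)) :
    T * t + 4 * T * tuning C D η T n p * Ms ≤
      rateConst C D η T Ms H * (√(Real.log p / n) + 1 / √p) := by
  have h1 := mul_le_mul_of_nonneg_left ht hT.le
  refine (add_le_add_left h1 _).trans ?_
  unfold tuning rateConst
  set x := √(Real.log p / n)
  have hx : 0 ≤ x := Real.sqrt_nonneg _
  set y := 1 / √(p : ℝ) with hy
  have hy0 : 0 ≤ y := by positivity
  have e1 : D / √(p : ℝ) = D * y := by rw [hy]; ring
  rw [e1]
  set a := 200 * H ^ 4 / √η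
  have ha : 0 ≤ a := by positivity
  set b := 2 * C * (8 + η ^ 2 * D) / η ^ 2
  have hb : 0 ≤ b := by positivity
  have h2 : 0 ≤ T * a * y := by positivity
  have h3 : 0 ≤ 4 * Ms * T ^ 2 * (b * y + D * x) := by positivity
  linarith

theorem exists_sample_size_threshold {c : ℝ} (hc : 0 < c) :
    ∃ N : ℕ, ∀ n : ℕ, N ≤ n → (n : ℝ) * (2 * Real.exp (-(n / c))) ≤ 1 := by
  have h1 := (isLittleO_pow_exp_pos_mul_atTop 1 (b := 1 / c) (by positivity)).bound
    (c := 1 / 2) (by norm_num)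
  have h2 := tendsto_natCast_atTop_atTop (R := ℝ) |>.eventually h1
  obtain ⟨N, hN⟩ := Filter.eventually_atTop.1 h2
  refine ⟨N, fun n hn => ?_⟩
  have h3 := hN n hn
  rw [pow_one, Real.norm_of_nonneg (by positivity), Real.norm_of_nonneg (by positivity)] at h3
  have h4 : (n : ℝ) / c = 1 / c * n := by ring
  rw [h4, Real.exp_neg]
  have h5 := Real.exp_pos (1 / c * n)
  rw [← div_eq_mul_inv, mul_div_assoc', div_le_one h5]
  linarith

theorem exists_dimension_threshold (B : ℝ) :
    ∃ N : ℕ, ∀ p : ℕ, N ≤ p → 3 ≤ p ∧ B ≤ p ∧ Real.exp (-(p / 2)) ≤ 1 / (p : ℝ) ^ 4 := by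
  have h1 := (isLittleO_pow_exp_pos_mul_atTop 4 (b := 1 / 2) (by norm_num)).bound
    (c := 1) (by norm_num)
  have h2 := tendsto_natCast_atTop_atTop (R := ℝ) |>.eventually
    (h1.and (Filter.eventually_ge_atTop B))
  obtain ⟨N, hN⟩ := Filter.eventually_atTop.1 (h2.and (Filter.eventually_ge_atTop 3))
  refine ⟨N, fun p hp => ?_⟩
  obtain ⟨⟨h3, h4⟩, h5⟩ := hN p hp
  refine ⟨h5, h4, ?_⟩
  have hp' : (0 : ℝ) < p := by exact_mod_cast (by omega : 0 < p)
  rw [Real.norm_of_nonneg (by positivity), Real.norm_of_nonneg (by positivity), one_mul] at h3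
  have h6 : (p : ℝ) / 2 = 1 / 2 * p := by ring
  rw [h6, Real.exp_neg, one_div ((p : ℝ) ^ 4)]
  exact inv_anti₀ (by positivity) h3

end Constants

/-! ### The error bound with high probability -/

section Main

theorem sqrt_log_div_le {n k p : ℕ} (hn : 0 < n) (h : n ≤ 3 * k) :
    √(Real.log p / k) ≤ 2 * √(Real.log p / n) := by
  have hk : 0 < k := by omega
  have hn' : (0 : ℝ) < n := by exact_mod_cast hn
  have hk' : (0 : ℝ) < k := by exact_mod_cast hk
  have hl : 0 ≤ Real.log p := Real.log_natCast_nonneg p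
  have h' : (n : ℝ) ≤ 3 * k := by exact_mod_cast h
  have h2 : (2 : ℝ) = √4 := by
    rw [show (4 : ℝ) = 2 ^ 2 by norm_num, Real.sqrt_sq (by norm_num)]
  rw [h2, ← Real.sqrt_mul (by norm_num)]
  apply Real.sqrt_le_sqrt
  rw [mul_div_assoc', div_le_div_iff₀ hk' hn']
  nlinarith

universe u

/-- The bound on the direction error holds with high probability. -/
theorem exists_directionError_bound {c₀ η T M ζ ψ Kν Ms : ℝ} (hη : 0 < η) (hT : 0 < T)
    (hζ : 0 < ζ) (hK : 0 < Kν) (hMs : 0 ≤ Ms) :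
    ∃ (N : ℕ) (K : ℝ), 0 ≤ K ∧ ∀ n₀ n₁ p : ℕ, N ≤ n₀ + n₁ → N ≤ p →
      n₀ + n₁ ≤ 3 * n₀ → n₀ + n₁ ≤ 3 * n₁ → ∀ (q s₀ : ℝ)
      (m₀ m₁ : EuclideanSpace ℝ (Fin p)) (Sig : Matrix (Fin p) (Fin p) ℝ) (rho : Measure ℝ),
      TwoClassModel m₀ m₁ Sig rho c₀ η T M q s₀ ζ ψ Kν Ms →
      ∀ (Ω : Type u) [MeasurableSpace Ω] (P : Measure Ω) [IsProbabilityMeasure P]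
        (X₀ : Fin n₀ → Ω → EuclideanSpace ℝ (Fin p))
        (X₁ : Fin n₁ → Ω → EuclideanSpace ℝ (Fin p)),
      TwoClassSample P m₀ m₁ Sig rho X₀ X₁ →
      P {ω | ¬ DirectionErrorLE (fun i => X₀ i ω) (fun i => X₁ i ω) Sig m₀ m₁
          (tuning (radiusFactor ζ Kν ^ 9) (biasConst η T) η T (n₀ + n₁) p)
          (min (errorBound 1 (radiusFactor ζ Kν ^ 9) (biasConst η T) (zetaOne Sig rho) η T Ms
              (n₀ + n₁) p)
            (K * (√(Real.log p / ((n₀ + n₁ : ℕ) : ℝ)) + 1 / √p)))}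
        < ENNReal.ofReal (4 / (p : ℝ) ^ 2) := by
  set H := radiusFactor ζ Kν * scatterFactor η with hHdef
  set C := radiusFactor ζ Kν ^ 9 with hCdef
  set D := biasConst η T with hDdef
  have hdom : DominatingConst H η ζ (1 / (12 * Kν ^ 2)) := dominatingConst_mul hη hζ hK
  have hH1 := hdom.one_le
  have hH0 : 0 < H := by linarith
  have hC : 0 < C := pow_pos (by linarith [one_le_radiusFactor ζ Kν]) 9
  have hD : 0 < D := biasConst_pos η T
  have hD' : 320 / η ^ 4 ≤ D := by
    have := one_le_scatterFactor η
    rw [hDdef, biasConst]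
    linarith [show 0 ≤ 41002 * scatterFactor η ^ 9 * (1 + 1 / |T|) by positivity]
  have hCD1 : 41002 * H ^ 9 * (1 + 1 / T) ≤ C * D := by
    have e1 : 41002 * H ^ 9 * (1 + 1 / T) =
        C * (41002 * scatterFactor η ^ 9 * (1 + 1 / |T|)) := by
      rw [hHdef, hCdef, mul_pow, abs_of_pos hT]; ring
    rw [e1, hDdef, biasConst]
    gcongr
    linarith [show 0 ≤ 320 / η ^ 4 by positivity]
  have hH9 : 0 < 41002 * H ^ 9 := by positivity
  have hCD : 41002 * H ^ 9 ≤ C * D := by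
    have : 0 ≤ 41002 * H ^ 9 * (1 / T) := by positivity
    linarith
  have hTD : 41002 * H ^ 9 ≤ T * (C * D) := by
    have h1 := mul_le_mul_of_nonneg_left hCD1 hT.le
    have h2 : T * (41002 * H ^ 9 * (1 + 1 / T)) = T * (41002 * H ^ 9) + 41002 * H ^ 9 := by
      field_simp
    have h3 : 0 ≤ T * (41002 * H ^ 9) := by positivity
    linarith
  set s := 1 / (12 * Kν ^ 2) with hs
  have hs0 : 0 < s := by positivity
  obtain ⟨N₁, hN₁⟩ := exists_sample_size_threshold (c := 1024 * H ^ 5) (by positivity)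
  obtain ⟨N₂, hN₂⟩ := exists_dimension_threshold
    (max (H ^ 2) (max (128 / η ^ 4 + 2 / s) ((50 * H ^ 4 * η ^ 2) ^ 2)))
  -- Each class has at least a third of the observations, so `3 N₁ + 1` makes both class sizes
  -- positive and at least `N₁`.
  refine ⟨max (3 * N₁ + 1) N₂, rateConst C D η T Ms H, rateConst_nonneg hη hT hC hD hMs, ?_⟩
  intro n₀ n₁ p hn hp hb₀ hb₁ q s₀ m₀ m₁ Sig rho hmod Ω _ P _ X₀ X₁ hX
  obtain ⟨hp3, hpB, hpe⟩ := hN₂ p (by omega)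
  simp only [max_le_iff] at hpB
  obtain ⟨hpH, hpw, hpη⟩ := hpB
  have hn0 : 0 < n₀ := by omega
  have hn1 : 0 < n₁ := by omega
  have hp0 : 0 < p := by omega
  have hp' : (0 : ℝ) < p := by exact_mod_cast hp0
  have hsp : 0 < √(p : ℝ) := Real.sqrt_pos.2 hp'
  have hprob := hmod.prob
  have hpd := hmod.scatter.posDef
  have hcol := hmod.scatter.colSum_le
  have he1 := fun i => (hmod.scatter.eig i).1.le
  have he2 := fun i => (hmod.scatter.eig i).2.le
  have hlaw := signRadiusLaw_ellipticalLaw (by omega) hpd hη he1 he2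
    hmod.second_moment_integrable hmod.second_moment hK hmod.radius₀
  set z := zetaOne Sig rho
  have hz : 0 < z := hlaw.z_pos
  have hzη : √η ≤ z * √p := by
    have h1 := sqrt_div_le_zetaOne hp0 hpd hη he2 hmod.second_moment_integrable
      hmod.second_moment hmod.radius₀.ae_ne_zero
      (by simpa using hmod.radius₀.integrable_pow (k := 1) (by simp))
    rw [Real.sqrt_div hη.le, div_le_iff₀ hsp] at h1
    exact h1
  set x := √(Real.log p / ((n₀ + n₁ : ℕ) : ℝ)) with hx
  have hx0 : 0 ≤ x := Real.sqrt_nonneg _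
  have htun0 : 0 < tuning C D η T (n₀ + n₁) p := by
    unfold tuning
    have : 0 ≤ 2 * C * (8 + η ^ 2 * D) / η ^ 2 * √(Real.log p / ((n₀ + n₁ : ℕ) : ℝ)) := by
      positivity
    positivity
  set lam := tuning C D η T (n₀ + n₁) p with hlam
  -- For `lam ≥ 1` the exceptional event is empty: the estimator vanishes, and its error `T Ms` is
  -- below `4 T lam Ms`.
  rcases le_or_gt 1 lam with h1 | h1
  · have : {ω | ¬ DirectionErrorLE (fun i => X₀ i ω) (fun i => X₁ i ω) Sig m₀ m₁ lam
        (min (errorBound 1 C D z η T Ms (n₀ + n₁) p)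
          (rateConst C D η T Ms H * (x + 1 / √p)))} = ∅ := by
      rw [Set.eq_empty_iff_forall_notMem]
      intro ω hω
      refine hω (directionErrorLE_of_one_le hn0 hn1 hT.le hcol h1 hmod.mean_diff ?_)
      have h2 : T * Ms ≤ T * 0 + 4 * T * lam * Ms := by
        have : 0 ≤ T * Ms := by positivity
        nlinarith
      refine h2.trans (le_min ?_ ?_)
      · exact add_tuning_le_errorBound hT (by positivity)
      · exact add_tuning_le_rate hη hT hC hD hMs (by positivity)
    rw [this, measure_empty]
    exact ENNReal.ofReal_pos.2 (by positivity)
  have hsmall := lt_one_of_tuning_lt_one hη hT hC hD hTD h1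
  rw [← hx] at hsmall
  have hacc : ∀ (k : ℕ) (m : EuclideanSpace ℝ (Fin p)) (X : Fin k → Ω → EuclideanSpace ℝ (Fin p)),
      n₀ + n₁ ≤ 3 * k → (∀ i, HasLaw (X i) (ellipticalLaw m Sig rho) P) → iIndepFun X P →
      P {ω | ¬ AccurateSample (fun i => X i ω) m Sig (200 * H ^ 4 * x / (z * √p))
        (82004 * H ^ 9 * x + 320 / η ^ 4 / √p)} ≤ ENNReal.ofReal (1 / (p : ℝ) ^ 2) := by
    intro k m X hk hXl hXi
    have hk0 : 0 < k := by omega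
    have hk' : (0 : ℝ) < k := by exact_mod_cast hk0
    set δ := √(Real.log p / k) with hδ
    have hδ0 : 0 ≤ δ := Real.sqrt_nonneg _
    have hδx : δ ≤ 2 * x := sqrt_log_div_le (by omega) hk
    have hl : k * δ ^ 2 = Real.log p := by
      rw [hδ, Real.sq_sqrt (div_nonneg (Real.log_natCast_nonneg p) hk'.le)]
      field_simp
    have hHpow : H ^ 5 ≤ H ^ 9 := pow_le_pow_right₀ hH1 (by norm_num)
    have hδH : 5000 * H ^ 5 * δ ≤ 1 := by
      calc 5000 * H ^ 5 * δ ≤ 5000 * H ^ 9 * (2 * x) := by gcongr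
        _ ≤ 1 := by
          have : 0 ≤ H ^ 9 * x := by positivity
          linarith
    have hmain := measure_not_accurateSample_le hlaw hXl hXi hp3 hη hs0 hζ hk0 hdom hpH hpw hpe
      (hN₁ k (by omega)) hδ0 hδH hl
    refine le_trans (measure_mono fun ω hω (hc : AccurateSample _ _ _ _ _) =>
      hω (hc.mono ?_ ?_)) hmain
    · refine div_le_div_of_nonneg_right ?_ (by positivity)
      calc 100 * H ^ 4 * δ ≤ 100 * H ^ 4 * (2 * x) := by gcongr
        _ = _ := by ring
    · have hH9' : H ≤ H ^ 9 := le_self_pow₀ hH1 (by norm_num)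
      calc _ ≤ 41000 * H ^ 9 * (2 * x) + (2 * H ^ 9 * (2 * x) + 320 / η ^ 4 / √p) := by gcongr
        _ = _ := by ring
  have hP0 := hacc n₀ m₀ X₀ hb₀ hX.law₀ (hX.indep.precomp (g := Sum.inl) Sum.inl_injective)
  have hP1 := hacc n₁ m₁ X₁ hb₁ hX.law₁ (hX.indep.precomp (g := Sum.inr) Sum.inr_injective)
  -- The coordinatewise median error has a spare factor `1 / √p`. For `p ≥ (50 H⁴ η²)²` it swallows
  -- `H`, leaving the constant `2 √6` with `A = 1`, as `4 ≤ 2 √6`.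
  have hbz : 200 * H ^ 4 * x / (z * √p) ≤ 2 * √6 / (z * η ^ 2) * x := by
    have h50 : 50 * H ^ 4 * η ^ 2 ≤ √p := Real.le_sqrt_of_sq_le hpη
    have h6 : 2 ≤ √(6 : ℝ) := Real.le_sqrt_of_sq_le (by norm_num)
    rw [div_mul_eq_mul_div, div_le_div_iff₀ (by positivity) (by positivity)]
    calc 200 * H ^ 4 * x * (z * η ^ 2) = 4 * (50 * H ^ 4 * η ^ 2) * (x * z) := by ring
      _ ≤ (2 * √6) * √p * (x * z) := by
          gcongr
          linarith
      _ = _ := by ring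
  -- For the uniform rate the spare factor is spent instead on `z`, through `z √p ≥ √η`.
  have hbη : 200 * H ^ 4 * x / (z * √p) ≤ 200 * H ^ 4 / √η * x := by
    rw [div_mul_eq_mul_div]
    have := Real.sqrt_pos.2 hη
    gcongr
  have hT' := tuning_ge (n := n₀ + n₁) (p := p) hη hT hC hCD hD'
  rw [← hx, ← hlam] at hT'
  calc _ ≤ P ({ω | ¬ AccurateSample (fun i => X₀ i ω) m₀ Sig (200 * H ^ 4 * x / (z * √p))
        (82004 * H ^ 9 * x + 320 / η ^ 4 / √p)} ∪
        {ω | ¬ AccurateSample (fun i => X₁ i ω) m₁ Sig (200 * H ^ 4 * x / (z * √p))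
        (82004 * H ^ 9 * x + 320 / η ^ 4 / √p)}) := by
        refine measure_mono fun ω hω => ?_
        by_contra hc
        simp only [Set.mem_union, not_or, Set.mem_ofPred_eq, not_not] at hc
        refine hω (directionErrorLE_of_accurateSample hp0 hn0 hn1 hpd hc.1 hc.2 (by positivity)
          (by positivity) hT.le hcol hT' hmod.mean_diff (le_min ?_ ?_))
        · exact add_tuning_le_errorBound hT hbz
        · exact add_tuning_le_rate hη hT hC hD hMs hbη
    _ ≤ ENNReal.ofReal (1 / (p : ℝ) ^ 2) + ENNReal.ofReal (1 / (p : ℝ) ^ 2) :=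
        (measure_union_le _ _).trans (add_le_add hP0 hP1)
    _ = ENNReal.ofReal (2 / (p : ℝ) ^ 2) := by
        rw [← ENNReal.ofReal_add (by positivity) (by positivity)]
        congr 1; ring
    _ < _ := by
        rw [ENNReal.ofReal_lt_ofReal_iff (by positivity)]
        gcongr
        norm_num

end Main
end

/-! ### The explicit bound, the rate and consistency -/

theorem theorem5 :
    -- `A` is an absolute constant, `C` depends on `ζ, ψ, Kν` only, `D` on `c₀, η, T, M` only
    ∃ (A : ℝ) (C : ℝ → ℝ → ℝ → ℝ) (D : ℝ → ℝ → ℝ → ℝ → ℝ),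
      0 < A ∧ (∀ ζ ψ Kν, 0 < C ζ ψ Kν) ∧ (∀ c₀ η T M, 0 < D c₀ η T M) ∧
      ∀ c₀ η T M ζ ψ Kν Mstar : ℝ,
        0 < c₀ → 0 < η → 0 < T → 0 < M → 0 < ζ → 0 < ψ → 0 < Kν → 0 ≤ Mstar →
        -- the explicit bound, and the rate
        (∃ (N : ℕ) (K : ℝ), ∀ n₀ n₁ p : ℕ, N ≤ n₀ + n₁ → N ≤ p →
          n₀ + n₁ ≤ 3 * n₀ → n₀ + n₁ ≤ 3 * n₁ →
          (3 * Real.log p) ^ (1 / 3 : ℝ) < ((n₀ + n₁ : ℕ) : ℝ) →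
          ∀ (q s₀ : ℝ), 0 ≤ q → q < 1 → 0 < s₀ →
          ∀ (m₀ m₁ : EuclideanSpace ℝ (Fin p)) (Sig : Matrix (Fin p) (Fin p) ℝ) (rho : Measure ℝ),
          TwoClassModel m₀ m₁ Sig rho c₀ η T M q s₀ ζ ψ Kν Mstar →
          ∀ (Ω : Type*) [MeasurableSpace Ω] (P : Measure Ω) [IsProbabilityMeasure P]
            (X₀ : Fin n₀ → Ω → EuclideanSpace ℝ (Fin p))
            (X₁ : Fin n₁ → Ω → EuclideanSpace ℝ (Fin p)),
          TwoClassSample P m₀ m₁ Sig rho X₀ X₁ →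
          P {ω | ¬ DirectionErrorLE (fun i => X₀ i ω) (fun i => X₁ i ω) Sig m₀ m₁
              (tuning (C ζ ψ Kν) (D c₀ η T M) η T (n₀ + n₁) p)
              (min (errorBound A (C ζ ψ Kν) (D c₀ η T M) (zetaOne Sig rho) η T Mstar (n₀ + n₁) p)
                (K * (√(Real.log p / ((n₀ + n₁ : ℕ) : ℝ)) + 1 / √p)))}
            < ENNReal.ofReal (4 / (p : ℝ) ^ 2)) ∧
        -- consistency, uniformly over the model, when `n, p` are large and `log p / n` is small
        (∀ ε : ℝ, 0 < ε → ∃ (N : ℕ) (δ : ℝ), 0 < δ ∧ ∀ n₀ n₁ p : ℕ, N ≤ n₀ + n₁ → N ≤ p →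
          n₀ + n₁ ≤ 3 * n₀ → n₀ + n₁ ≤ 3 * n₁ →
          Real.log p / ((n₀ + n₁ : ℕ) : ℝ) ≤ δ →
          ∀ (q s₀ : ℝ), 0 ≤ q → q < 1 → 0 < s₀ →
          ∀ (m₀ m₁ : EuclideanSpace ℝ (Fin p)) (Sig : Matrix (Fin p) (Fin p) ℝ) (rho : Measure ℝ),
          TwoClassModel m₀ m₁ Sig rho c₀ η T M q s₀ ζ ψ Kν Mstar →
          ∀ (Ω : Type*) [MeasurableSpace Ω] (P : Measure Ω) [IsProbabilityMeasure P]
            (X₀ : Fin n₀ → Ω → EuclideanSpace ℝ (Fin p))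
            (X₁ : Fin n₁ → Ω → EuclideanSpace ℝ (Fin p)),
          TwoClassSample P m₀ m₁ Sig rho X₀ X₁ →
          P {ω | ¬ DirectionErrorLE (fun i => X₀ i ω) (fun i => X₁ i ω) Sig m₀ m₁
              (tuning (C ζ ψ Kν) (D c₀ η T M) η T (n₀ + n₁) p) ε}
            ≤ ENNReal.ofReal ε) := by
  refine ⟨1, fun ζ _ Kν => radiusFactor ζ Kν ^ 9, fun _ η T _ => biasConst η T, one_pos,
    fun ζ _ Kν => pow_pos (by linarith [one_le_radiusFactor ζ Kν]) 9,
    fun _ η T _ => biasConst_pos η T, ?_⟩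
  intro c₀ η T M ζ ψ Kν Mstar _ hη hT _ hζ _ hK hMs
  refine ⟨?_, fun ε hε => ?_⟩
  · obtain ⟨N, K, -, hmain⟩ := exists_directionError_bound (c₀ := c₀) (M := M) (ψ := ψ)
      hη hT hζ hK hMs
    exact ⟨N, K, fun n₀ n₁ p hn hp hb₀ hb₁ _ q s₀ _ _ _ => hmain n₀ n₁ p hn hp hb₀ hb₁ q s₀⟩
  obtain ⟨N, K, hK0, hmain⟩ := exists_directionError_bound (c₀ := c₀) (M := M) (ψ := ψ)
    hη hT hζ hK hMs
  -- The first threshold makes `4 / p² ≤ ε`, the second `K / √p ≤ ε / 2`; the choice of `δ` below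
  -- makes the sampling term at most `ε / 2`, with `K + 1` in place of `K` to avoid dividing by
  -- zero.
  obtain ⟨N', hN'⟩ := exists_dimension_threshold (max (4 / ε) ((2 * K / ε) ^ 2))
  refine ⟨max N N', (ε / (2 * (K + 1))) ^ 2, by positivity, ?_⟩
  intro n₀ n₁ p hn hp hb₀ hb₁ hδ q s₀ _ _ _ m₀ m₁ Sig rho hmod Ω _ P _ X₀ X₁ hX
  have hlt := hmain n₀ n₁ p (by omega) (by omega) hb₀ hb₁ q s₀ m₀ m₁ Sig rho hmod Ω P X₀ X₁ hX
  obtain ⟨hp3, hpB, -⟩ := hN' p (by omega)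
  simp only [max_le_iff] at hpB
  have hp' : (3 : ℝ) ≤ p := by exact_mod_cast hp3
  have hsp : 0 < √(p : ℝ) := Real.sqrt_pos.2 (by linarith)
  refine le_trans (measure_mono fun ω hω (hc : DirectionErrorLE _ _ _ _ _ _ _) =>
    hω (hc.mono ((min_le_right _ _).trans ?_)))
    (hlt.le.trans (ENNReal.ofReal_le_ofReal ?_))
  · have h1 : K * √(Real.log p / ((n₀ + n₁ : ℕ) : ℝ)) ≤ ε / 2 := by
      have h2 := Real.sqrt_le_sqrt hδ
      rw [Real.sqrt_sq (by positivity)] at h2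
      calc _ ≤ (K + 1) * (ε / (2 * (K + 1))) := by gcongr; linarith
        _ = ε / 2 := by field_simp
    have h3 : K * (1 / √p) ≤ ε / 2 := by
      have h4 : 2 * K / ε ≤ √p := Real.le_sqrt_of_sq_le hpB.2
      rw [div_le_iff₀ hε] at h4
      rw [mul_one_div, div_le_iff₀ hsp]
      linarith
    rw [mul_add]
    linarith
  · have h5 := hpB.1
    rw [div_le_iff₀ hε] at h5
    rw [div_le_iff₀ (by positivity)]
    nlinarith
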